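/- For a group $G$, let $\mathrm{Sub}(G)\subset\{0,1\}^G$ be the space of subgroups of $G$ with the Chabauty topology (induced by the product topology), on which $G$ acts by conjugation. A uniformly recurrent subgroup (URS) of $G$ is a non-empty closed conjugation-invariant subset of $\mathrm{Sub}(G)$ that contains no smaller non-empty closed conjugation-invariant subset. A normal subgroup $N$ of $G$ is identified with the URS $\{N\}$; in particular $1$ and $G$ stand for $\{\{1\}\}$ and $\{G\}$. If $G$ acts minimally by homeomorphisms on a compact space $X$, its stabilizer URS is the closure in $\mathrm{Sub}(G)$ of the set of stabilizers $G_x$, where $x$ runs over the points of $X$ at which the map $X\to\mathrm{Sub}(G)$, $y\mapsto G_y$, is continuous. Thompson's group $T$ is the group of orientation-preserving homeomorphisms of $\mathbb{S}^1=\mathbb{R}/\mathbb{Z}$ that are piecewise linear with finitely many breakpoints, all of them dyadic, with slopes in $2^{\mathbb{Z}}$, and that preserve the set of dyadic points $\mathbb{Z}[1/2]/\mathbb{Z}$. Thompson's group $F$ is the stabilizer of $0\in\mathbb{S}^1$ in $T$. Thompson's group $V$ is the group of homeomorphisms $g$ of the binary Cantor set $\mathcal{C}=\{0,1\}^{\mathbb{N}}$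 for which there are two partitions $\{C_{w_1},\dots,C_{w_n}\}$ and $\{C_{z_1},\dots,C_{z_n}\}$ of $\mathcal{C}$ into cylinders such that $g(w_i x)=z_i x$ for every $i$ and every $x\in\mathcal{C}$, where $C_w$ denotes the set of sequences with prefix $w$. Theorem. (i) The URS's of $F$ are exactly its normal subgroups. The URS's of the derived subgroup $[F,F]$ are exactly $1$ and $[F,F]$. (ii) The URS's of $T$ are exactly $1$, $T$ and the stabilizer URS of the action of $T$ on $\mathbb{S}^1$. (iii) The URS's of $V$ are exactly $1$, $V$ and the stabilizer URS of the action of $V$ on $\mathcal{C}$. -/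

import Mathlib

open Topology Filter

/-! ### The Chabauty space and uniformly recurrent subgroups -/

/-- The Chabauty topology on the space of subgroups of a (discrete) group `G`: the topology
induced by the embedding `H ↦ 1_H` into `{0,1}^G`, where `{0,1}` is discrete (hence `Bool`)
and `{0,1}^G` has the product topology. -/
noncomputable instance chabautyTopology (G : Type*) [Group G] : TopologicalSpace (Subgroup G) :=
  open Classical in
  TopologicalSpace.induced (fun (H : Subgroup G) (g : G) => decide (g ∈ H)) inferInstance

/-- The conjugate `g H g⁻¹`. -/
def conjSubgroup {G : Type*} [Group G] (g : G) (H : Subgroup G) : Subgroup G :=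
  H.map (MulAut.conj g).toMonoidHom

/-- A set of subgroups which is invariant under conjugation. -/
def IsConjInvariant {G : Type*} [Group G] (A : Set (Subgroup G)) : Prop :=
  ∀ g : G, ∀ H ∈ A, conjSubgroup g H ∈ A

/-- A uniformly recurrent subgroup of `G`: a non-empty closed conjugation-invariant subset of
the Chabauty space of `G` which is minimal, i.e. which contains no smaller non-empty closed
conjugation-invariant set. -/
structure IsURS {G : Type*} [Group G] (A : Set (Subgroup G)) : Prop where
  nonempty : A.Nonempty
  isClosed : IsClosed A
  invariant : IsConjInvariant A
  minimal : ∀ B : Set (Subgroup G), B ⊆ A → B.Nonempty → IsClosed B → IsConjInvariant B → B = A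

/-- The stabilizer URS `S_G(X)`: the closure of the set of the point stabilizers `G_x`, where
`x` runs over the points at which the map `y ↦ G_y` is continuous. -/
def stabilizerURS (G X : Type*) [Group G] [MulAction G X] [TopologicalSpace X] :
    Set (Subgroup G) :=
  closure {H | ∃ x : X, ContinuousAt (fun y : X => MulAction.stabilizer G y) x ∧
    H = MulAction.stabilizer G x}

/-! ### Groups of homeomorphisms -/

/-- The tautological action of the group of homeomorphisms of `X` on `X`. -/
instance homeomorphAction (X : Type*) [TopologicalSpace X] : MulAction (X ≃ₜ X) X where
  smul f x := f x
  one_smul _ := rfl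
  mul_smul _ _ _ := rfl

/-! ### Thompson's groups `T` and `F` -/

/-- The dyadic points of the circle `ℝ/ℤ`: the classes of the numbers `m / 2^n`. -/
def dyadicPoints : Set UnitAddCircle :=
  {x | ∃ (m : ℤ) (n : ℕ), x = (((m : ℝ) / 2 ^ n : ℝ) : UnitAddCircle)}

/-- Near the point `x`, the map `f` of the circle is affine with slope `2^k`. -/
def HasDyadicSlopeAt (f : UnitAddCircle → UnitAddCircle) (x : UnitAddCircle) (k : ℤ) : Prop :=
  ∀ᶠ t : ℝ in 𝓝 0, f (x + (t : UnitAddCircle)) = f x + (((2 : ℝ) ^ k * t : ℝ) : UnitAddCircle)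

/-- The points near which `f` is not affine with a slope in `2^ℤ`. -/
def breakpoints (f : UnitAddCircle → UnitAddCircle) : Set UnitAddCircle :=
  {x | ¬ ∃ k : ℤ, HasDyadicSlopeAt f x k}

/-- Thompson's group `T`: the homeomorphisms of the circle `ℝ/ℤ` which are piecewise linear with
slopes in `2^ℤ`, with only finitely many breakpoints, all dyadic, and which preserve the set of
dyadic points. (Such a homeomorphism preserves the orientation since its slopes are positive.) -/
def ThompsonT : Subgroup (UnitAddCircle ≃ₜ UnitAddCircle) where
  carrier := {f | (breakpoints f).Finite ∧ breakpoints f ⊆ dyadicPoints ∧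
    ∀ x, f x ∈ dyadicPoints ↔ x ∈ dyadicPoints}
  one_mem' := by
    have h : breakpoints (1 : UnitAddCircle ≃ₜ UnitAddCircle) = ∅ := by
      ext x
      simp only [breakpoints, Set.mem_ofPred_eq, Set.mem_empty_iff_false, iff_false, not_not]
      exact ⟨0, Eventually.of_forall fun t => by simp⟩
    refine ⟨by rw [h]; exact Set.finite_empty, by rw [h]; exact Set.empty_subset _, ?_⟩
    intro x
    rfl
  mul_mem' := by
    rintro f g ⟨hf1, hf2, hf3⟩ ⟨hg1, hg2, hg3⟩
    have h : breakpoints (f * g : UnitAddCircle ≃ₜ UnitAddCircle) ⊆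
        breakpoints g ∪ g ⁻¹' breakpoints f := by
      intro x hx
      by_contra hx'
      simp only [Set.mem_union, Set.mem_preimage, breakpoints, Set.mem_ofPred_eq, not_or,
        not_not] at hx'
      obtain ⟨⟨k, hk⟩, l, hl⟩ := hx'
      refine hx ⟨l + k, ?_⟩
      have ht : Tendsto (fun t : ℝ => (2 : ℝ) ^ k * t) (𝓝 0) (𝓝 0) := by
        have : Continuous (fun t : ℝ => (2 : ℝ) ^ k * t) := by fun_prop
        simpa using this.tendsto 0
      filter_upwards [hk, ht.eventually hl] with t h1 h2
      change f (g (x + t)) = f (g x) + _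
      rw [h1, h2, zpow_add₀ two_ne_zero, mul_assoc]
    refine ⟨(hg1.union (hf1.preimage g.injective.injOn)).subset h, fun x hx => ?_, fun x => ?_⟩
    · rcases h hx with h' | h'
      · exact hg2 h'
      · exact (hg3 x).1 (hf2 h')
    · exact (hf3 (g x)).trans (hg3 x)
  inv_mem' := by
    rintro f ⟨hf1, hf2, hf3⟩
    have h : breakpoints (f⁻¹ : UnitAddCircle ≃ₜ UnitAddCircle) ⊆ f.symm ⁻¹' breakpoints f := by
      intro y hy
      by_contra hy'
      simp only [Set.mem_preimage, breakpoints, Set.mem_ofPred_eq, not_not] at hy'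
      obtain ⟨k, hk⟩ := hy'
      refine hy ⟨-k, ?_⟩
      have ht : Tendsto (fun t : ℝ => (2 : ℝ) ^ (-k) * t) (𝓝 0) (𝓝 0) := by
        have : Continuous (fun t : ℝ => (2 : ℝ) ^ (-k) * t) := by fun_prop
        simpa using this.tendsto 0
      filter_upwards [ht.eventually hk] with t h1
      change f.symm (y + t) = f.symm y + _
      rw [Homeomorph.symm_apply_eq, h1, f.apply_symm_apply, ← mul_assoc,
        ← zpow_add₀ two_ne_zero]
      simp
    have h3 : ∀ y, f.symm y ∈ dyadicPoints ↔ y ∈ dyadicPoints := fun y => by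
      rw [← hf3 (f.symm y), f.apply_symm_apply]
    exact ⟨(hf1.preimage f.symm.injective.injOn).subset h,
      fun y hy => (h3 y).1 (hf2 (h hy)), h3⟩

/-- Thompson's group `F`: the subgroup of `T` that stabilizes the point `0` of the circle. -/
def ThompsonF : Subgroup ThompsonT :=
  MulAction.stabilizer ThompsonT (0 : UnitAddCircle)

/-! ### Thompson's group `V` -/

/-- The binary Cantor set `{0,1}^ℕ`, with the product topology. -/
abbrev BinaryCantor : Type := ℕ → Bool

/-- The concatenation `w x` of a finite word `w` and an infinite binary sequence `x`. -/
def prependWord : List Bool → BinaryCantor → BinaryCantor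
  | [], x => x
  | b :: w, x => fun n => Nat.casesOn n b (prependWord w x)

/-- The cylinder `C_w`: the sequences that have `w` as an initial prefix. -/
def wordCylinder (w : List Bool) : Set BinaryCantor :=
  Set.range (prependWord w)

/-- The cylinders of the words `w 0, …, w (n-1)` form a partition of the Cantor set. -/
def IsCylinderPartition {n : ℕ} (w : Fin n → List Bool) : Prop :=
  (∀ i j, i ≠ j → Disjoint (wordCylinder (w i)) (wordCylinder (w j))) ∧
    ⋃ i, wordCylinder (w i) = Set.univ

/-- There are cylinder partitions `{C_{w_1}, …, C_{w_n}}` and `{C_{z_1}, …, C_{z_n}}` such that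
`g (w_i x) = z_i x` for every `i` and every binary sequence `x`. -/
def IsPrefixExchange (g : BinaryCantor → BinaryCantor) : Prop :=
  ∃ (n : ℕ) (w z : Fin n → List Bool), IsCylinderPartition w ∧ IsCylinderPartition z ∧
    ∀ i x, g (prependWord (w i) x) = prependWord (z i) x

theorem prependWord_append (u v : List Bool) (x : BinaryCantor) :
    prependWord (u ++ v) x = prependWord u (prependWord v x) := by
  induction u with
  | nil => rfl
  | cons b u ih => simp only [List.cons_append, prependWord, ih]

theorem prependWord_cons_inj {b c : Bool} {u v : List Bool} {x y : BinaryCantor}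
    (h : prependWord (b :: u) x = prependWord (c :: v) y) :
    b = c ∧ prependWord u x = prependWord v y :=
  ⟨congrFun h 0, funext fun n => congrFun h (n + 1)⟩

theorem exists_prependWord (N : ℕ) (x : BinaryCantor) :
    ∃ (w : List Bool) (y : BinaryCantor), w.length = N ∧ prependWord w y = x := by
  induction N generalizing x with
  | zero => exact ⟨[], x, rfl, rfl⟩
  | succ N ih =>
    obtain ⟨w, y, hw, h⟩ := ih (fun n => x (n + 1))
    refine ⟨x 0 :: w, y, by simp [hw], ?_⟩
    funext n
    cases n with
    | zero => rfl
    | succ n => exact congrFun h n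

theorem prefix_of_prependWord_eq {u v : List Bool} {x y : BinaryCantor}
    (hl : u.length ≤ v.length) (h : prependWord u x = prependWord v y) :
    ∃ s, v = u ++ s := by
  induction u generalizing v with
  | nil => exact ⟨v, rfl⟩
  | cons b u ih =>
    cases v with
    | nil => simp at hl
    | cons c v =>
      obtain ⟨rfl, h'⟩ := prependWord_cons_inj h
      obtain ⟨s, rfl⟩ := ih (by simpa using hl) h'
      exact ⟨s, rfl⟩

theorem eq_of_prependWord_eq {u v : List Bool} {x y : BinaryCantor}
    (hl : u.length = v.length) (h : prependWord u x = prependWord v y) : u = v := by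
  obtain ⟨s, rfl⟩ := prefix_of_prependWord_eq hl.le h
  have : s = [] := by simpa using hl
  simp [this]

theorem prependWord_injective (w : List Bool) : Function.Injective (prependWord w) := by
  induction w with
  | nil => exact fun _ _ h => h
  | cons b w ih => exact fun _ _ h => ih (prependWord_cons_inj h).2

theorem IsPrefixExchange.exists_depth {g : BinaryCantor → BinaryCantor} (hg : IsPrefixExchange g) :
    ∃ N, ∀ w : List Bool, N ≤ w.length →
      ∃ z, ∀ x, g (prependWord w x) = prependWord z x := by
  obtain ⟨n, w, z, ⟨-, hw⟩, -, h⟩ := hg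
  refine ⟨∑ i, (w i).length, fun u hu => ?_⟩
  have hx : prependWord u (fun _ => false) ∈ ⋃ i, wordCylinder (w i) := hw ▸ Set.mem_univ _
  obtain ⟨i, y, hy⟩ := Set.mem_iUnion.1 hx
  have hi : (w i).length ≤ ∑ i, (w i).length :=
    Finset.single_le_sum (f := fun i => (w i).length) (fun _ _ => Nat.zero_le _)
      (Finset.mem_univ i)
  obtain ⟨s, rfl⟩ := prefix_of_prependWord_eq (hi.trans hu) hy
  exact ⟨z i ++ s, fun x => by rw [prependWord_append, h, prependWord_append]⟩

theorem isPrefixExchange_of_depth {g : BinaryCantor → BinaryCantor} (hb : Function.Bijective g)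
    {N : ℕ} (hN : ∀ w : List Bool, w.length = N → ∃ z, ∀ x, g (prependWord w x) = prependWord z x) :
    IsPrefixExchange g := by
  let e := Fintype.equivFin (List.Vector Bool N)
  choose z hz using hN
  let w : Fin (Fintype.card (List.Vector Bool N)) → List Bool := fun i => (e.symm i).1
  have hwl : ∀ i, (w i).length = N := fun i => (e.symm i).2
  have hcyl : ∀ i, wordCylinder (z (w i) (hwl i)) = g '' wordCylinder (w i) := by
    intro i
    rw [wordCylinder, wordCylinder, ← Set.range_comp]
    congr 1
    funext x
    exact (hz _ _ x).symm
  have hdisj : ∀ i j, i ≠ j → Disjoint (wordCylinder (w i)) (wordCylinder (w j)) := by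
    intro i j hij
    rw [Set.disjoint_left]
    rintro _ ⟨x, rfl⟩ ⟨y, hy⟩
    refine hij (e.symm.injective (Subtype.ext ?_))
    exact (eq_of_prependWord_eq ((hwl j).trans (hwl i).symm) hy).symm
  have hcov : ⋃ i, wordCylinder (w i) = Set.univ := by
    refine Set.eq_univ_of_forall fun x => ?_
    obtain ⟨u, y, hu, rfl⟩ := exists_prependWord N x
    have hwu : w (e ⟨u, hu⟩) = u := congrArg Subtype.val (e.symm_apply_apply ⟨u, hu⟩)
    exact Set.mem_iUnion.2 ⟨e ⟨u, hu⟩, y, congrArg (fun v => prependWord v y) hwu⟩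
  refine ⟨_, w, fun i => z (w i) (hwl i), ⟨hdisj, hcov⟩, ⟨fun i j hij => ?_, ?_⟩,
    fun i x => hz _ _ x⟩
  · rw [hcyl, hcyl]
    exact (Set.disjoint_image_iff hb.1).2 (hdisj i j hij)
  · simp only [hcyl]
    rw [← Set.image_iUnion, hcov, Set.image_univ, hb.2.range_eq]

/-- Thompson's group `V`: the homeomorphisms of the binary Cantor set that exchange the prefixes of
two finite cylinder partitions. -/
def ThompsonV : Subgroup (BinaryCantor ≃ₜ BinaryCantor) where
  carrier := {g | IsPrefixExchange g}
  one_mem' := isPrefixExchange_of_depth (Homeomorph.bijective _) (N := 0) fun w _ => ⟨w, fun _ => rfl⟩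
  mul_mem' := by
    intro g h hg hh
    obtain ⟨M, hM⟩ := IsPrefixExchange.exists_depth hg
    obtain ⟨N, hN⟩ := IsPrefixExchange.exists_depth hh
    refine isPrefixExchange_of_depth (Homeomorph.bijective _) (N := N + M) fun w hw => ?_
    obtain ⟨z, hz⟩ := hN (w.take N) (by simp [hw])
    obtain ⟨v, hv⟩ := hM (z ++ w.drop N) (by simp [hw])
    refine ⟨v, fun x => ?_⟩
    change g (h (prependWord w x)) = _
    rw [← hv, prependWord_append, ← hz, ← prependWord_append, List.take_append_drop]
  inv_mem' := by
    rintro g ⟨n, w, z, hw, hz, h⟩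
    refine ⟨n, z, w, hz, hw, fun i x => ?_⟩
    change g.symm _ = _
    rw [Homeomorph.symm_apply_eq, h]

/-!
In all four groups the argument starts from a URS `A ≠ {1}` and produces a large member of `A`.

*Rigid subgroups.* Let `G` act faithfully on a Hausdorff space `X` such that every non-empty open
set supports an infinite simple subgroup of `G` from a family `𝒢`. Since `A` is compact and does
not contain `1`, there is a finite set `P` of nontrivial elements which meets every member of `A`;
if it is chosen minimal, some member `H` meets it in a single element `γ`. In a small open set `W`
moved by `γ`, each element of `P` is trivial or moves `W` off itself. If `Γ ∈ 𝒢` is supported in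
`W`, an element of `P` that is trivial on `W` commutes with `Γ`, so that it cannot account for the
conjugates of `H` under `Γ`: these all meet the set of those elements of `P` that move `W` off
itself. By B. H. Neumann's lemma on coverings by cosets this forces `Γ ≤ H`
(`le_of_forall_conj_mem`, `IsURS.exists_rigid_le`).

*Expansion.* Conjugating this member by elements that expand the open set to the complement of a
point `x`, and passing to an ultrafilter limit in the compact space of subgroups, some `K ∈ A`
contains the germ stabilizer of `x`, i.e. all elements that are trivial near `x`
(`IsURS.exists_range_le` for the circle, `IsURS.exists_germStabilizer_le_ThompsonV` for the Cantor
set). For `F`, with `x = 0`, the germ stabilizer is the derived subgroup (`commutator_ThompsonF`),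
so that `K` is normal and `A = {K}`; for `[F, F]` it is the whole group.

*Conclusion for `T` and `V`.* If `K` moves `x`, then `K` contains the germ stabilizers of two
points, and therefore `K = G` (`eq_top_of_germStabilizer_le`, `eq_top_of_two_germStabilizer_le`).
Otherwise `K` lies between the germ stabilizer and the stabilizer of `x`. As the action is
minimal, conjugates of `K` then accumulate at the stabilizer of any point whose stabilizer and
germ stabilizer agree, and such points exist: `√2` on the circle, the indicator sequence of the
squares in the Cantor set. Hence `A` is the stabilizer URS (`isURS_iff_of_between`).

The simple groups come from the dyadic piecewise linear homeomorphisms of the line with compact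
support in an interval (`isSimpleGroup_plCompact`), and from copies of `V` acting on cylinders
(`isSimpleGroup_ThompsonV`). Both rest on the classical commutator trick: a normal subgroup that
moves an open set off itself contains the commutators of elements supported there. For the line
this needs perfectness of the group of compactly supported maps. It is a normal subgroup `C` of
the group `P` of the maps that are trivial near `-∞`, and `P ⧸ ⁅C, C⁆` is a central extension of
the group of germs at `+∞`, a solvable Baumslag–Solitar group. This extension splits, and as `P`
is generated by conjugates of a single type of element, `C = ⁅C, C⁆`
(`le_commutator_of_baumslagSolitar`). For `V` it needs generation by exchanges of the prefixes of
two disjoint cylinders (`eq_top_of_wordSwap_mem`).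
-/

open scoped commutatorElement

/-! ### Limits in the Chabauty space -/

section Chabauty

variable {G : Type*} [Group G]

/-- Convergence in the Chabauty topology is eventual constancy of each membership relation. -/
theorem tendsto_nhds_subgroup_iff {ι : Type*} {l : Filter ι} {H : ι → Subgroup G}
    {K : Subgroup G} :
    Tendsto H l (𝓝 K) ↔ ∀ g, ∀ᶠ i in l, (g ∈ H i ↔ g ∈ K) := by
  classical
  rw [(Topology.IsInducing.induced
      (fun (H : Subgroup G) (g : G) => decide (g ∈ H))).tendsto_nhds_iff,
    tendsto_pi_nhds]
  refine forall_congr' fun g => ?_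
  rw [nhds_discrete, tendsto_pure]
  refine eventually_congr (Eventually.of_forall fun i => ?_)
  simp

/-- The limit of a family of subgroups along an ultrafilter: it consists of the elements that
belong to almost all of them. -/
def ultrafilterLimit {ι : Type*} (U : Ultrafilter ι) (H : ι → Subgroup G) : Subgroup G where
  carrier := {g | ∀ᶠ i in (U : Filter ι), g ∈ H i}
  one_mem' := Eventually.of_forall fun i => (H i).one_mem
  mul_mem' := fun ha hb => (ha.and hb).mono fun i h => (H i).mul_mem h.1 h.2
  inv_mem' := fun ha => ha.mono fun i h => (H i).inv_mem h

theorem mem_ultrafilterLimit {ι : Type*} {U : Ultrafilter ι} {H : ι → Subgroup G} {g : G} :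
    g ∈ ultrafilterLimit U H ↔ ∀ᶠ i in (U : Filter ι), g ∈ H i := Iff.rfl

theorem tendsto_ultrafilterLimit {ι : Type*} (U : Ultrafilter ι) (H : ι → Subgroup G) :
    Tendsto H U (𝓝 (ultrafilterLimit U H)) := by
  refine tendsto_nhds_subgroup_iff.2 fun g => ?_
  by_cases hg : g ∈ ultrafilterLimit U H
  · exact (mem_ultrafilterLimit.1 hg).mono fun i hi => by simp [hi, hg]
  · exact (Ultrafilter.eventually_not.2 hg).mono fun i hi => by simp [hi, hg]

theorem ultrafilterLimit_mem {ι : Type*} {U : Ultrafilter ι} {H : ι → Subgroup G}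
    {A : Set (Subgroup G)} (hA : IsClosed A) (h : ∀ i, H i ∈ A) : ultrafilterLimit U H ∈ A :=
  hA.mem_of_tendsto (tendsto_ultrafilterLimit U H) (Eventually.of_forall h)


theorem eq_of_tendsto_subgroup {ι : Type*} {l : Filter ι} [l.NeBot] {H : ι → Subgroup G}
    {K L : Subgroup G} (hK : Tendsto H l (𝓝 K)) (hL : Tendsto H l (𝓝 L)) : K = L := by
  ext g
  obtain ⟨i, h1, h2⟩ := ((tendsto_nhds_subgroup_iff.1 hK g).and
    (tendsto_nhds_subgroup_iff.1 hL g)).exists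
  rw [← h1, h2]

theorem isClosed_of_forall_ultrafilter {A : Set (Subgroup G)}
    (h : ∀ (U : Ultrafilter (Subgroup G)) (K : Subgroup G), A ∈ U → Tendsto id U (𝓝 K) → K ∈ A) :
    IsClosed A := by
  rw [isClosed_iff_ultrafilter]
  exact fun x u hu hA => h u x hA hu

theorem isClosed_singleton_subgroup (N : Subgroup G) : IsClosed {N} := by
  refine isClosed_of_forall_ultrafilter fun U K hU hK => ?_
  refine eq_of_tendsto_subgroup (l := (U : Filter _)) (H := id) hK ?_
  refine tendsto_const_nhds.congr' ?_
  filter_upwards [hU] with H hH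
  exact hH.symm

theorem mem_conjSubgroup {g h : G} {H : Subgroup G} : h ∈ conjSubgroup g H ↔ g⁻¹ * h * g ∈ H := by
  simp only [conjSubgroup, Subgroup.mem_map]
  constructor
  · rintro ⟨x, hx, rfl⟩
    simpa [mul_assoc] using hx
  · exact fun hx => ⟨_, hx, by simp [mul_assoc]⟩

theorem conjSubgroup_eq_self_of_normal {N : Subgroup G} (hN : N.Normal) (g : G) :
    conjSubgroup g N = N := by
  ext h
  rw [mem_conjSubgroup]
  simpa using (hN.mem_comm_iff (a := g⁻¹ * h) (b := g))

theorem isConjInvariant_singleton {N : Subgroup G} (hN : N.Normal) : IsConjInvariant {N} := by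
  rintro g H rfl
  exact conjSubgroup_eq_self_of_normal hN g

theorem isURS_singleton {N : Subgroup G} (hN : N.Normal) : IsURS {N} where
  nonempty := Set.singleton_nonempty N
  isClosed := isClosed_singleton_subgroup N
  invariant := isConjInvariant_singleton hN
  minimal _ hB hne _ _ := (Set.subset_singleton_iff_eq.1 hB).resolve_left hne.ne_empty

theorem IsURS.eq_singleton {A : Set (Subgroup G)} (hA : IsURS A) {N : Subgroup G} (hN : N.Normal)
    (h : N ∈ A) : A = {N} :=
  (hA.minimal {N} (Set.singleton_subset_iff.2 h) (Set.singleton_nonempty N)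
    (isClosed_singleton_subgroup N) (isConjInvariant_singleton hN)).symm

theorem tendsto_conjSubgroup {ι : Type*} {l : Filter ι} {H : ι → Subgroup G}
    {K : Subgroup G} (h : Tendsto H l (𝓝 K)) (g : G) :
    Tendsto (fun i => conjSubgroup g (H i)) l (𝓝 (conjSubgroup g K)) := by
  rw [tendsto_nhds_subgroup_iff] at h ⊢
  simpa only [mem_conjSubgroup] using fun x => h (g⁻¹ * x * g)

theorem IsConjInvariant.closure {A : Set (Subgroup G)} (hA : IsConjInvariant A) :
    IsConjInvariant (closure A) := by
  intro g H hH
  rw [mem_closure_iff_ultrafilter] at hH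
  obtain ⟨u, huA, hu⟩ := hH
  refine mem_closure_of_tendsto (tendsto_conjSubgroup (tendsto_id.mono_left hu) g) ?_
  filter_upwards [huA] with K hK using hA g K hK

/-- Minimality in the form in which it is used: a uniformly recurrent subgroup is contained in
every closed invariant set which it meets. -/
theorem IsURS.subset_of_mem {A B : Set (Subgroup G)} (hA : IsURS A) (hB : IsClosed B)
    (hB' : IsConjInvariant B) {K : Subgroup G} (hKA : K ∈ A) (hKB : K ∈ B) : A ⊆ B := by
  have := hA.minimal (A ∩ B) Set.inter_subset_left ⟨K, hKA, hKB⟩ (hA.isClosed.inter hB)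
    fun g H hH => ⟨hA.invariant g H hH.1, hB' g H hH.2⟩
  exact this ▸ Set.inter_subset_right

theorem IsURS.eq_of_mem {A B : Set (Subgroup G)} (hA : IsURS A) (hB : IsURS B) {K : Subgroup G}
    (hKA : K ∈ A) (hKB : K ∈ B) : A = B :=
  (hA.subset_of_mem hB.isClosed hB.invariant hKA hKB).antisymm
    (hB.subset_of_mem hA.isClosed hA.invariant hKB hKA)

/-- A uniformly recurrent subgroup other than the trivial one is confined: some finite set of
non-trivial elements meets all its members. -/
theorem IsURS.exists_finset_confining {A : Set (Subgroup G)} (hA : IsURS A) (h : A ≠ {⊥}) :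
    ∃ P : Finset G, (1 : G) ∉ P ∧ ∀ H ∈ A, ∃ γ ∈ P, γ ∈ H := by
  classical
  by_contra! hcon
  have hcon' : ∀ P : Finset G, ∃ H ∈ A, ∀ γ ∈ P, γ ≠ 1 → γ ∉ H := fun P => by
    obtain ⟨H, hH, h'⟩ := hcon (P.erase 1) (by simp)
    exact ⟨H, hH, fun γ hγ h1 => h' γ (Finset.mem_erase.2 ⟨h1, hγ⟩)⟩
  choose H hHA hH using hcon'
  let U : Ultrafilter (Finset G) := Ultrafilter.of atTop
  have hK : ultrafilterLimit U H = ⊥ := by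
    rw [eq_bot_iff]
    intro g hg
    by_contra hg1
    have hev : ∀ᶠ P in (U : Filter (Finset G)), {g} ≤ P :=
      (eventually_ge_atTop {g}).filter_mono (Ultrafilter.of_le _)
    obtain ⟨P, h1, h2⟩ := ((mem_ultrafilterLimit.1 hg).and hev).exists
    exact hH P g (h2 (Finset.mem_singleton_self g)) (by simpa using hg1) h1
  exact h (hA.eq_singleton inferInstance (hK ▸ ultrafilterLimit_mem hA.isClosed hHA))

/-- A confining set that is minimal for inclusion comes with an element `γ` and a member `H`
of the uniformly recurrent subgroup which meets the set in `γ` only. -/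
theorem IsURS.exists_minimal_confining {A : Set (Subgroup G)} (hA : IsURS A) (h : A ≠ {⊥}) :
    ∃ P : Finset G, (∀ H ∈ A, ∃ γ ∈ P, γ ∈ H) ∧
      ∃ γ ∈ P, γ ≠ 1 ∧ ∃ H ∈ A, γ ∈ H ∧ ∀ δ ∈ P, δ ∈ H → δ = γ := by
  classical
  obtain ⟨P, ⟨h1, hP⟩, hmin⟩ := WellFounded.has_min (wellFounded_lt (α := Finset G))
    {P | (1 : G) ∉ P ∧ ∀ H ∈ A, ∃ γ ∈ P, γ ∈ H} (hA.exists_finset_confining h)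
  refine ⟨P, hP, ?_⟩
  obtain ⟨H₀, hH₀⟩ := hA.nonempty
  obtain ⟨γ, hγ, -⟩ := hP H₀ hH₀
  have hne : ¬ ∀ H ∈ A, ∃ δ ∈ P.erase γ, δ ∈ H := fun hcon =>
    hmin (P.erase γ) ⟨fun h => h1 (Finset.mem_of_mem_erase h), hcon⟩ (Finset.erase_ssubset hγ)
  push Not at hne
  obtain ⟨H, hHA, hH⟩ := hne
  have key : ∀ δ ∈ P, δ ∈ H → δ = γ := fun δ hδ hδH => by
    by_contra hne
    exact hH δ (Finset.mem_erase.2 ⟨hne, hδ⟩) hδH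
  obtain ⟨δ, hδ, hδH⟩ := hP H hHA
  exact ⟨γ, hγ, fun h => h1 (h ▸ hγ), H, hHA, key δ hδ hδH ▸ hδH, key⟩

end Chabauty

/-! ### Confined subgroups contain rigid subgroups -/

section Confined

variable {G X : Type*} [Group G] [MulAction G X]

/-- Elements with disjoint supports commute. -/
theorem commute_of_disjoint_support [FaithfulSMul G X] {a b : G}
    (h : ∀ x : X, a • x = x ∨ b • x = x) : Commute a b := by
  refine FaithfulSMul.eq_of_smul_eq_smul (α := X) fun x => ?_
  rw [mul_smul, mul_smul]
  rcases h x with hx | hx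
  · rcases h (b • x) with hb | hb
    · rw [hb, hx]
    · rw [smul_left_cancel_iff] at hb
      rw [hb, hx, hb]
  · rcases h (a • x) with ha | ha
    · rw [smul_left_cancel_iff] at ha
      rw [hx, ha, hx]
    · rw [ha, hx]

theorem commute_conj_of_disjoint [FaithfulSMul G X] {U : Set X} {γ a b : G}
    (hγ : ∀ x ∈ U, γ • x ∉ U) (ha : ∀ x ∉ U, a • x = x) (hb : ∀ x ∉ U, b • x = x) :
    Commute (γ * a * γ⁻¹) b := by
  refine commute_of_disjoint_support (X := X) fun x => ?_
  by_cases hx : x ∈ U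
  · left
    have : γ⁻¹ • x ∉ U := fun h => hγ _ h (by simpa using hx)
    rw [mul_smul, mul_smul, ha _ this, smul_inv_smul]
  · exact Or.inr (hb x hx)

/-- The double commutator trick: a normal subgroup which contains an element that moves `U` off
itself contains the commutators of the elements supported in `U`. -/
theorem commutator_mem_of_moves_off [FaithfulSMul G X] {N : Subgroup G} (hN : N.Normal)
    {U : Set X} {γ a b : G} (hγN : γ ∈ N) (hγ : ∀ x ∈ U, γ • x ∉ U)
    (ha : ∀ x ∉ U, a • x = x) (hb : ∀ x ∉ U, b • x = x) : ⁅a, b⁆ ∈ N := by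
  have ha' : ∀ x ∉ U, a⁻¹ • x = x := fun x hx => by rw [inv_smul_eq_iff, ha x hx]
  have hc : Commute (γ * a⁻¹ * γ⁻¹) b := commute_conj_of_disjoint hγ ha' hb
  have h1 : a * (γ * a⁻¹ * γ⁻¹) ∈ N := by
    have := N.mul_mem (hN.conj_mem _ hγN a) (N.inv_mem hγN)
    simpa [mul_assoc] using this
  have h2 : ⁅a * (γ * a⁻¹ * γ⁻¹), b⁆ ∈ N := by
    have := N.mul_mem h1 (hN.conj_mem _ (N.inv_mem h1) b)
    simpa [commutatorElement_def, mul_assoc] using this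
  have h3 : ⁅a * (γ * a⁻¹ * γ⁻¹), b⁆ = ⁅a, b⁆ := by
    set e := γ * a⁻¹ * γ⁻¹
    rw [commutatorElement_def, commutatorElement_def, mul_assoc a e b, hc.eq]
    group
  exact h3 ▸ h2

/-- Inside any non-empty open set there is a smaller one on which each of finitely many given
elements acts trivially or which it moves off itself. -/
theorem exists_open_trivial_or_moved [TopologicalSpace X] [T2Space X] [ContinuousConstSMul G X]
    (P : Finset G) {O : Set X} (hO : IsOpen O) (hne : O.Nonempty) :
    ∃ W ⊆ O, IsOpen W ∧ W.Nonempty ∧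
      ∀ γ ∈ P, (∀ x ∈ W, γ • x = x) ∨ ∀ x ∈ W, γ • x ∉ W := by
  classical
  induction P using Finset.induction_on with
  | empty => exact ⟨O, subset_rfl, hO, hne, by simp⟩
  | insert γ P _ ih =>
    obtain ⟨W, hWO, hW, hWne, hWP⟩ := ih
    by_cases htriv : ∀ x ∈ W, γ • x = x
    · refine ⟨W, hWO, hW, hWne, fun δ hδ => ?_⟩
      rcases Finset.mem_insert.1 hδ with rfl | hδ
      · exact Or.inl htriv
      · exact hWP δ hδ
    · push Not at htriv
      obtain ⟨x, hx, hγx⟩ := htriv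
      obtain ⟨A, B, hA, hB, hxA, hxB, hAB⟩ := t2_separation hγx
      refine ⟨W ∩ (B ∩ (γ • ·) ⁻¹' A), fun y hy => hWO hy.1,
        hW.inter (hB.inter (hA.preimage (continuous_const_smul γ))), ⟨x, hx, hxB, hxA⟩,
        fun δ hδ => ?_⟩
      rcases Finset.mem_insert.1 hδ with rfl | hδ
      · exact Or.inr fun y hy hy' => Set.disjoint_left.1 hAB hy.2.2 hy'.2.1
      · exact (hWP δ hδ).imp (fun h y hy => h y hy.1) fun h y hy hy' => h y hy.1 hy'.1

end Confined

section Simple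

variable {Γ : Type*} [Group Γ]

/-- An infinite simple group has no proper subgroup of finite index. -/
theorem eq_top_of_finiteIndex_of_isSimpleGroup [IsSimpleGroup Γ] [Infinite Γ] (K : Subgroup Γ)
    [hK : K.FiniteIndex] : K = ⊤ := by
  rcases (inferInstance : K.normalCore.Normal).eq_bot_or_eq_top with h | h
  · have : (⊥ : Subgroup Γ).FiniteIndex := h ▸ inferInstance
    have hfin : Finite (Γ ⧸ (⊥ : Subgroup Γ)) := inferInstance
    have : Finite Γ := Finite.of_equiv _ QuotientGroup.quotientBot.toEquiv
    exact absurd this (not_finite_iff_infinite.2 inferInstance)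
  · exact top_le_iff.1 (h ▸ K.normalCore_le)

theorem exists_eq_top_of_leftCoset_cover [IsSimpleGroup Γ] [Infinite Γ] {ι : Type*}
    (s : Finset ι) (g : ι → Γ) (K : ι → Subgroup Γ) (h : ∀ x, ∃ i ∈ s, (g i)⁻¹ * x ∈ K i) :
    ∃ i ∈ s, K i = ⊤ := by
  obtain ⟨i, hi, hK⟩ := Subgroup.exists_finiteIndex_of_leftCoset_cover
    (s := s) (g := g) (H := K) (by
    refine Set.eq_univ_of_forall fun x => ?_
    obtain ⟨i, hi, hx⟩ := h x
    exact Set.mem_iUnion₂.2 ⟨i, hi, (mem_leftCoset_iff _).2 hx⟩)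
  exact ⟨i, hi, eq_top_of_finiteIndex_of_isSimpleGroup _⟩

theorem eq_one_of_centralizer_eq_top [IsSimpleGroup Γ] [Infinite Γ] {a : Γ}
    (ha : Subgroup.centralizer {a} = ⊤) : a = 1 := by
  by_contra h1
  have hac : a ∈ Subgroup.center Γ := by
    rw [Subgroup.mem_center_iff]
    intro g
    have : g ∈ Subgroup.centralizer {a} := ha ▸ Subgroup.mem_top g
    exact (Subgroup.mem_centralizer_singleton_iff.1 this)
  have hcen : Subgroup.center Γ = ⊤ := by
    refine (inferInstance : (Subgroup.center Γ).Normal).eq_bot_or_eq_top.resolve_left fun h => h1 ?_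
    rwa [h, Subgroup.mem_bot] at hac
  let inst : CommGroup Γ := Group.commGroupOfCenterEqTop hcen
  have hcyc : IsCyclic Γ := IsSimpleGroup.isCyclic
  have : Finite Γ := IsSimpleGroup.finite
  exact not_finite Γ

end Simple

section Main

variable {G X : Type*} [Group G] [MulAction G X] [FaithfulSMul G X]

/-- Let `Γ` be an infinite simple group supported in `U`, `P` a finite set of elements each of
which moves `U` off itself, and suppose that the `Γ`-conjugates of a subgroup `H` all meet `P`.
Then `H` contains `Γ`. -/
theorem le_of_forall_conj_mem {U : Set X} {Γ : Subgroup G} [IsSimpleGroup Γ] [Infinite Γ]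
    (hΓ : ∀ l ∈ Γ, ∀ x ∉ U, l • x = x) {P : Finset G} (hP : ∀ γ ∈ P, ∀ x ∈ U, γ • x ∉ U)
    {H : Subgroup G} (hH : ∀ l ∈ Γ, ∃ γ ∈ P, l⁻¹ * γ * l ∈ H) : Γ ≤ H := by
  classical
  -- For `g, h` in the same colour class `Y γ`, a product of two elements of `H` acts on `U`
  -- like `g⁻¹ h`, and is otherwise supported in `γ U`.
  let Y : G → Γ → Prop := fun γ l => (l : G)⁻¹ * γ * l ∈ H
  have hpair : ∀ γ ∈ P, ∀ g h : Γ, Y γ g → Y γ h →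
      (g : G)⁻¹ * h * (γ * (g * (h : G)⁻¹) * γ⁻¹) ∈ H := by
    intro γ hγ g h hg hh
    have h1 := H.mul_mem hg (H.inv_mem hh)
    have hc : Commute (γ * ((g * h⁻¹ : Γ) : G) * γ⁻¹) (h : G) :=
      commute_conj_of_disjoint (hP γ hγ) (hΓ _ (g * h⁻¹).2) (hΓ _ h.2)
    have h2 : (g : G)⁻¹ * γ * g * ((h : G)⁻¹ * γ * h)⁻¹ =
        (g : G)⁻¹ * ((γ * ((g * h⁻¹ : Γ) : G) * γ⁻¹) * h) := by
      push_cast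
      group
    rw [h2, hc.eq] at h1
    simpa [mul_assoc] using h1
  -- Some class has its left quotients generating `Γ`.
  let K : G → Subgroup Γ := fun γ => Subgroup.closure {k | ∃ g h, Y γ g ∧ Y γ h ∧ k = g⁻¹ * h}
  have hbase : ∃ b : G → Γ, ∀ γ l, Y γ l → Y γ (b γ) :=
    ⟨fun γ => if h : ∃ l, Y γ l then h.choose else 1, fun γ l hl => by
      have h : ∃ l, Y γ l := ⟨l, hl⟩
      simpa only [dif_pos h] using h.choose_spec⟩
  obtain ⟨b, hb⟩ := hbase
  obtain ⟨γ, hγ, hKγ⟩ : ∃ γ ∈ P, K γ = ⊤ :=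
    exists_eq_top_of_leftCoset_cover P b K fun l => by
      obtain ⟨γ, hγ, hl⟩ := hH l l.2
      exact ⟨γ, hγ, Subgroup.subset_closure ⟨b γ, l, hb γ l hl, hl, rfl⟩⟩
  have hext : ∀ k : Γ, ∃ k' : Γ, (k : G) * (γ * k' * γ⁻¹) ∈ H := by
    intro k
    have hk : k ∈ K γ := hKγ ▸ Subgroup.mem_top k
    have hcomm : ∀ a b : Γ, Commute (γ * (a : G) * γ⁻¹) (b : G) := fun a b =>
      commute_conj_of_disjoint (hP γ hγ) (hΓ _ a.2) (hΓ _ b.2)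
    induction hk using Subgroup.closure_induction with
    | mem k hk =>
      obtain ⟨g, h, hg, hh, rfl⟩ := hk
      exact ⟨g * h⁻¹, by simpa using hpair γ hγ g h hg hh⟩
    | one => exact ⟨1, by simp⟩
    | mul k l _ _ hk hl =>
      obtain ⟨k', hk'⟩ := hk
      obtain ⟨l', hl'⟩ := hl
      refine ⟨k' * l', ?_⟩
      have := H.mul_mem hk' hl'
      have h2 : (k : G) * (γ * k' * γ⁻¹) * (l * (γ * l' * γ⁻¹)) =
          k * ((γ * k' * γ⁻¹) * l) * (γ * l' * γ⁻¹) := by group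
      rw [h2, (hcomm k' l).eq] at this
      convert this using 1
      push_cast
      group
    | inv k _ hk =>
      obtain ⟨k', hk'⟩ := hk
      refine ⟨k'⁻¹, ?_⟩
      have := H.inv_mem hk'
      rw [mul_inv_rev, show (γ * (k' : G) * γ⁻¹)⁻¹ = γ * ((k'⁻¹ : Γ) : G) * γ⁻¹ by push_cast; group,
        show (k : G)⁻¹ = ((k⁻¹ : Γ) : G) by simp, (hcomm k'⁻¹ k⁻¹).eq] at this
      exact this
  -- Hence `H ∩ Γ` is normal in `Γ`.
  have hnorm : (H.subgroupOf Γ).Normal := by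
    refine ⟨fun n hn k => ?_⟩
    obtain ⟨k', hk'⟩ := hext k
    rw [Subgroup.mem_subgroupOf] at hn ⊢
    have hc : Commute (γ * (k' : G) * γ⁻¹) (n : G) :=
      commute_conj_of_disjoint (hP γ hγ) (hΓ _ k'.2) (hΓ _ n.2)
    have := H.mul_mem (H.mul_mem hk' hn) (H.inv_mem hk')
    have h2 : (k : G) * (γ * k' * γ⁻¹) * n * (k * (γ * k' * γ⁻¹))⁻¹ =
        k * ((γ * k' * γ⁻¹) * n) * (k * (γ * k' * γ⁻¹))⁻¹ := by group
    rw [h2, hc.eq] at this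
    convert this using 1
    push_cast
    group
  rcases hnorm.eq_bot_or_eq_top with hbot | htop
  swap
  · exact Subgroup.subgroupOf_eq_top.1 htop
  -- Otherwise two pairs in a class with the same right quotient have the same left quotient.
  exfalso
  have hrigid : ∀ δ ∈ P, ∀ a h h' : Γ, Y δ h → Y δ (a * h) → Y δ h' → Y δ (a * h') →
      h⁻¹ * a * h = h'⁻¹ * a * h' := by
    intro δ hδ a h h' h1 h2 h3 h4
    have h5 := H.mul_mem (H.inv_mem (hpair δ hδ _ _ h1 h2)) (hpair δ hδ _ _ h3 h4)
    have hc : Commute (δ * (a : G) * δ⁻¹) ((h⁻¹ * a * h : Γ) : G)⁻¹ := by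
      have := commute_conj_of_disjoint (hP δ hδ) (hΓ _ a.2) (hΓ _ (h⁻¹ * a * h)⁻¹.2)
      simpa using this
    have hc' : Commute (δ * (a : G) * δ⁻¹) ((h'⁻¹ * a * h' : Γ) : G) :=
      commute_conj_of_disjoint (hP δ hδ) (hΓ _ a.2) (hΓ _ (h'⁻¹ * a * h').2)
    have h6 : ((h⁻¹ * a * h)⁻¹ * (h'⁻¹ * a * h') : Γ) ∈ H.subgroupOf Γ := by
      rw [Subgroup.mem_subgroupOf]
      convert h5 using 1
      push_cast at hc hc' ⊢
      have e1 : ((h : G)⁻¹ * (a * h) * (δ * (h * (a * (h : G))⁻¹) * δ⁻¹))⁻¹ =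
        (δ * (a : G) * δ⁻¹) * ((h : G)⁻¹ * a * h)⁻¹ := by group
      have e2 : (h' : G)⁻¹ * (a * h') * (δ * (h' * (a * (h' : G))⁻¹) * δ⁻¹) =
        ((h' : G)⁻¹ * a * h') * (δ * (a : G) * δ⁻¹)⁻¹ := by group
      rw [e1, e2, hc.eq, mul_assoc _ (δ * (a : G) * δ⁻¹), ← mul_assoc (δ * (a : G) * δ⁻¹),
        hc'.eq]
      group
    rw [hbot, Subgroup.mem_bot, inv_mul_eq_one] at h6
    exact h6
  -- By the pigeonhole principle `Γ` is then covered by finitely many cosets of centralizers.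
  obtain ⟨a, ha⟩ := Infinite.natEmbedding Γ
  let s : Finset ((ℕ × ℕ) × G) :=
    (((Finset.range (P.card + 1)) ×ˢ (Finset.range (P.card + 1))).filter fun p => p.1 ≠ p.2) ×ˢ P
  let R : (ℕ × ℕ) × G → Γ → Prop := fun i l =>
    Y i.2 (a i.1.1 * l⁻¹) ∧ Y i.2 (a i.1.2 * l⁻¹)
  have hbase : ∃ c : (ℕ × ℕ) × G → Γ, ∀ i l, R i l → R i (c i) :=
    ⟨fun i => if h : ∃ l, R i l then h.choose else 1, fun i l hl => by
      have h : ∃ l, R i l := ⟨l, hl⟩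
      simpa only [dif_pos h] using h.choose_spec⟩
  obtain ⟨c, hc⟩ := hbase
  obtain ⟨⟨⟨m, n⟩, δ⟩, hi, htop⟩ := exists_eq_top_of_leftCoset_cover s c
    (fun i => Subgroup.centralizer {(a i.1.1)⁻¹ * a i.1.2}) (fun l => by
      have hcol : ∀ m, ∃ δ ∈ P, Y δ (a m * l⁻¹) := fun m => hH _ (a m * l⁻¹).2
      choose col hcolP hcol using hcol
      obtain ⟨m, hm, n, hn, hmn, heq⟩ := Finset.exists_ne_map_eq_of_card_lt_of_maps_to
        (s := Finset.range (P.card + 1)) (t := P) (by simp) (fun m _ => hcolP m)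
      have hR : R ((m, n), col m) l := ⟨hcol m, heq ▸ hcol n⟩
      have hR' := hc _ _ hR
      refine ⟨((m, n), col m), ?_, ?_⟩
      · simp only [s, Finset.mem_product, Finset.mem_filter]
        exact ⟨⟨⟨hm, hn⟩, hmn⟩, hcolP m⟩
      · set d := c ((m, n), col m)
        have hrig := hrigid (col m) (hcolP m) (a n * (a m)⁻¹) (a m * l⁻¹) (a m * d⁻¹) hR.1
          (by simpa [mul_assoc] using hR.2) hR'.1 (by simpa [mul_assoc] using hR'.2)
        rw [Subgroup.mem_centralizer_singleton_iff]
        simp only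
        have h7 : l * ((a m)⁻¹ * a n) * l⁻¹ = d * ((a m)⁻¹ * a n) * d⁻¹ := by
          simpa [mul_assoc] using hrig
        have h8 : l * ((a m)⁻¹ * a n) = d * ((a m)⁻¹ * a n) * d⁻¹ * l := by
          rw [← h7]; group
        rw [mul_assoc d⁻¹ l, h8]
        group)
  simp only [s, Finset.mem_product, Finset.mem_filter] at hi
  have := eq_one_of_centralizer_eq_top htop
  rw [inv_mul_eq_one] at this
  exact hi.1.2 (ha this)

/-- A uniformly recurrent subgroup other than the trivial one has a member which contains one of
the subgroups of the family `𝒢`, if each non-empty open set is acted upon by an infinite simple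
member of `𝒢` which is trivial outside of it. -/
theorem IsURS.exists_rigid_le [TopologicalSpace X] [T2Space X] [ContinuousConstSMul G X]
    {𝒢 : Set (Subgroup G)}
    (h𝒢 : ∀ O : Set X, IsOpen O → O.Nonempty →
      ∃ Γ ∈ 𝒢, IsSimpleGroup Γ ∧ Infinite Γ ∧ ∀ l ∈ Γ, ∀ x ∉ O, l • x = x)
    {A : Set (Subgroup G)} (hA : IsURS A) (h : A ≠ {⊥}) : ∃ H ∈ A, ∃ Γ ∈ 𝒢, Γ ≤ H := by
  classical
  obtain ⟨P, hP, γ, hγP, hγ1, H, hHA, -, huniq⟩ := hA.exists_minimal_confining h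
  obtain ⟨x, hx⟩ : ∃ x : X, γ • x ≠ x := by
    by_contra! hcon
    exact hγ1 (FaithfulSMul.eq_of_smul_eq_smul (α := X) fun x => by rw [hcon, one_smul])
  have hO : IsOpen {x : X | γ • x ≠ x} :=
    isOpen_ne_fun (continuous_const_smul γ) continuous_id
  obtain ⟨W, hWO, hW, hWne, hWP⟩ := exists_open_trivial_or_moved P hO ⟨x, hx⟩
  obtain ⟨Γ, hΓ, hsimp, hinf, hsupp⟩ := h𝒢 W hW hWne
  refine ⟨H, hHA, Γ, hΓ, le_of_forall_conj_mem (X := X) hsupp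
    (P := P.filter fun δ => ∀ x ∈ W, δ • x ∉ W) (fun δ hδ => (Finset.mem_filter.1 hδ).2) ?_⟩
  intro l hl
  obtain ⟨δ, hδ, hδH⟩ := hP _ (hA.invariant l H hHA)
  rw [mem_conjSubgroup] at hδH
  refine ⟨δ, Finset.mem_filter.2 ⟨hδ, (hWP δ hδ).resolve_left fun htriv => ?_⟩, hδH⟩
  -- An element that is trivial on `W` commutes with `l`, hence lies in `H`, hence is `γ`.
  have hcomm : Commute δ l := commute_of_disjoint_support (X := X) fun y => by
    by_cases hy : y ∈ W
    · exact Or.inl (htriv y hy)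
    · exact Or.inr (hsupp l hl y hy)
  rw [mul_assoc, hcomm.eq, inv_mul_cancel_left] at hδH
  obtain rfl := huniq δ hδ hδH
  obtain ⟨y, hy⟩ := hWne
  exact hWO hy (htriv y hy)

end Main

/-! ### Stabilizer URS's -/

section Stabilizer

variable {G X : Type*} [Group G] [TopologicalSpace X] [MulAction G X]

variable (G) in
/-- The germ stabilizer of `x`: the elements that act trivially on a neighbourhood of `x`. -/
def germStabilizer (x : X) : Subgroup G where
  carrier := {g | ∀ᶠ y in 𝓝 x, g • y = y}
  one_mem' := Eventually.of_forall fun y => one_smul G y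
  mul_mem' := fun ha hb => (ha.and hb).mono fun y h => by rw [mul_smul, h.2, h.1]
  inv_mem' := fun ha => ha.mono fun y h => by rw [inv_smul_eq_iff, h]

theorem mem_germStabilizer {x : X} {g : G} : g ∈ germStabilizer G x ↔ ∀ᶠ y in 𝓝 x, g • y = y :=
  Iff.rfl

theorem conjSubgroup_stabilizer {G X : Type*} [Group G] [MulAction G X] (g : G) (x : X) :
    conjSubgroup g (MulAction.stabilizer G x) = MulAction.stabilizer G (g • x) := by
  ext h
  rw [mem_conjSubgroup, MulAction.mem_stabilizer_iff, MulAction.mem_stabilizer_iff, mul_smul,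
    mul_smul, inv_smul_eq_iff]

variable [ContinuousConstSMul G X]

/-- Members of the stabilizer URS lie between a germ stabilizer and the stabilizer of the same
point. -/
theorem exists_between_of_mem_stabilizerURS [CompactSpace X] [T2Space X] {K : Subgroup G}
    (hK : K ∈ stabilizerURS G X) :
    ∃ x : X, germStabilizer G x ≤ K ∧ K ≤ MulAction.stabilizer G x := by
  classical
  rw [stabilizerURS, mem_closure_iff_ultrafilter] at hK
  obtain ⟨u, hu, huK⟩ := hK
  obtain ⟨_, x₀, -, -⟩ := u.nonempty_of_mem hu
  have hpt : ∃ pt : Subgroup G → X, ∀ᶠ H in (u : Filter _), H = MulAction.stabilizer G (pt H) := by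
    refine ⟨fun H => if h : ∃ x : X, H = MulAction.stabilizer G x then h.choose else x₀, ?_⟩
    filter_upwards [hu] with H hH
    obtain ⟨x, -, hx⟩ := hH
    have h : ∃ x : X, H = MulAction.stabilizer G x := ⟨x, hx⟩
    simpa only [dif_pos h] using h.choose_spec
  obtain ⟨pt, hpt⟩ := hpt
  obtain ⟨x, -, hx⟩ := isCompact_univ.ultrafilter_le_nhds (u.map pt) (by simp)
  have hx' : Tendsto pt u (𝓝 x) := hx
  have hmem : ∀ g, g ∈ K ↔ ∀ᶠ H in (u : Filter _), g • pt H = pt H := by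
    intro g
    have h1 := tendsto_nhds_subgroup_iff.1 (show Tendsto id (u : Filter _) (𝓝 K) from huK) g
    constructor
    · intro hg
      filter_upwards [h1, hpt] with H h2 h3
      have h4 : g ∈ H := h2.2 hg
      rw [h3] at h4
      exact h4
    · intro hg
      obtain ⟨H, h2, h3, h4⟩ := (h1.and (hpt.and hg)).exists
      refine h2.1 ?_
      change g ∈ H
      rw [h3]
      exact h4
  refine ⟨x, fun g hg => (hmem g).2 (hx'.eventually (mem_germStabilizer.1 hg)), fun g hg => ?_⟩
  have h1 : Tendsto (fun H => g • pt H) u (𝓝 (g • x)) := hx'.const_smul g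
  refine tendsto_nhds_unique (h1.congr' ?_) hx'
  exact (hmem g).1 hg

theorem conj_mem_germStabilizer {x : X} {g h : G} :
    g⁻¹ * h * g ∈ germStabilizer G x ↔ h ∈ germStabilizer G (g • x) := by
  rw [mem_germStabilizer, mem_germStabilizer,
    show 𝓝 (g • x) = map (g • ·) (𝓝 x) from ((Homeomorph.smul g).map_nhds_eq x).symm,
    eventually_map]
  refine eventually_congr (Eventually.of_forall fun y => ?_)
  rw [mul_smul, mul_smul, inv_smul_eq_iff]

theorem continuousAt_stabilizer_iff [T2Space X] {x : X} :
    ContinuousAt (fun y : X => MulAction.stabilizer G y) x ↔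
      MulAction.stabilizer G x ≤ germStabilizer G x := by
  rw [ContinuousAt, tendsto_nhds_subgroup_iff]
  constructor
  · intro h g hg
    exact (h g).mono fun y hy => MulAction.mem_stabilizer_iff.1 (hy.2 hg)
  · intro h g
    by_cases hg : g ∈ MulAction.stabilizer G x
    · filter_upwards [mem_germStabilizer.1 (h hg)] with y hy
      simp [hg, MulAction.mem_stabilizer_iff, hy]
    · have hg' : g • x ≠ x := hg
      filter_upwards [(isOpen_ne_fun (continuous_const_smul g) continuous_id).mem_nhds hg']
        with y hy
      simpa [hg, MulAction.mem_stabilizer_iff] using hy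

/-- By density of the orbit of `x`, the conjugates of a group between the germ stabilizer and the
stabilizer of `x` accumulate at the stabilizer of every point of continuity. -/
theorem stabilizer_mem_of_between [MulAction.IsMinimal G X] [T2Space X] {B : Set (Subgroup G)}
    (hB : IsClosed B) (hB' : IsConjInvariant B) {K : Subgroup G} (hK : K ∈ B) {x y : X}
    (h1 : germStabilizer G x ≤ K) (h2 : K ≤ MulAction.stabilizer G x)
    (hy : MulAction.stabilizer G y ≤ germStabilizer G y) : MulAction.stabilizer G y ∈ B := by
  have hne : (comap (fun g : G => g • x) (𝓝 y)).NeBot :=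
    comap_neBot fun t ht =>
      (mem_closure_iff_nhds.1 (MulAction.dense_orbit G x y) t ht).elim fun z hz =>
        hz.2.imp fun g (hg : g • x = z) => show g • x ∈ t from hg ▸ hz.1
  let U : Ultrafilter G := Ultrafilter.of (comap (fun g : G => g • x) (𝓝 y))
  have hU : Tendsto (fun g : G => g • x) U (𝓝 y) :=
    tendsto_comap.mono_left (Ultrafilter.of_le _)
  have : ultrafilterLimit U (fun g => conjSubgroup g K) = MulAction.stabilizer G y := by
    ext h
    simp only [mem_ultrafilterLimit, mem_conjSubgroup]
    constructor
    · intro hh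
      refine tendsto_nhds_unique ((hU.const_smul h).congr' ?_) hU
      filter_upwards [hh] with g hg
      have := h2 hg
      rwa [MulAction.mem_stabilizer_iff, mul_smul, mul_smul, inv_smul_eq_iff] at this
    · intro hh
      have h3 : ∀ᶠ z in 𝓝 y, h ∈ germStabilizer G z := eventually_eventually_nhds.2 (hy hh)
      filter_upwards [hU.eventually h3] with g hg
      exact h1 (conj_mem_germStabilizer.2 hg)
  exact this ▸ ultrafilterLimit_mem hB fun g => hB' g K hK

theorem isURS_stabilizerURS [MulAction.IsMinimal G X] [CompactSpace X] [T2Space X]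
    (hreg : ∃ y : X, MulAction.stabilizer G y ≤ germStabilizer G y) :
    IsURS (stabilizerURS G X) := by
  obtain ⟨y, hy⟩ := hreg
  refine ⟨⟨_, subset_closure ⟨y, continuousAt_stabilizer_iff.2 hy, rfl⟩⟩, isClosed_closure,
    IsConjInvariant.closure ?_, fun B hBS hne hB hB' => hBS.antisymm ?_⟩
  · rintro g _ ⟨x, hx, rfl⟩
    refine ⟨g • x, ?_, conjSubgroup_stabilizer g x⟩
    rw [continuousAt_stabilizer_iff] at hx ⊢
    intro h hh
    refine conj_mem_germStabilizer.1 (hx ?_)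
    rwa [← conjSubgroup_stabilizer, mem_conjSubgroup] at hh
  · obtain ⟨K, hK⟩ := hne
    obtain ⟨x, h1, h2⟩ := exists_between_of_mem_stabilizerURS (hBS hK)
    refine closure_minimal ?_ hB
    rintro _ ⟨z, hz, rfl⟩
    exact stabilizer_mem_of_between hB hB' hK h1 h2 (continuousAt_stabilizer_iff.1 hz)

/-- A classification of the uniformly recurrent subgroups by the stabilizer URS. -/
theorem isURS_iff_of_between [MulAction.IsMinimal G X] [CompactSpace X] [T2Space X]
    (hreg : ∃ y : X, MulAction.stabilizer G y ≤ germStabilizer G y)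
    (hbetween : ∀ A : Set (Subgroup G), IsURS A → A = {⊥} ∨ A = {⊤} ∨
      ∃ K ∈ A, ∃ x : X, germStabilizer G x ≤ K ∧ K ≤ MulAction.stabilizer G x)
    (A : Set (Subgroup G)) : IsURS A ↔ A = {⊥} ∨ A = {⊤} ∨ A = stabilizerURS G X := by
  constructor
  · intro hA
    refine (hbetween A hA).imp id (Or.imp id ?_)
    rintro ⟨K, hK, x, h1, h2⟩
    obtain ⟨y, hy⟩ := hreg
    exact hA.eq_of_mem (isURS_stabilizerURS ⟨y, hy⟩)
      (stabilizer_mem_of_between hA.isClosed hA.invariant hK h1 h2 hy)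
      (subset_closure ⟨y, continuousAt_stabilizer_iff.2 hy, rfl⟩)
  · rintro (rfl | rfl | rfl)
    · exact isURS_singleton inferInstance
    · exact isURS_singleton inferInstance
    · exact isURS_stabilizerURS hreg

end Stabilizer

/-! ### Two criteria: simplicity and perfectness -/

section Criteria

/-- A perfect group of homeomorphisms is simple if the supports of any two elements can be
compressed together into any small neighbourhood of a point that is not globally fixed. -/
theorem isSimpleGroup_of_compressible {Γ Y : Type*} [Group Γ] [Nontrivial Γ] [MulAction Γ Y]
    [FaithfulSMul Γ Y] [TopologicalSpace Y] [T2Space Y] [ContinuousConstSMul Γ Y]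
    (hperf : commutator Γ = ⊤)
    (hcomp : ∀ a b δ : Γ, ∀ x : Y, δ • x ≠ x → ∀ O ∈ 𝓝 x,
      ∃ g : Γ, ∀ y : Y, (a • y ≠ y ∨ b • y ≠ y) → g • y ∈ O) : IsSimpleGroup Γ := by
  refine ⟨fun N hN => or_iff_not_imp_left.2 fun hbot => ?_⟩
  obtain ⟨δ, hδN, hδ⟩ := N.bot_or_exists_ne_one.resolve_left hbot
  obtain ⟨x, hx⟩ : ∃ x : Y, δ • x ≠ x := by
    by_contra! hcon
    exact hδ (FaithfulSMul.eq_of_smul_eq_smul (α := Y) fun x => by rw [hcon, one_smul])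
  obtain ⟨A, B, hA, hB, hxA, hxB, hAB⟩ := t2_separation hx
  have hO : B ∩ (δ • ·) ⁻¹' A ∈ 𝓝 x :=
    (hB.inter (hA.preimage (continuous_const_smul δ))).mem_nhds ⟨hxB, hxA⟩
  rw [eq_top_iff, ← hperf, commutator_def, Subgroup.commutator_le]
  intro a _ b _
  obtain ⟨g, hg⟩ := hcomp a b δ x hx _ hO
  have hconj : ∀ c : Γ, (∀ y : Y, c • y ≠ y → g • y ∈ B ∩ (δ • ·) ⁻¹' A) →
      ∀ y ∉ B ∩ (δ • ·) ⁻¹' A, (g * c * g⁻¹) • y = y := by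
    intro c hc y hy
    by_contra hne
    refine hy ?_
    have := hc (g⁻¹ • y) fun h => hne (by rw [mul_smul, mul_smul, h, smul_inv_smul])
    simpa only [smul_inv_smul] using this
  have := commutator_mem_of_moves_off (X := Y) hN hδN
    (fun y hy hy' => Set.disjoint_left.1 hAB hy.2 hy'.1)
    (hconj a fun y hy => hg y (Or.inl hy)) (hconj b fun y hy => hg y (Or.inr hy))
  have h2 := hN.conj_mem _ this g⁻¹
  convert h2 using 1
  simp only [commutatorElement_def]
  group

/-- In a group with `σ τ σ⁻¹ = τ²` the elements `σ⁻ⁱ τʲ σᵏ` form a subgroup. -/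
def baumslagSolitarSubgroup {E : Type*} [Group E] {σ τ : E} (h : σ * τ * σ⁻¹ = τ ^ 2) :
    Subgroup E where
  carrier := {e | ∃ (i k : ℕ) (j : ℤ), e = (σ ^ i)⁻¹ * τ ^ j * σ ^ k}
  one_mem' := ⟨0, 0, 0, by simp⟩
  inv_mem' := by
    rintro _ ⟨i, k, j, rfl⟩
    exact ⟨k, i, -j, by simp [mul_assoc]⟩
  mul_mem' := by
    have hn : ∀ (n : ℕ) (m : ℤ), σ ^ n * τ ^ m = τ ^ (2 ^ n * m) * σ ^ n := by
      intro n m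
      have h1 : ∀ m : ℤ, σ * τ ^ m = τ ^ (2 * m) * σ := fun m => by
        rw [zpow_mul, zpow_ofNat, ← h, conj_zpow]
        group
      induction n generalizing m with
      | zero => simp
      | succ n ih =>
        rw [pow_succ, mul_assoc, h1, ← mul_assoc, ih, mul_assoc, ← pow_succ, ← mul_assoc (2 ^ n),
          ← pow_succ]
    rintro _ _ ⟨i, k, j, rfl⟩ ⟨i', k', j', rfl⟩
    rcases le_total i' k with hk | hk
    · obtain ⟨n, rfl⟩ := Nat.exists_eq_add_of_le' hk
      refine ⟨i, n + k', j + 2 ^ n * j', ?_⟩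
      calc (σ ^ i)⁻¹ * τ ^ j * σ ^ (n + i') * ((σ ^ i')⁻¹ * τ ^ j' * σ ^ k')
          = (σ ^ i)⁻¹ * τ ^ j * (σ ^ n * τ ^ j') * σ ^ k' := by rw [pow_add]; group
        _ = _ := by rw [hn, pow_add, zpow_add]; group
    · obtain ⟨n, rfl⟩ := Nat.exists_eq_add_of_le' hk
      refine ⟨n + i, k', 2 ^ n * j + j', ?_⟩
      calc (σ ^ i)⁻¹ * τ ^ j * σ ^ k * ((σ ^ (n + k))⁻¹ * τ ^ j' * σ ^ k')
          = (σ ^ i)⁻¹ * (σ ^ n)⁻¹ * (σ ^ n * τ ^ j) * (σ ^ n)⁻¹ * τ ^ j' * σ ^ k' := by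
            rw [pow_add]; group
        _ = _ := by rw [hn, pow_add, zpow_add]; group

/-- The quotient of a group `P` by `⁅C, C⁆` is a central extension of `P ⧸ C`. If the latter is the
solvable Baumslag–Solitar group `⟨s, t ∣ s t s⁻¹ = t²⟩`, the extension splits, since the defect of
the relation can be absorbed in `t`; if moreover `P` is generated by conjugates of `s`, there is no
room for a complement, so that `C` is perfect. -/
theorem le_commutator_of_baumslagSolitar {P : Type*} [Group P] {C : Subgroup P} [C.Normal]
    (hcent : ∀ p : P, ∀ c ∈ C, p * c * p⁻¹ * c⁻¹ ∈ ⁅C, C⁆) {s t : P} {S : Set P}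
    (hS : Subgroup.closure S = ⊤) (hconj : ∀ a ∈ S, ∃ p : P, a = p * s * p⁻¹)
    (hrel : s * t * s⁻¹ * (t ^ 2)⁻¹ ∈ C)
    (hform : ∀ p : P, ∃ (i k : ℕ) (j : ℤ), p⁻¹ * ((s ^ i)⁻¹ * t ^ j * s ^ k) ∈ C)
    (hfree : ∀ (i k : ℕ) (j : ℤ), (s ^ i)⁻¹ * t ^ j * s ^ k ∈ C → i = k ∧ j = 0) :
    C ≤ ⁅C, C⁆ := by
  set D := ⁅C, C⁆ with hD
  have hDC : D ≤ C := Subgroup.commutator_le_left C C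
  let π : P →* P ⧸ D := QuotientGroup.mk' D
  have hπ : ∀ {p}, π p = 1 ↔ p ∈ D := fun {p} => QuotientGroup.eq_one_iff p
  have hπC : ∀ p : P, ∀ c ∈ C, π p * π c = π c * π p := by
    intro p c hc
    have := hπ.2 (hcent p c hc)
    simp only [map_mul, map_inv, mul_inv_eq_iff_eq_mul, one_mul] at this
    exact this
  -- the defect of the relation is absorbed in `t`
  set c := s * t * s⁻¹ * (t ^ 2)⁻¹ with hc
  set t' := t * c with ht'
  have hrel' : π s * π t' * (π s)⁻¹ = π t' ^ 2 := by
    have h1 : π s * π t * (π s)⁻¹ = π c * π t ^ 2 := by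
      rw [hc]; simp
    rw [ht', map_mul, (show Commute (π t) (π c) from hπC t c hrel).mul_pow]
    have h2 := hπC s⁻¹ c hrel
    rw [map_inv] at h2
    have h3 := hπC (t ^ 2) c hrel
    rw [map_pow] at h3
    rw [mul_assoc (π s), mul_assoc (π t), ← h2, ← mul_assoc (π t), ← mul_assoc (π s),
      ← mul_assoc (π s), h1, pow_two (π c), ← h3, mul_assoc]
  let κ : P →* P ⧸ C := QuotientGroup.mk' C
  have hκ : ∀ {p}, κ p = 1 ↔ p ∈ C := fun {p} => QuotientGroup.eq_one_iff p
  have hκt : κ t' = κ t := by rw [ht', map_mul, hκ.2 hrel, mul_one]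
  have hE : baumslagSolitarSubgroup hrel' = ⊤ := by
    rw [eq_top_iff, ← Subgroup.map_top_of_surjective π (QuotientGroup.mk'_surjective D), ← hS,
      Subgroup.map_le_iff_le_comap, Subgroup.closure_le]
    intro a ha
    obtain ⟨p, rfl⟩ := hconj a ha
    obtain ⟨i, k, j, hp⟩ := hform p
    set w := (s ^ i)⁻¹ * t' ^ j * s ^ k with hw
    have hpw : p⁻¹ * w ∈ C := by
      rw [← hκ] at hp ⊢
      rw [← hp, hw]
      simp [hκt]
    have hwE : π w ∈ baumslagSolitarSubgroup hrel' := ⟨i, k, j, by simp [hw]⟩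
    have hsE : π s ∈ baumslagSolitarSubgroup hrel' := ⟨0, 1, 0, by simp⟩
    have h4 : π (p * s * p⁻¹) = π w * π s * (π w)⁻¹ := by
      have h5 := hπC s _ hpw
      have h6 : π w = π p * π (p⁻¹ * w) := by rw [← map_mul]; simp
      rw [h6, mul_assoc (π p), ← h5]
      simp only [map_mul, map_inv]
      group
    change π (p * s * p⁻¹) ∈ baumslagSolitarSubgroup hrel'
    rw [h4]
    exact mul_mem (mul_mem hwE hsE) (inv_mem hwE)
  intro p hp
  obtain ⟨i, k, j, hpE⟩ : π p ∈ baumslagSolitarSubgroup hrel' := hE ▸ Subgroup.mem_top _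
  have h7 : p⁻¹ * ((s ^ i)⁻¹ * t' ^ j * s ^ k) ∈ D := by
    rw [← hπ]
    simp only [map_mul, map_inv, map_pow, map_zpow] at hpE ⊢
    rw [hpE, inv_mul_cancel]
  have h8 : (s ^ i)⁻¹ * t ^ j * s ^ k ∈ C := by
    have h9 := C.mul_mem hp (hDC h7)
    rw [← hκ] at h9 ⊢
    rw [← h9]
    simp [hκt]
  obtain ⟨rfl, rfl⟩ := hfree i k j h8
  rw [← hπ, hpE]
  group

end Criteria

/-! ### Dyadic piecewise linear homeomorphisms of the line -/

section DyadicReals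

/-- The dyadic rational numbers, as an additive subgroup of `ℝ`. -/
def dyadicReals : AddSubgroup ℝ where
  carrier := {x | ∃ (m : ℤ) (n : ℕ), x = (m : ℝ) / 2 ^ n}
  zero_mem' := ⟨0, 0, by simp⟩
  add_mem' := by
    rintro _ _ ⟨m, n, rfl⟩ ⟨m', n', rfl⟩
    refine ⟨m * 2 ^ n' + m' * 2 ^ n, n + n', ?_⟩
    rw [pow_add]
    push_cast
    field_simp
  neg_mem' := by
    rintro _ ⟨m, n, rfl⟩
    exact ⟨-m, n, by push_cast; ring⟩

theorem intCast_mem_dyadicReals (m : ℤ) : (m : ℝ) ∈ dyadicReals := ⟨m, 0, by simp⟩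

theorem natCast_mem_dyadicReals (m : ℕ) : (m : ℝ) ∈ dyadicReals := ⟨m, 0, by simp⟩

theorem two_zpow_mul_mem_dyadicReals (k : ℤ) {x : ℝ} (hx : x ∈ dyadicReals) :
    (2 : ℝ) ^ k * x ∈ dyadicReals := by
  obtain ⟨m, n, rfl⟩ := hx
  obtain ⟨j, rfl | rfl⟩ := k.eq_nat_or_neg
  · exact ⟨2 ^ j * m, n, by push_cast; rw [zpow_natCast]; ring⟩
  · refine ⟨m, n + j, ?_⟩
    rw [zpow_neg, zpow_natCast, pow_add]
    field_simp

theorem two_zpow_mul_mem_dyadicReals_iff (k : ℤ) {x : ℝ} :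
    (2 : ℝ) ^ k * x ∈ dyadicReals ↔ x ∈ dyadicReals := by
  refine ⟨fun h => ?_, two_zpow_mul_mem_dyadicReals k⟩
  have := two_zpow_mul_mem_dyadicReals (-k) h
  rwa [← mul_assoc, ← zpow_add₀ two_ne_zero, neg_add_cancel, zpow_zero, one_mul] at this

theorem two_mul_mem_dyadicReals {x : ℝ} (hx : x ∈ dyadicReals) : 2 * x ∈ dyadicReals := by
  rw [two_mul]; exact add_mem hx hx

theorem exists_dyadic_between {u v : ℝ} (h : u < v) : ∃ x ∈ dyadicReals, u < x ∧ x < v := by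
  obtain ⟨n, hn⟩ := exists_pow_lt_of_lt_one (sub_pos.2 h) (by norm_num : (1 / 2 : ℝ) < 1)
  refine ⟨(⌊u * 2 ^ n⌋ + 1 : ℤ) / 2 ^ n, ⟨_, n, rfl⟩, ?_, ?_⟩
  · rw [lt_div_iff₀ (by positivity)]
    push_cast
    exact Int.lt_floor_add_one _
  · rw [div_lt_iff₀ (by positivity)]
    push_cast
    have h1 := Int.floor_le (u * 2 ^ n)
    have h2 : (1 / 2 : ℝ) ^ n * 2 ^ n = 1 := by rw [← mul_pow]; norm_num
    nlinarith [pow_pos (two_pos : (0 : ℝ) < 2) n]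

end DyadicReals

section PiecewiseLinear

/-- Near the point `x`, the function `f` on the line is affine with slope `2^k`. -/
def HasSlopeAt (f : ℝ → ℝ) (x : ℝ) (k : ℤ) : Prop :=
  ∀ᶠ t : ℝ in 𝓝 0, f (x + t) = f x + (2 : ℝ) ^ k * t

/-- The points near which `f` is not affine with a slope in `2^ℤ`. -/
def realBreakpoints (f : ℝ → ℝ) : Set ℝ := {x | ¬ ∃ k : ℤ, HasSlopeAt f x k}

theorem tendsto_two_zpow_mul (k : ℤ) : Tendsto (fun t : ℝ => (2 : ℝ) ^ k * t) (𝓝 0) (𝓝 0) := by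
  have : Continuous (fun t : ℝ => (2 : ℝ) ^ k * t) := by fun_prop
  simpa using this.tendsto 0

theorem HasSlopeAt.comp {f g : ℝ → ℝ} {x : ℝ} {k l : ℤ} (hf : HasSlopeAt f (g x) k)
    (hg : HasSlopeAt g x l) : HasSlopeAt (fun y => f (g y)) x (k + l) := by
  filter_upwards [hg, (tendsto_two_zpow_mul l).eventually hf] with t h1 h2
  rw [h1, h2, zpow_add₀ two_ne_zero, mul_assoc]

theorem HasSlopeAt.symm {f : ℝ ≃ₜ ℝ} {y : ℝ} {k : ℤ} (hf : HasSlopeAt f (f.symm y) k) :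
    HasSlopeAt f.symm y (-k) := by
  filter_upwards [(tendsto_two_zpow_mul (-k)).eventually hf] with t h1
  rw [Homeomorph.symm_apply_eq, h1, f.apply_symm_apply, ← mul_assoc, ← zpow_add₀ two_ne_zero]
  simp

theorem realBreakpoints_mul_subset (f g : ℝ ≃ₜ ℝ) :
    realBreakpoints (f * g : ℝ ≃ₜ ℝ) ⊆ realBreakpoints g ∪ g ⁻¹' realBreakpoints f := by
  intro x hx
  by_contra hx'
  simp only [Set.mem_union, Set.mem_preimage, realBreakpoints, Set.mem_ofPred_eq, not_or,
    not_not] at hx'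
  obtain ⟨⟨k, hk⟩, l, hl⟩ := hx'
  exact hx ⟨l + k, hl.comp hk⟩

/-- The group of piecewise linear homeomorphisms of the line with slopes in `2^ℤ` and finitely
many breakpoints, all dyadic, that preserve the set of dyadic numbers. -/
def PLDyadic : Subgroup (ℝ ≃ₜ ℝ) where
  carrier := {f | (realBreakpoints f).Finite ∧ realBreakpoints f ⊆ dyadicReals ∧
    ∀ x, f x ∈ dyadicReals ↔ x ∈ dyadicReals}
  one_mem' := by
    have h : realBreakpoints (1 : ℝ ≃ₜ ℝ) = ∅ := by
      ext x
      simp only [realBreakpoints, Set.mem_ofPred_eq, Set.mem_empty_iff_false, iff_false, not_not]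
      exact ⟨0, Eventually.of_forall fun t => by simp⟩
    exact ⟨by rw [h]; exact Set.finite_empty, by rw [h]; exact Set.empty_subset _, fun x => Iff.rfl⟩
  mul_mem' := by
    rintro f g ⟨hf1, hf2, hf3⟩ ⟨hg1, hg2, hg3⟩
    refine ⟨(hg1.union (hf1.preimage g.injective.injOn)).subset (realBreakpoints_mul_subset f g),
      fun x hx => ?_, fun x => (hf3 (g x)).trans (hg3 x)⟩
    rcases realBreakpoints_mul_subset f g hx with h' | h'
    · exact hg2 h'
    · exact (hg3 x).1 (hf2 h')
  inv_mem' := by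
    rintro f ⟨hf1, hf2, hf3⟩
    have h : realBreakpoints (f⁻¹ : ℝ ≃ₜ ℝ) ⊆ f.symm ⁻¹' realBreakpoints f := by
      intro y hy
      by_contra hy'
      simp only [Set.mem_preimage, realBreakpoints, Set.mem_ofPred_eq, not_not] at hy'
      obtain ⟨k, hk⟩ := hy'
      exact hy ⟨-k, hk.symm⟩
    have h3 : ∀ y, f.symm y ∈ dyadicReals ↔ y ∈ dyadicReals := fun y => by
      rw [← hf3 (f.symm y), f.apply_symm_apply]
    exact ⟨(hf1.preimage f.symm.injective.injOn).subset h, fun y hy => (h3 y).1 (hf2 (h hy)), h3⟩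

theorem HasSlopeAt.hasDerivAt {f : ℝ → ℝ} {x : ℝ} {k : ℤ} (h : HasSlopeAt f x k) :
    HasDerivAt f ((2 : ℝ) ^ k) x := by
  have h1 : HasDerivAt (fun y => f x + (2 : ℝ) ^ k * (y - x)) ((2 : ℝ) ^ k) x := by
    simpa using (((hasDerivAt_id x).sub_const x).const_mul ((2 : ℝ) ^ k)).const_add (f x)
  refine h1.congr_of_eventuallyEq ?_
  have h2 : Tendsto (fun y : ℝ => y - x) (𝓝 x) (𝓝 0) := by
    have : Continuous (fun y : ℝ => y - x) := by fun_prop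
    simpa using this.tendsto x
  filter_upwards [h2.eventually h] with y hy
  simpa using hy

theorem HasSlopeAt.eventually {f : ℝ → ℝ} {x : ℝ} {k : ℤ} (h : HasSlopeAt f x k) :
    ∀ᶠ y in 𝓝 x, HasSlopeAt f y k := by
  have h2 : Tendsto (fun y : ℝ => y - x) (𝓝 x) (𝓝 0) := by
    have : Continuous (fun y : ℝ => y - x) := by fun_prop
    simpa using this.tendsto x
  filter_upwards [h2.eventually (eventually_eventually_nhds.2 h)] with y hy
  have h3 : Tendsto (fun t : ℝ => y - x + t) (𝓝 0) (𝓝 (y - x)) := by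
    have : Continuous (fun t : ℝ => y - x + t) := by fun_prop
    simpa using this.tendsto 0
  filter_upwards [h3.eventually hy] with t ht
  have h4 := hy.self_of_nhds
  rw [show x + (y - x + t) = y + t by ring] at ht
  rw [show x + (y - x) = y by ring] at h4
  rw [ht, h4]
  ring

/-- A function without breakpoints on an interval is affine there. -/
theorem exists_affine_of_hasSlopeAt {f : ℝ → ℝ} {s : Set ℝ} (hs : IsOpen s)
    (hs' : IsPreconnected s) (hne : s.Nonempty) (h : ∀ x ∈ s, ∃ k, HasSlopeAt f x k) :
    ∃ (k : ℤ) (c : ℝ), ∀ x ∈ s, f x = (2 : ℝ) ^ k * x + c := by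
  have hd : ∀ x ∈ s, HasDerivAt (deriv f) 0 x := fun x hx => by
    obtain ⟨k, hk⟩ := h x hx
    refine (hasDerivAt_const x ((2 : ℝ) ^ k)).congr_of_eventuallyEq ?_
    filter_upwards [hk.eventually] with y hy using hy.hasDerivAt.deriv
  obtain ⟨d, hd⟩ := hs.exists_is_const_of_deriv_eq_zero hs'
    (fun x hx => (hd x hx).differentiableAt.differentiableWithinAt) fun x hx => (hd x hx).deriv
  obtain ⟨x₀, hx₀⟩ := hne
  obtain ⟨k, hk⟩ := h x₀ hx₀
  have hdk : d = (2 : ℝ) ^ k := by rw [← hd x₀ hx₀, hk.hasDerivAt.deriv]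
  have hg : ∀ x ∈ s, HasDerivAt (fun y => f y - (2 : ℝ) ^ k * y) 0 x := fun x hx => by
    obtain ⟨l, hl⟩ := h x hx
    have h1 : HasDerivAt f ((2 : ℝ) ^ k) x := by
      rw [← hdk, ← hd x hx, hl.hasDerivAt.deriv]; exact hl.hasDerivAt
    have h2 := h1.sub ((hasDerivAt_id x).const_mul ((2 : ℝ) ^ k))
    rw [mul_one, sub_self] at h2
    exact h2
  obtain ⟨c, hc⟩ := hs.exists_is_const_of_deriv_eq_zero hs'
    (fun x hx => (hg x hx).differentiableAt.differentiableWithinAt) fun x hx => (hg x hx).deriv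
  exact ⟨k, c, fun x hx => by rw [← hc x hx]; ring⟩

/-- The hinge at `a`: the identity to the left of `a`, expansion by the factor `2` to the right. -/
noncomputable def hinge (a : ℝ) : ℝ ≃ₜ ℝ where
  toFun x := x + max (x - a) 0
  invFun y := y - max (y - a) 0 / 2
  left_inv x := by
    rcases le_total x a with h | h
    · simp [max_eq_right (sub_nonpos.2 h)]
    · simp only [max_eq_left (sub_nonneg.2 h)]
      rw [max_eq_left (by linarith)]
      ring
  right_inv x := by
    rcases le_total x a with h | h
    · simp [max_eq_right (sub_nonpos.2 h)]
    · simp only [max_eq_left (sub_nonneg.2 h)]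
      rw [max_eq_left (by linarith)]
      ring
  continuous_toFun := by fun_prop
  continuous_invFun := by fun_prop

theorem hinge_of_le {a x : ℝ} (h : x ≤ a) : hinge a x = x := by
  change x + max (x - a) 0 = x
  rw [max_eq_right (by linarith), add_zero]

theorem hinge_of_ge {a x : ℝ} (h : a ≤ x) : hinge a x = 2 * x - a := by
  change x + max (x - a) 0 = _
  rw [max_eq_left (by linarith)]
  ring

theorem hinge_inv_of_le {a x : ℝ} (h : x ≤ a) : (hinge a)⁻¹ x = x := by
  change (hinge a).symm x = x
  rw [Homeomorph.symm_apply_eq, hinge_of_le h]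

theorem hinge_inv_of_ge {a x : ℝ} (h : a ≤ x) : (hinge a)⁻¹ x = (x + a) / 2 := by
  change (hinge a).symm x = _
  rw [Homeomorph.symm_apply_eq, hinge_of_ge (by linarith)]
  ring

theorem hinge_zpow_of_le {a x : ℝ} (h : x ≤ a) (k : ℤ) : (hinge a ^ k) x = x := by
  induction k with
  | zero => rfl
  | succ n ih =>
    rw [zpow_add_one]
    change (hinge a ^ (n : ℤ)) (hinge a x) = x
    rw [hinge_of_le h, ih]
  | pred n ih =>
    rw [zpow_sub_one]
    change (hinge a ^ (-n : ℤ)) ((hinge a)⁻¹ x) = x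
    rw [hinge_inv_of_le h, ih]

theorem hinge_zpow_of_ge {a x : ℝ} (h : a ≤ x) (k : ℤ) :
    (hinge a ^ k) x = a + (2 : ℝ) ^ k * (x - a) := by
  induction k generalizing x with
  | zero =>
    rw [zpow_zero, zpow_zero]
    change x = _
    ring
  | succ n ih =>
    rw [zpow_add_one]
    change (hinge a ^ (n : ℤ)) (hinge a x) = _
    rw [hinge_of_ge h, ih (by linarith), zpow_add_one₀ two_ne_zero]
    ring
  | pred n ih =>
    rw [zpow_sub_one]
    change (hinge a ^ (-n : ℤ)) ((hinge a)⁻¹ x) = _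
    rw [hinge_inv_of_ge h, ih (by linarith), zpow_sub_one₀ two_ne_zero]
    ring

theorem hasSlopeAt_hinge_zpow (a : ℝ) (k : ℤ) {x : ℝ} (hx : x ≠ a) :
    ∃ l, HasSlopeAt (hinge a ^ k : ℝ ≃ₜ ℝ) x l := by
  have ht : Tendsto (fun t : ℝ => x + t) (𝓝 0) (𝓝 x) := by
    have : Continuous (fun t : ℝ => x + t) := by fun_prop
    simpa using this.tendsto 0
  rcases lt_or_gt_of_ne hx with h | h
  · refine ⟨0, ?_⟩
    filter_upwards [ht.eventually (gt_mem_nhds h)] with t h1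
    rw [hinge_zpow_of_le h1.le, hinge_zpow_of_le h.le]
    simp
  · refine ⟨k, ?_⟩
    filter_upwards [ht.eventually (lt_mem_nhds h)] with t h1
    rw [hinge_zpow_of_ge h1.le, hinge_zpow_of_ge h.le]
    ring

theorem hinge_mem_PLDyadic {a : ℝ} (ha : a ∈ dyadicReals) : hinge a ∈ PLDyadic := by
  have h : realBreakpoints (hinge a) ⊆ {a} := by
    intro x hx
    by_contra hne
    refine hx ?_
    simpa using hasSlopeAt_hinge_zpow a 1 hne
  refine ⟨(Set.finite_singleton a).subset h, h.trans (by simpa using ha), fun x => ?_⟩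
  rcases le_total x a with hx | hx
  · rw [hinge_of_le hx]
  · rw [hinge_of_ge hx, sub_eq_add_neg, AddSubgroup.add_mem_cancel_right _ (neg_mem ha)]
    simpa using two_zpow_mul_mem_dyadicReals_iff 1 (x := x)

/-- A conjugate of a hinge by a hinge further to the left is again a hinge. -/
theorem hinge_conj {a b : ℝ} (h : a < b) : hinge a * hinge b * (hinge a)⁻¹ = hinge (2 * b - a) := by
  rw [mul_inv_eq_iff_eq_mul]
  ext x
  change hinge a (hinge b x) = hinge (2 * b - a) (hinge a x)
  rcases le_total x a with h1 | h1
  · rw [hinge_of_le (h1.trans h.le), hinge_of_le h1, hinge_of_le (by linarith)]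
  · rcases le_total x b with h2 | h2
    · rw [hinge_of_le h2, hinge_of_ge h1, hinge_of_le (by linarith)]
    · rw [hinge_of_ge h2, hinge_of_ge h1, hinge_of_ge (by linarith), hinge_of_ge (by linarith)]
      ring

/-- Dyadic piecewise linear homeomorphisms that are trivial near `-∞` are products of hinges: the
leftmost breakpoint can be removed by composing with a power of a hinge. -/
theorem mem_closure_hinge {f : ℝ ≃ₜ ℝ} (hf : f ∈ PLDyadic) {u : ℝ} (hu : ∀ x ≤ u, f x = x) :
    f ∈ Subgroup.closure (hinge '' (dyadicReals : Set ℝ)) := by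
  induction hn : (realBreakpoints f).ncard using Nat.strong_induction_on generalizing f u with
  | _ n ih =>
  rcases (realBreakpoints f).eq_empty_or_nonempty with hempty | hne
  · have hslope : ∀ x ∈ Set.univ, ∃ k, HasSlopeAt f x k := fun x _ => by
      by_contra hx
      have : x ∈ realBreakpoints f := hx
      simp [hempty] at this
    obtain ⟨k, c, hkc⟩ := exists_affine_of_hasSlopeAt isOpen_univ isPreconnected_univ
      Set.univ_nonempty hslope
    have h1 := hkc u trivial
    have h2 := hkc (u - 1) trivial
    rw [hu _ le_rfl] at h1
    rw [hu _ (by linarith)] at h2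
    have hk : (2 : ℝ) ^ k = 1 := by linarith
    have : f = 1 := by
      ext x
      have := hkc x trivial
      rw [hk] at this h1
      change f x = x
      linarith
    rw [this]
    exact one_mem _
  obtain ⟨b, hb, hbmin⟩ := Set.exists_min_image _ id hf.1 hne
  have hbD : b ∈ dyadicReals := hf.2.1 hb
  -- the homeomorphism is trivial to the left of `b`
  have hleft : ∀ x < b, f x = x := by
    obtain ⟨k, c, hkc⟩ := exists_affine_of_hasSlopeAt (f := f) (s := Set.Iio b) isOpen_Iio
      isPreconnected_Iio Set.nonempty_Iio fun x hx => by
        by_contra hx'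
        exact absurd (hbmin x hx') (not_le.2 hx)
    have h1 := hkc (min u b - 1) (show _ < b by linarith [min_le_right u b])
    have h2 := hkc (min u b - 2) (show _ < b by linarith [min_le_right u b])
    rw [hu _ (by linarith [min_le_left u b])] at h1 h2
    have hk : (2 : ℝ) ^ k = 1 := by linarith
    intro x hx
    have := hkc x hx
    rw [hk] at this h1
    linarith
  have hleft' : ∀ x ≤ b, f x = x := by
    intro x hx
    refine closure_minimal (s := Set.Iio b) (t := {x | f x = x}) hleft
      (isClosed_eq f.continuous continuous_id) ?_
    rw [closure_Iio]
    exact hx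
  -- to the right of `b` it is affine as far as the next breakpoint
  obtain ⟨ε, hε, hεb⟩ : ∃ ε > 0, ∀ x ∈ Set.Ioo b (b + ε), x ∉ realBreakpoints f := by
    have : (realBreakpoints f \ {b})ᶜ ∈ 𝓝 b :=
      (hf.1.subset Set.sdiff_subset).isClosed.isOpen_compl.mem_nhds (by simp)
    obtain ⟨ε, hε, hball⟩ := Metric.mem_nhds_iff.1 this
    refine ⟨ε, hε, fun x hx hxf => hball (a := x) ?_ ⟨hxf, hx.1.ne'⟩⟩
    rw [Metric.mem_ball, Real.dist_eq, abs_lt]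
    constructor <;> linarith [hx.1, hx.2]
  obtain ⟨k, c, hkc⟩ := exists_affine_of_hasSlopeAt (f := f) (s := Set.Ioo b (b + ε)) isOpen_Ioo
    isPreconnected_Ioo (Set.nonempty_Ioo.2 (by linarith)) fun x hx => not_not.1 (hεb x hx)
  have hbk : f b = (2 : ℝ) ^ k * b + c := by
    have h1 : Set.EqOn f (fun x => (2 : ℝ) ^ k * x + c) (closure (Set.Ioo b (b + ε))) :=
      Set.EqOn.closure hkc f.continuous (by fun_prop)
    refine h1 ?_
    rw [closure_Ioo (by linarith)]
    exact ⟨le_rfl, by linarith⟩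
  rw [hleft' b le_rfl] at hbk
  have hright : ∀ x, b ≤ x → x < b + ε → f x = b + (2 : ℝ) ^ k * (x - b) := by
    intro x hx hx'
    rcases hx.eq_or_lt with rfl | h
    · rw [hleft' b le_rfl]; ring
    · rw [hkc x ⟨h, hx'⟩]; linarith
  set h := hinge b ^ k with hh
  have hhinv : h⁻¹ = hinge b ^ (-k) := by rw [zpow_neg]
  have hhD : h ∈ PLDyadic := zpow_mem (hinge_mem_PLDyadic hbD) k
  have hg : f * h⁻¹ ∈ PLDyadic := mul_mem hf (inv_mem hhD)
  have hinv : ∀ x, h⁻¹ (h x) = x := fun x => h.symm_apply_apply x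
  have hinv' : ∀ x, h (h⁻¹ x) = x := fun x => h.apply_symm_apply x
  have hb0 : HasSlopeAt (f * h⁻¹ : ℝ ≃ₜ ℝ) b 0 := by
    filter_upwards [(tendsto_two_zpow_mul (-k)).eventually (gt_mem_nhds hε)] with t ht
    change f (h⁻¹ (b + t)) = f (h⁻¹ b) + _
    rw [hhinv, hinge_zpow_of_le le_rfl, hleft' b le_rfl]
    rcases le_total t 0 with h0 | h0
    · rw [hinge_zpow_of_le (by linarith), hleft' _ (by linarith)]
      simp
    · have h1 : 0 ≤ (2 : ℝ) ^ (-k) * t := by positivity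
      rw [hinge_zpow_of_ge (by linarith), add_sub_cancel_left, hright _ (by linarith) (by linarith),
        add_sub_cancel_left, ← mul_assoc, ← zpow_add₀ two_ne_zero]
      simp
  have hbrk : realBreakpoints (f * h⁻¹ : ℝ ≃ₜ ℝ) ⊆ h '' (realBreakpoints f \ {b}) := by
    intro x hx
    have hxb : x ≠ b := by
      rintro rfl
      exact hx ⟨0, hb0⟩
    refine ⟨h⁻¹ x, ⟨?_, ?_⟩, hinv' x⟩
    · refine (realBreakpoints_mul_subset f h⁻¹ hx).resolve_left fun hx' => hx' ?_
      rw [hhinv]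
      exact hasSlopeAt_hinge_zpow b (-k) hxb
    · intro hxb'
      refine hxb ?_
      rw [← hinv' x, Set.mem_singleton_iff.1 hxb', hh, hinge_zpow_of_le le_rfl]
  have hcard : (realBreakpoints (f * h⁻¹ : ℝ ≃ₜ ℝ)).ncard < n := by
    have hfin : (realBreakpoints f \ {b}).Finite := hf.1.subset Set.sdiff_subset
    calc _ ≤ (h '' (realBreakpoints f \ {b})).ncard := Set.ncard_le_ncard hbrk (hfin.image _)
      _ ≤ (realBreakpoints f \ {b}).ncard := Set.ncard_image_le hfin
      _ < (realBreakpoints f).ncard := Set.ncard_sdiff_singleton_lt_of_mem hb hf.1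
      _ = n := hn
  have := ih _ hcard hg (u := b) (fun x hx => by
    change f (h⁻¹ x) = x
    rw [hhinv, hinge_zpow_of_le hx, hleft' x hx]) rfl
  have h3 : f = f * h⁻¹ * h := by group
  rw [h3]
  exact mul_mem this (zpow_mem (Subgroup.subset_closure (Set.mem_image_of_mem hinge hbD)) k)

/-- The bump on `[a, a + 3 L]`: it has slope `2` on the first third of the interval, slope `1/2` on
the rest of it, and is trivial elsewhere. -/
noncomputable def bump (a L : ℝ) : ℝ ≃ₜ ℝ :=
  hinge (a + 3 * L) * (hinge (a + 2 * L))⁻¹ * (hinge (a + 2 * L))⁻¹ * hinge a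

theorem bump_apply (a L x : ℝ) : bump a L x =
    hinge (a + 3 * L) ((hinge (a + 2 * L))⁻¹ ((hinge (a + 2 * L))⁻¹ (hinge a x))) := rfl

theorem bump_of_le_start {a L x : ℝ} (hL : 0 ≤ L) (hx : x ≤ a) : bump a L x = x := by
  have h2 : (hinge (a + 2 * L))⁻¹ x = x := hinge_inv_of_le (by linarith)
  rw [bump_apply, hinge_of_le hx, h2, h2, hinge_of_le (by linarith)]

theorem bump_of_mem_left {a L x : ℝ} (hL : 0 ≤ L) (hx : a ≤ x) (hx' : x ≤ a + L) :
    bump a L x = 2 * x - a := by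
  have h2 : (hinge (a + 2 * L))⁻¹ (2 * x - a) = 2 * x - a := hinge_inv_of_le (by linarith)
  rw [bump_apply, hinge_of_ge hx, h2, h2, hinge_of_le (by linarith)]

theorem hinge_inv_inv_hinge {a L x : ℝ} (hL : 0 ≤ L) (hx : a + L ≤ x) :
    (hinge (a + 2 * L))⁻¹ ((hinge (a + 2 * L))⁻¹ (hinge a x)) = (x + a + 3 * L) / 2 := by
  rw [hinge_of_ge (show a ≤ x by linarith),
    hinge_inv_of_ge (show a + 2 * L ≤ 2 * x - a by linarith), hinge_inv_of_ge (by linarith)]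
  ring

theorem bump_of_mem_right {a L x : ℝ} (hL : 0 ≤ L) (hx : a + L ≤ x) (hx' : x ≤ a + 3 * L) :
    bump a L x = (x + a + 3 * L) / 2 := by
  rw [bump_apply, hinge_inv_inv_hinge hL hx, hinge_of_le (by linarith)]

theorem bump_of_ge_end {a L x : ℝ} (hL : 0 ≤ L) (hx : a + 3 * L ≤ x) : bump a L x = x := by
  rw [bump_apply, hinge_inv_inv_hinge hL (by linarith), hinge_of_ge (by linarith)]
  ring

theorem three_mul_mem_dyadicReals {x : ℝ} (hx : x ∈ dyadicReals) : 3 * x ∈ dyadicReals := by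
  have := add_mem (two_mul_mem_dyadicReals hx) hx
  rwa [show 2 * x + x = 3 * x by ring] at this

theorem bump_mem_PLDyadic {a L : ℝ} (ha : a ∈ dyadicReals) (hL : L ∈ dyadicReals) :
    bump a L ∈ PLDyadic := by
  have h2 := inv_mem (hinge_mem_PLDyadic (add_mem ha (two_mul_mem_dyadicReals hL)))
  have h3 := hinge_mem_PLDyadic (add_mem ha (three_mul_mem_dyadicReals hL))
  exact mul_mem (mul_mem (mul_mem h3 h2) h2) (hinge_mem_PLDyadic ha)

end PiecewiseLinear

/-! ### Perfectness and simplicity of groups of compactly supported maps -/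

instance homeomorph_faithfulSMul (X : Type*) [TopologicalSpace X] : FaithfulSMul (X ≃ₜ X) X :=
  ⟨fun h => Homeomorph.ext h⟩

instance homeomorph_continuousConstSMul (X : Type*) [TopologicalSpace X] :
    ContinuousConstSMul (X ≃ₜ X) X := ⟨fun f => f.continuous⟩

instance subgroup_continuousConstSMul {G X : Type*} [Group G] [TopologicalSpace X] [MulAction G X]
    [ContinuousConstSMul G X] (S : Subgroup G) : ContinuousConstSMul S X :=
  ⟨fun s => continuous_const_smul (s : G)⟩

section GermsAtInfinity

/-- Near `+∞` the map `f` is `x ↦ 2^k x + c`. -/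
def HasGermAtTop (f : ℝ ≃ₜ ℝ) (k : ℤ) (c : ℝ) : Prop :=
  ∀ᶠ x in atTop, f x = (2 : ℝ) ^ k * x + c

theorem tendsto_two_zpow_mul_add (k : ℤ) (c : ℝ) :
    Tendsto (fun x : ℝ => (2 : ℝ) ^ k * x + c) atTop atTop :=
  tendsto_atTop_add_const_right _ _ (tendsto_id.const_mul_atTop (by positivity))

theorem hasGermAtTop_one : HasGermAtTop 1 0 0 := Eventually.of_forall fun x => by simp

theorem HasGermAtTop.mul {f g : ℝ ≃ₜ ℝ} {k l : ℤ} {c d : ℝ} (hf : HasGermAtTop f k c)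
    (hg : HasGermAtTop g l d) : HasGermAtTop (f * g) (k + l) (2 ^ k * d + c) := by
  filter_upwards [hg, (tendsto_two_zpow_mul_add l d).eventually hf] with x h1 h2
  change f (g x) = _
  rw [h1, h2, zpow_add₀ two_ne_zero]
  ring

theorem HasGermAtTop.inv {f : ℝ ≃ₜ ℝ} {k : ℤ} {c : ℝ} (hf : HasGermAtTop f k c) :
    HasGermAtTop f⁻¹ (-k) (-(2 ^ (-k) * c)) := by
  filter_upwards [(tendsto_two_zpow_mul_add (-k) (-(2 ^ (-k) * c))).eventually hf] with x h
  change f.symm x = _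
  rw [Homeomorph.symm_apply_eq, h, zpow_neg]
  field_simp
  ring

theorem HasGermAtTop.unique {f : ℝ ≃ₜ ℝ} {k l : ℤ} {c d : ℝ} (h : HasGermAtTop f k c)
    (h' : HasGermAtTop f l d) : k = l ∧ c = d := by
  obtain ⟨N, hN⟩ := eventually_atTop.1 (h.and h')
  have h1 := hN N le_rfl
  have h2 := hN (N + 1) (by linarith)
  have h3 : (2 : ℝ) ^ k = 2 ^ l := by linarith [h1.1.symm.trans h1.2, h2.1.symm.trans h2.2]
  refine ⟨zpow_right_injective₀ two_pos (by norm_num) h3, ?_⟩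
  have := h1.1.symm.trans h1.2
  rw [h3] at this
  linarith

theorem HasGermAtTop.congr {f g : ℝ ≃ₜ ℝ} {k l : ℤ} {c d : ℝ} (h : HasGermAtTop f k c)
    (hfg : f = g) (hkl : k = l) (hcd : c = d) : HasGermAtTop g l d := by
  subst hfg hkl hcd
  exact h

theorem HasGermAtTop.pow {f : ℝ ≃ₜ ℝ} {k : ℤ} (h : HasGermAtTop f k 0) (n : ℕ) :
    HasGermAtTop (f ^ n) (n * k) 0 := by
  induction n with
  | zero => simpa using hasGermAtTop_one
  | succ n ih =>
    rw [pow_succ]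
    convert ih.mul h using 1
    · push_cast; ring
    · simp

theorem HasGermAtTop.zpow {f : ℝ ≃ₜ ℝ} {c : ℝ} (h : HasGermAtTop f 0 c) (n : ℤ) :
    HasGermAtTop (f ^ n) 0 (n * c) := by
  have hnat : ∀ n : ℕ, HasGermAtTop (f ^ n) 0 (n * c) := fun n => by
    induction n with
    | zero => simpa using hasGermAtTop_one
    | succ n ih =>
      rw [pow_succ]
      convert ih.mul h using 1
      push_cast
      simp
      ring
  obtain ⟨m, rfl | rfl⟩ := n.eq_nat_or_neg
  · simpa using hnat m
  · simpa using (hnat m).inv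

theorem exists_hasGermAtTop {f : ℝ ≃ₜ ℝ} (hf : f ∈ PLDyadic) :
    ∃ (k : ℤ) (c : ℝ), c ∈ dyadicReals ∧ HasGermAtTop f k c := by
  obtain ⟨M, hM⟩ := hf.1.bddAbove
  obtain ⟨k, c, h⟩ := exists_affine_of_hasSlopeAt (f := f) (s := Set.Ioi M) isOpen_Ioi
    isPreconnected_Ioi Set.nonempty_Ioi fun x hx => by
      by_contra hx'
      exact absurd (hM hx') (not_le.2 hx)
  refine ⟨k, c, ?_, (eventually_gt_atTop M).mono h⟩
  obtain ⟨n, hn⟩ := exists_nat_gt M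
  have h1 := h n hn
  have h2 := (hf.2.2 n).2 (natCast_mem_dyadicReals n)
  rw [h1] at h2
  exact (AddSubgroup.add_mem_cancel_left _
    (two_zpow_mul_mem_dyadicReals k (natCast_mem_dyadicReals n))).1 h2

theorem hasGermAtTop_hinge (a : ℝ) : HasGermAtTop (hinge a) 1 (-a) := by
  filter_upwards [eventually_ge_atTop a] with x hx
  rw [hinge_of_ge hx]
  ring

/-- The dyadic piecewise linear homeomorphisms that are trivial near `-∞`. -/
def leftTrivial : Subgroup (ℝ ≃ₜ ℝ) where
  carrier := {f | f ∈ PLDyadic ∧ ∃ u, ∀ x ≤ u, f x = x}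
  one_mem' := ⟨one_mem _, 0, fun _ _ => rfl⟩
  mul_mem' := by
    rintro f g ⟨hf, u, hu⟩ ⟨hg, v, hv⟩
    refine ⟨mul_mem hf hg, min u v, fun x hx => ?_⟩
    change f (g x) = x
    rw [hv x (hx.trans (min_le_right _ _)), hu x (hx.trans (min_le_left _ _))]
  inv_mem' := by
    rintro f ⟨hf, u, hu⟩
    refine ⟨inv_mem hf, u, fun x hx => ?_⟩
    change f.symm x = x
    rw [Homeomorph.symm_apply_eq, hu x hx]

/-- The elements of `leftTrivial` that are trivial near `+∞`, that is, the compactly supported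
ones. -/
def leftTrivialCompact : Subgroup leftTrivial where
  carrier := {f | HasGermAtTop f 0 0}
  one_mem' := hasGermAtTop_one
  mul_mem' := by
    intro f g hf hg
    have h := HasGermAtTop.mul hf hg
    simpa using h
  inv_mem' := by
    intro f hf
    have h := HasGermAtTop.inv hf
    simpa using h

theorem mem_leftTrivialCompact {f : leftTrivial} :
    f ∈ leftTrivialCompact ↔ HasGermAtTop f 0 0 := Iff.rfl

instance leftTrivialCompact_normal : leftTrivialCompact.Normal := by
  refine ⟨fun f hf g => ?_⟩
  obtain ⟨k, c, -, hg⟩ := exists_hasGermAtTop g.2.1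
  have := (hg.mul hf).mul hg.inv
  refine this.congr rfl (by ring) ?_
  rw [zpow_neg, add_zero]
  field_simp
  ring

/-- The hinge at a dyadic number, as an element of `leftTrivial`. -/
noncomputable def leftTrivialHinge (a : dyadicReals) : leftTrivial :=
  ⟨hinge a, hinge_mem_PLDyadic a.2, a, fun _ hx => hinge_of_le hx⟩

theorem closure_leftTrivialHinge : Subgroup.closure (Set.range leftTrivialHinge) = ⊤ := by
  rw [eq_top_iff]
  intro f _
  obtain ⟨u, hu⟩ := f.2.2
  have h := mem_closure_hinge f.2.1 hu
  have himg : hinge '' (dyadicReals : Set ℝ) =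
      leftTrivial.subtype '' Set.range leftTrivialHinge := by
    ext g
    constructor
    · rintro ⟨a, ha, rfl⟩
      exact ⟨_, ⟨⟨a, ha⟩, rfl⟩, rfl⟩
    · rintro ⟨_, ⟨a, rfl⟩, rfl⟩
      exact ⟨a, a.2, rfl⟩
  rw [himg, ← MonoidHom.map_closure] at h
  obtain ⟨g, hg, hgf⟩ := h
  rwa [Subtype.ext hgf] at hg

theorem exists_conj_leftTrivialHinge (a : dyadicReals) :
    ∃ p, leftTrivialHinge a = p * leftTrivialHinge 0 * p⁻¹ := by
  rcases lt_trichotomy (a : ℝ) 0 with h | h | h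
  · refine ⟨(leftTrivialHinge (a + a))⁻¹, ?_⟩
    have h1 : leftTrivialHinge (a + a) * leftTrivialHinge a * (leftTrivialHinge (a + a))⁻¹ =
        leftTrivialHinge 0 := by
      refine Subtype.ext ((hinge_conj (a := ((a + a : dyadicReals) : ℝ)) (b := a) ?_).trans ?_)
      · push_cast; linarith
      · push_cast
        rw [show 2 * (a : ℝ) - (a + a) = 0 by ring]
        rfl
    rw [← h1]
    group
  · refine ⟨1, ?_⟩
    have : a = 0 := Subtype.ext h
    simp [this]
  · refine ⟨leftTrivialHinge (-a), ?_⟩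
    refine Subtype.ext ((hinge_conj (a := ((-a : dyadicReals) : ℝ)) (b := 0) ?_).trans ?_).symm
    · push_cast; linarith
    · push_cast
      rw [show 2 * (0 : ℝ) - -a = a by ring]
      rfl

/-- On a compactly supported map, a hinge acts by conjugation in the same way as a long bump. -/
theorem conj_leftTrivialCompact_mem_commutator (p c : leftTrivial) (hc : c ∈ leftTrivialCompact) :
    p * c * p⁻¹ * c⁻¹ ∈ ⁅leftTrivialCompact, leftTrivialCompact⁆ := by
  have hp : p ∈ Subgroup.closure (Set.range leftTrivialHinge) :=
    closure_leftTrivialHinge ▸ Subgroup.mem_top p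
  induction hp using Subgroup.closure_induction generalizing c with
  | mem p hp =>
    obtain ⟨a, rfl⟩ := hp
    obtain ⟨M, hM⟩ := eventually_atTop.1 (mem_leftTrivialCompact.1 hc)
    obtain ⟨n, hn⟩ := exists_nat_ge (M - a)
    have hb := bump_mem_PLDyadic a.2 (natCast_mem_dyadicReals n)
    have hn0 : (0 : ℝ) ≤ n := n.cast_nonneg
    let b : leftTrivial := ⟨bump a n, hb, a, fun x hx => bump_of_le_start hn0 hx⟩
    have hbC : b ∈ leftTrivialCompact := by
      rw [mem_leftTrivialCompact]
      filter_upwards [eventually_ge_atTop (a + 3 * n : ℝ)] with x hx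
      simpa using bump_of_ge_end hn0 hx
    have hcomm : Commute (b⁻¹ * leftTrivialHinge a) c :=
      commute_of_disjoint_support (X := ℝ) fun x => by
        rcases le_total x (a + n) with hx | hx
        · left
          rw [mul_smul, inv_smul_eq_iff]
          change hinge a x = bump a n x
          rcases le_total x a with hx' | hx'
          · rw [hinge_of_le hx', bump_of_le_start hn0 hx']
          · rw [hinge_of_ge hx', bump_of_mem_left hn0 hx' hx]
        · right
          have := hM x (by linarith)
          rwa [zpow_zero, one_mul, add_zero] at this
    have h2 : leftTrivialHinge a * c * (leftTrivialHinge a)⁻¹ * c⁻¹ = ⁅b, c⁆ := by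
      have h3 : leftTrivialHinge a = b * (b⁻¹ * leftTrivialHinge a) := by group
      rw [h3, mul_assoc b _ c, hcomm.eq, commutatorElement_def]
      group
    rw [h2]
    exact Subgroup.commutator_mem_commutator hbC hc
  | one => simp
  | mul p q _ _ ihp ihq =>
    have h1 := ihp (q * c * q⁻¹) (leftTrivialCompact_normal.conj_mem c hc q)
    have := mul_mem h1 (ihq c hc)
    convert this using 1
    group
  | inv p _ ih =>
    have h1 := ih (p⁻¹ * c * p⁻¹⁻¹) (leftTrivialCompact_normal.conj_mem c hc p⁻¹)
    have := inv_mem h1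
    convert this using 1
    group

/-- The germs at `+∞` form the solvable Baumslag–Solitar group, generated by `x ↦ 2 x` and
`x ↦ x + 1`. -/
theorem leftTrivialCompact_le_commutator :
    leftTrivialCompact ≤ ⁅leftTrivialCompact, leftTrivialCompact⁆ := by
  let s := leftTrivialHinge 0
  let t := leftTrivialHinge ⟨-1, neg_mem (by simpa using intCast_mem_dyadicReals 1)⟩ * s⁻¹
  have hs : HasGermAtTop s 1 0 :=
    (hasGermAtTop_hinge 0).congr rfl rfl neg_zero
  have ht : HasGermAtTop t 0 1 := by
    exact ((hasGermAtTop_hinge (-1)).mul hs.inv).congr rfl (by ring) (by simp)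
  have hw : ∀ (i k : ℕ) (j : ℤ),
      HasGermAtTop ((s ^ i)⁻¹ * t ^ j * s ^ k : leftTrivial) (k - i) (2 ^ (-i : ℤ) * j) := by
    intro i k j
    exact (((hs.pow i).inv.mul (ht.zpow j)).mul (hs.pow k)).congr rfl (by ring) (by simp)
  refine le_commutator_of_baumslagSolitar conj_leftTrivialCompact_mem_commutator
    (s := s) (t := t) closure_leftTrivialHinge ?_ ?_ ?_ ?_
  · rintro _ ⟨a, rfl⟩
    exact exists_conj_leftTrivialHinge a
  · exact (((hs.mul ht).mul hs.inv).mul (ht.zpow 2).inv).congr rfl (by ring) (by norm_num)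
  · intro p
    obtain ⟨m, _, ⟨u, n, rfl⟩, hp⟩ := exists_hasGermAtTop p.2.1
    obtain ⟨k, hk⟩ : ∃ k : ℕ, (k : ℤ) = m + (n + m.natAbs : ℕ) :=
      ⟨(m + (n + m.natAbs : ℕ)).toNat, Int.toNat_of_nonneg (by
        push_cast; linarith [neg_abs_le m, Int.natCast_nonneg n])⟩
    refine ⟨n + m.natAbs, k, u * 2 ^ m.natAbs, ?_⟩
    refine (hp.inv.mul (hw (n + m.natAbs) k (u * 2 ^ m.natAbs))).congr rfl ?_ ?_
    · rw [hk]; ring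
    · have h1 : (2 : ℝ) ^ (-((n + m.natAbs : ℕ) : ℤ)) * ((u * 2 ^ m.natAbs : ℤ) : ℝ) =
          u / 2 ^ n := by
        rw [zpow_neg, zpow_natCast, pow_add]
        push_cast
        field_simp
      rw [h1]
      ring
  · intro i k j h
    obtain ⟨h1, h2⟩ := (hw i k j).unique (mem_leftTrivialCompact.1 h)
    refine ⟨by omega, ?_⟩
    simpa using h2

end GermsAtInfinity

section Compress

/-- The homeomorphisms in `PLDyadic` that are supported in a compact part of `(p, q)`. -/
def plCompact (p q : ℝ) : Subgroup (ℝ ≃ₜ ℝ) where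
  carrier := {f | f ∈ PLDyadic ∧ ∃ u v, p < u ∧ v < q ∧ ∀ x ∉ Set.Icc u v, f x = x}
  one_mem' := ⟨one_mem _, p + 1, q - 1, by linarith, by linarith, fun _ _ => rfl⟩
  mul_mem' := by
    rintro f g ⟨hf, u, v, hu, hv, h⟩ ⟨hg, u', v', hu', hv', h'⟩
    refine ⟨mul_mem hf hg, min u u', max v v', lt_min hu hu', max_lt hv hv', fun x hx => ?_⟩
    change f (g x) = x
    rw [h' x fun hx' => hx ⟨(min_le_right _ _).trans hx'.1, hx'.2.trans (le_max_right _ _)⟩,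
      h x fun hx' => hx ⟨(min_le_left _ _).trans hx'.1, hx'.2.trans (le_max_left _ _)⟩]
  inv_mem' := by
    rintro f ⟨hf, u, v, hu, hv, h⟩
    refine ⟨inv_mem hf, u, v, hu, hv, fun x hx => ?_⟩
    change f.symm x = x
    rw [Homeomorph.symm_apply_eq, h x hx]

/-- The homeomorphisms in `PLDyadic` that are supported in `[u, v]`. -/
def plSupported (u v : ℝ) : Subgroup (ℝ ≃ₜ ℝ) where
  carrier := {f | f ∈ PLDyadic ∧ ∀ x ∉ Set.Icc u v, f x = x}
  one_mem' := ⟨one_mem _, fun _ _ => rfl⟩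
  mul_mem' := by
    rintro f g ⟨hf, h⟩ ⟨hg, h'⟩
    refine ⟨mul_mem hf hg, fun x hx => ?_⟩
    change f (g x) = x
    rw [h' x hx, h x hx]
  inv_mem' := by
    rintro f ⟨hf, h⟩
    refine ⟨inv_mem hf, fun x hx => ?_⟩
    change f.symm x = x
    rw [Homeomorph.symm_apply_eq, h x hx]

theorem plSupported_mono {u v u' v' : ℝ} (hu : u' ≤ u) (hv : v ≤ v') :
    plSupported u v ≤ plSupported u' v' := fun _ hf =>
  ⟨hf.1, fun x hx => hf.2 x fun hx' => hx ⟨hu.trans hx'.1, hx'.2.trans hv⟩⟩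

theorem plSupported_le_plCompact {p q u v : ℝ} (hu : p < u) (hv : v < q) :
    plSupported u v ≤ plCompact p q := fun _ hf => ⟨hf.1, u, v, hu, hv, hf.2⟩

theorem bump_mem_plSupported {a L : ℝ} (ha : a ∈ dyadicReals) (hL : L ∈ dyadicReals)
    (hL0 : 0 ≤ L) : bump a L ∈ plSupported a (a + 3 * L) := by
  refine ⟨bump_mem_PLDyadic ha hL, fun x hx => ?_⟩
  rw [Set.mem_Icc, not_and_or, not_le, not_le] at hx
  rcases hx with h | h
  · exact bump_of_le_start hL0 h.le
  · exact bump_of_ge_end hL0 h.le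

theorem lt_bump {a L x : ℝ} (hx : a < x) (hx' : x < a + 3 * L) : x < bump a L x := by
  have hL : 0 ≤ L := by linarith
  rcases le_total x (a + L) with h | h
  · rw [bump_of_mem_left hL hx.le h]; linarith
  · rw [bump_of_mem_right hL h hx'.le]; linarith

theorem strictMono_bump {a L : ℝ} (hL : 0 ≤ L) : StrictMono (bump a L) := by
  refine ((bump a L).continuous.strictMono_of_inj (bump a L).injective).resolve_right fun h => ?_
  have := h (show a - 1 < a by linarith)
  rw [bump_of_le_start hL le_rfl, bump_of_le_start hL (by linarith)] at this
  linarith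

theorem strictMono_symm {f : ℝ ≃ₜ ℝ} (hf : StrictMono f) : StrictMono f.symm := fun x y h => by
  rw [← hf.lt_iff_lt]
  simpa using h

theorem homeomorph_pow_apply (f : ℝ ≃ₜ ℝ) (n : ℕ) (x : ℝ) : (f ^ n) x = f^[n] x := by
  induction n generalizing x with
  | zero => rfl
  | succ n ih => rw [pow_succ, Function.iterate_succ_apply, ← ih]; rfl

theorem eq_of_bump_eq {a L x : ℝ} (hx : a ≤ x) (hx' : x ≤ a + 3 * L) (h : bump a L x = x) :
    x = a ∨ x = a + 3 * L := by
  by_contra! hcon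
  exact (lt_bump (lt_of_le_of_ne hx hcon.1.symm) (lt_of_le_of_ne hx' hcon.2)).ne' h

theorem tendsto_bump_iterate {a L x : ℝ} (hx : a < x) (hx' : x ≤ a + 3 * L) :
    Tendsto (fun n => (bump a L)^[n] x) atTop (𝓝 (a + 3 * L)) := by
  have hL : 0 ≤ L := by linarith
  have hmono := (strictMono_bump (a := a) hL)
  have hle : x ≤ bump a L x := by
    rcases hx'.eq_or_lt with rfl | h
    · rw [bump_of_ge_end hL le_rfl]
    · exact (lt_bump hx h).le
  have h1 := hmono.monotone.monotone_iterate_of_le_map hle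
  have hfix : ∀ n, (bump a L)^[n] (a + 3 * L) = a + 3 * L := fun n =>
    Function.iterate_fixed (bump_of_ge_end hL le_rfl) n
  have hbd : ∀ n, (bump a L)^[n] x ≤ a + 3 * L := fun n =>
    (hmono.monotone.iterate n hx').trans_eq (hfix n)
  have ht := tendsto_atTop_ciSup h1 ⟨a + 3 * L, by rintro _ ⟨n, rfl⟩; exact hbd n⟩
  have hy := isFixedPt_of_tendsto_iterate ht (bump a L).continuous.continuousAt
  have hxy := ge_of_tendsto' ht fun n => h1 (Nat.zero_le n)
  have hy' := le_of_tendsto' ht hbd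
  have hxy' : x ≤ _ := hxy
  rcases eq_of_bump_eq (hx.le.trans hxy') hy' hy with h | h
  · linarith
  · rwa [h] at ht

theorem tendsto_bump_symm_iterate {a L x : ℝ} (hx : a ≤ x) (hx' : x < a + 3 * L) :
    Tendsto (fun n => (bump a L).symm^[n] x) atTop (𝓝 a) := by
  have hL : 0 ≤ L := by linarith
  have hmono := strictMono_symm (strictMono_bump (a := a) hL)
  have hle : (bump a L).symm x ≤ x := by
    rw [← (strictMono_bump (a := a) hL).le_iff_le, Homeomorph.apply_symm_apply]
    rcases hx.eq_or_lt with rfl | h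
    · rw [bump_of_le_start hL le_rfl]
    · exact (lt_bump h hx').le
  have h1 := hmono.monotone.antitone_iterate_of_map_le hle
  have hfix : ∀ n, (bump a L).symm^[n] a = a := fun n =>
    Function.iterate_fixed (by rw [Homeomorph.symm_apply_eq, bump_of_le_start hL le_rfl]) n
  have hbd : ∀ n, a ≤ (bump a L).symm^[n] x := fun n =>
    (hfix n).symm.le.trans (hmono.monotone.iterate n hx)
  have ht := tendsto_atTop_ciInf h1 ⟨a, by rintro _ ⟨n, rfl⟩; exact hbd n⟩
  have hy := isFixedPt_of_tendsto_iterate ht (bump a L).symm.continuous.continuousAt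
  have hxy := le_of_tendsto' ht fun n => h1 (Nat.zero_le n)
  have hy' := ge_of_tendsto' ht hbd
  have hxy' : _ ≤ x := hxy
  have hy2 := (Homeomorph.symm_apply_eq _).1 hy
  rcases eq_of_bump_eq hy' (hxy'.trans hx'.le) hy2.symm with h | h
  · rwa [h] at ht
  · linarith

/-- Points to the right of `a` can be pushed close to `a`. -/
theorem exists_push_left {a v q δ : ℝ} (ha : a ∈ dyadicReals) (hav : a ≤ v) (hvq : v < q)
    (hδ : 0 < δ) : ∃ w < q, ∃ g ∈ plSupported a w, ∀ x, a ≤ x → x ≤ v → a ≤ g x ∧ g x < a + δ := by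
  obtain ⟨L, hL, hL1, hL2⟩ := exists_dyadic_between (show (v - a) / 3 < (q - a) / 3 by linarith)
  have hL0 : 0 ≤ L := by linarith
  obtain ⟨n, hn⟩ := ((tendsto_bump_symm_iterate (x := v) hav (by linarith)).eventually
    (gt_mem_nhds (show a < a + δ by linarith))).exists
  refine ⟨a + 3 * L, by linarith, (bump a L)⁻¹ ^ n,
    pow_mem (inv_mem (bump_mem_plSupported ha hL hL0)) n, fun x hx hx' => ?_⟩
  rw [homeomorph_pow_apply]
  change a ≤ (bump a L).symm^[n] x ∧ (bump a L).symm^[n] x < a + δ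
  have hmono := (strictMono_symm (strictMono_bump (a := a) hL0)).monotone.iterate n
  have hfix : (bump a L).symm^[n] a = a :=
    Function.iterate_fixed (by rw [Homeomorph.symm_apply_eq, bump_of_le_start hL0 le_rfl]) n
  exact ⟨hfix.symm.le.trans (hmono hx), (hmono hx').trans_lt hn⟩

/-- Points to the left of `d` can be pushed close to `d`. -/
theorem exists_push_right {d u p δ : ℝ} (hd : d ∈ dyadicReals) (hud : u ≤ d) (hpu : p < u)
    (hδ : 0 < δ) : ∃ w > p, ∃ g ∈ plSupported w d, ∀ x, u ≤ x → x ≤ d → d - δ < g x ∧ g x ≤ d := by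
  obtain ⟨L, hL, hL1, hL2⟩ := exists_dyadic_between (show (d - u) / 3 < (d - p) / 3 by linarith)
  have hL0 : 0 ≤ L := by linarith
  set a := d - 3 * L with ha
  have had : a + 3 * L = d := by rw [ha]; ring
  have haD : a ∈ dyadicReals := sub_mem hd (three_mul_mem_dyadicReals hL)
  obtain ⟨n, hn⟩ := ((tendsto_bump_iterate (a := a) (x := u) (L := L) (by linarith)
    (by linarith)).eventually (lt_mem_nhds (show d - δ < a + 3 * L by linarith))).exists
  have hs := bump_mem_plSupported haD hL hL0
  rw [had] at hs
  refine ⟨a, by linarith, bump a L ^ n, pow_mem hs n, fun x hx hx' => ?_⟩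
  rw [homeomorph_pow_apply]
  have hmono := (strictMono_bump (a := a) hL0).monotone.iterate n
  have hfix : (bump a L)^[n] d = d :=
    Function.iterate_fixed (bump_of_ge_end hL0 had.le) n
  exact ⟨hn.trans_le (hmono hx), (hmono hx').trans_eq hfix⟩

/-- A compact part of `(p, q)` can be compressed into any given subinterval. -/
theorem exists_compress {p q u v o₁ o₂ : ℝ} (hu : p < u) (hv : v < q) (h₁ : p ≤ o₁) (h : o₁ < o₂)
    (h₂ : o₂ ≤ q) : ∃ g ∈ plCompact p q, ∀ x ∈ Set.Icc u v, g x ∈ Set.Ioo o₁ o₂ := by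
  obtain ⟨a, ha, ha1, ha2⟩ := exists_dyadic_between h
  obtain ⟨w, hw, g, hg, hgx⟩ := exists_push_left (v := max v a) (q := q) (δ := o₂ - a) ha
    (le_max_right _ _) (max_lt hv (by linarith)) (by linarith)
  obtain ⟨w', hw', g', hg', hgx'⟩ := exists_push_right (u := min u a) (p := p) (δ := a - o₁) ha
    (min_le_right _ _) (lt_min hu (by linarith)) (by linarith)
  refine ⟨g * g', mul_mem (plSupported_le_plCompact (by linarith) hw hg)
    (plSupported_le_plCompact hw' (by linarith) hg'), fun x hx => ?_⟩
  change g (g' x) ∈ _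
  rcases le_or_gt x a with hxa | hxa
  · obtain ⟨h3, h4⟩ := hgx' x ((min_le_left _ _).trans hx.1) hxa
    rcases h4.eq_or_lt with h5 | h5
    · obtain ⟨h6, h7⟩ := hgx a le_rfl (le_max_right _ _)
      rw [h5]
      exact ⟨by linarith, by linarith⟩
    · rw [hg.2 _ fun h6 => absurd h6.1 (not_le.2 h5)]
      exact ⟨by linarith, by linarith⟩
  · rw [hg'.2 x fun h6 => absurd h6.2 (not_le.2 hxa)]
    obtain ⟨h6, h7⟩ := hgx x hxa.le (hx.2.trans (le_max_left _ _))
    exact ⟨by linarith, by linarith⟩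

end Compress

section PlCompact

/-- A compactly supported map is a product of commutators of compactly supported maps. -/
theorem exists_mem_commutator_plSupported {f : ℝ ≃ₜ ℝ} {u v : ℝ} (hf : f ∈ plSupported u v) :
    ∃ M, f ∈ ⁅plSupported (-M) M, plSupported (-M) M⁆ := by
  have hmono : ∀ {M N : ℝ}, M ≤ N →
      ⁅plSupported (-M) M, plSupported (-M) M⁆ ≤ ⁅plSupported (-N) N, plSupported (-N) N⁆ :=
    fun h => Subgroup.commutator_mono (plSupported_mono (neg_le_neg h) h)
      (plSupported_mono (neg_le_neg h) h)
  have hlt : ∀ c ∈ leftTrivialCompact, ∃ M, (c : ℝ ≃ₜ ℝ) ∈ plSupported (-M) M := by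
    intro c hc
    obtain ⟨a, ha⟩ := c.2.2
    obtain ⟨b, hb⟩ := eventually_atTop.1 (mem_leftTrivialCompact.1 hc)
    refine ⟨max (-a) b, c.2.1, fun x hx => ?_⟩
    rw [Set.mem_Icc, not_and_or, not_le, not_le] at hx
    rcases hx with h | h
    · exact ha x (by linarith [le_max_left (-a) b])
    · have := hb x (by linarith [le_max_right (-a) b])
      rwa [zpow_zero, one_mul, add_zero] at this
  let f' : leftTrivial := ⟨f, hf.1, u - 1, fun x hx => hf.2 x fun h => by linarith [h.1]⟩
  have hf' : f' ∈ leftTrivialCompact := by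
    rw [mem_leftTrivialCompact]
    filter_upwards [eventually_gt_atTop v] with x hx
    simpa using hf.2 x fun h => absurd h.2 (not_le.2 hx)
  have hmem := leftTrivialCompact_le_commutator hf'
  rw [Subgroup.commutator_def] at hmem
  suffices h : ∀ c ∈ Subgroup.closure {g | ∃ a ∈ leftTrivialCompact, ∃ b ∈ leftTrivialCompact,
      ⁅a, b⁆ = g}, ∃ M, (c : ℝ ≃ₜ ℝ) ∈ ⁅plSupported (-M) M, plSupported (-M) M⁆ from h f' hmem
  intro c hc
  induction hc using Subgroup.closure_induction with
  | mem c hc =>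
    obtain ⟨a, ha, b, hb, rfl⟩ := hc
    obtain ⟨M, hM⟩ := hlt a ha
    obtain ⟨N, hN⟩ := hlt b hb
    exact ⟨max M N, Subgroup.commutator_mem_commutator
      (plSupported_mono (neg_le_neg (le_max_left _ _)) (le_max_left _ _) hM)
      (plSupported_mono (neg_le_neg (le_max_right _ _)) (le_max_right _ _) hN)⟩
  | one => exact ⟨0, one_mem _⟩
  | mul c d _ _ hc hd =>
    obtain ⟨M, hM⟩ := hc
    obtain ⟨N, hN⟩ := hd
    exact ⟨max M N, mul_mem (hmono (le_max_left _ _) hM) (hmono (le_max_right _ _) hN)⟩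
  | inv c _ hc =>
    obtain ⟨M, hM⟩ := hc
    exact ⟨M, inv_mem hM⟩

/-- Conjugation by a map that is trivial on the support of `f` and compresses the line into
`(p, q)` moves the commutators into `plCompact p q`. -/
theorem plCompact_le_commutator (p q : ℝ) : plCompact p q ≤ ⁅plCompact p q, plCompact p q⁆ := by
  rcases le_or_gt q p with hqp | hpq
  · rintro f ⟨hf, u, v, hu, hv, h⟩
    have : f = 1 := by
      ext x
      exact h x fun hx => by linarith [hx.1, hx.2]
    rw [this]
    exact one_mem _
  rintro f ⟨hf, u, v, hu, hv, h⟩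
  obtain ⟨M, hM⟩ := exists_mem_commutator_plSupported (u := u) (v := v) ⟨hf, h⟩
  obtain ⟨d₁, hd₁, hd₁p, hd₁u⟩ := exists_dyadic_between (lt_min hu hpq)
  obtain ⟨d₂, hd₂, hd₂v, hd₂q⟩ := exists_dyadic_between
    (max_lt hv (hd₁u.trans_le (min_le_right _ _)))
  have hd₁q := hd₁u.trans_le (min_le_right _ _)
  replace hd₁u := hd₁u.trans_le (min_le_left _ _)
  have hd₁d₂ := (le_max_right v d₁).trans_lt hd₂v
  replace hd₂v := (le_max_left v d₁).trans_lt hd₂v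
  obtain ⟨w, -, g, hg, hgx⟩ := exists_push_left (v := max M d₂) (q := max M d₂ + 1)
    (δ := (q - d₂) / 2) hd₂ (le_max_right _ _) (by linarith) (by linarith)
  obtain ⟨w', -, g', hg', hgx'⟩ := exists_push_right (u := min (-M) d₁) (p := min (-M) d₁ - 1)
    (δ := (d₁ - p) / 2) hd₁ (min_le_right _ _) (by linarith) (by linarith)
  have hκ : ∀ x ∈ Set.Icc (-M) M,
      (g * g') x ∈ Set.Icc (d₁ - (d₁ - p) / 2) (d₂ + (q - d₂) / 2) := by
    intro x hx
    change g (g' x) ∈ _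
    rcases le_or_gt x d₁ with hx1 | hx1
    · obtain ⟨h3, h4⟩ := hgx' x ((min_le_left _ _).trans hx.1) hx1
      rw [hg.2 _ fun h6 => by linarith [h6.1]]
      exact ⟨h3.le, by linarith⟩
    · rw [hg'.2 x fun h6 => absurd h6.2 (not_le.2 hx1)]
      rcases le_or_gt d₂ x with hx2 | hx2
      · obtain ⟨h6, h7⟩ := hgx x hx2 (hx.2.trans (le_max_left _ _))
        exact ⟨by linarith, h7.le⟩
      · rw [hg.2 x fun h6 => absurd h6.1 (not_le.2 hx2)]
        exact ⟨by linarith, by linarith⟩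
  have hcomm : Commute (g * g') f := commute_of_disjoint_support (X := ℝ) fun x => by
    by_cases hx : x ∈ Set.Icc u v
    · left
      change g (g' x) = x
      rw [hg'.2 x fun h6 => by linarith [h6.2, hx.1], hg.2 x fun h6 => by linarith [h6.1, hx.2]]
    · exact Or.inr (h x hx)
  have hPL : g * g' ∈ PLDyadic := mul_mem hg.1 hg'.1
  have hmap : (plSupported (-M) M).map (MulAut.conj (g * g')).toMonoidHom ≤ plCompact p q := by
    rintro _ ⟨k, hk, rfl⟩
    refine ⟨mul_mem (mul_mem hPL hk.1) (inv_mem hPL), d₁ - (d₁ - p) / 2, d₂ + (q - d₂) / 2,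
      by linarith, by linarith, fun x hx => ?_⟩
    change (g * g') (k ((g * g').symm x)) = x
    rw [hk.2 _ fun h6 => hx ?_, Homeomorph.apply_symm_apply]
    have := hκ _ h6
    rwa [Homeomorph.apply_symm_apply] at this
  have h1 := Subgroup.mem_map_of_mem (MulAut.conj (g * g')).toMonoidHom hM
  rw [Subgroup.map_commutator] at h1
  have h2 := Subgroup.commutator_mono hmap hmap h1
  have h3 : (MulAut.conj (g * g')).toMonoidHom f = f := by
    change (g * g') * f * (g * g')⁻¹ = f
    rw [hcomm.eq, mul_inv_cancel_right]
  rwa [h3] at h2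

theorem commutator_plCompact (p q : ℝ) : commutator (plCompact p q) = ⊤ := by
  rw [eq_top_iff]
  intro f _
  have h := plCompact_le_commutator p q f.2
  rw [← Subgroup.map_subtype_commutator] at h
  obtain ⟨g, hg, hgf⟩ := h
  rwa [Subtype.ext hgf] at hg

theorem infinite_plCompact {p q : ℝ} (h : p < q) : Infinite (plCompact p q) := by
  obtain ⟨a, ha, ha1, ha2⟩ := exists_dyadic_between h
  obtain ⟨L, hL, hL1, hL2⟩ := exists_dyadic_between (show 0 < (q - a) / 3 by linarith)
  have hb : bump a L ∈ plCompact p q :=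
    plSupported_le_plCompact ha1 (by linarith) (bump_mem_plSupported ha hL hL1.le)
  refine Infinite.of_injective (fun n : ℕ => (⟨bump a L, hb⟩ : plCompact p q) ^ n) fun m n hmn => ?_
  have h1 : (bump a L ^ m) (a + L) = (bump a L ^ n) (a + L) := by
    have := congrArg (fun g : plCompact p q => (g : ℝ ≃ₜ ℝ) (a + L)) hmn
    simpa using this
  rw [homeomorph_pow_apply, homeomorph_pow_apply] at h1
  exact ((strictMono_bump hL1.le).strictMono_iterate_of_lt_map
    (lt_bump (show a < a + L by linarith) (by linarith))).injective h1

theorem isSimpleGroup_plCompact {p q : ℝ} (h : p < q) : IsSimpleGroup (plCompact p q) := by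
  have := infinite_plCompact h
  refine isSimpleGroup_of_compressible (Y := ℝ) (commutator_plCompact p q) ?_
  rintro ⟨a, ha, u, v, hu, hv, hauv⟩ ⟨b, hb, u', v', hu', hv', hbuv⟩
    ⟨δ, hδ, u₀, v₀, hu₀, hv₀, hδuv⟩ x hx O hO
  have hxI : x ∈ Set.Ioo p q := by
    by_contra hx'
    exact hx (hδuv x fun h6 => hx' ⟨hu₀.trans_le h6.1, h6.2.trans_lt hv₀⟩)
  obtain ⟨o₁, o₂, hxo, hoO⟩ := mem_nhds_iff_exists_Ioo_subset.1
    (Filter.inter_mem hO (isOpen_Ioo.mem_nhds hxI))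
  have ho := Set.Ioo_subset_Ioo_iff (hxo.1.trans hxo.2) |>.1 (hoO.trans Set.inter_subset_right)
  obtain ⟨g, hg, hgx⟩ := exists_compress (lt_min hu hu') (max_lt hv hv') ho.1
    (hxo.1.trans hxo.2) ho.2
  refine ⟨⟨g, hg⟩, fun y hy => (hoO (hgx y ?_)).1⟩
  by_contra hy'
  rcases hy with hy | hy
  · exact hy (hauv y fun h6 => hy' ⟨(min_le_left _ _).trans h6.1, h6.2.trans (le_max_left _ _)⟩)
  · exact hy (hbuv y fun h6 => hy' ⟨(min_le_right _ _).trans h6.1, h6.2.trans (le_max_right _ _)⟩)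

end PlCompact

/-! ### From the line to the circle -/

section CircleCoe

theorem coe_eq_coe_iff_circle {x y : ℝ} :
    (x : UnitAddCircle) = y ↔ ∃ n : ℤ, x - y = n := by
  rw [← sub_eq_zero, ← AddCircle.coe_sub, AddCircle.coe_eq_zero_iff]
  simp [eq_comm]

theorem coe_mem_dyadicPoints_iff {x : ℝ} :
    (x : UnitAddCircle) ∈ dyadicPoints ↔ x ∈ dyadicReals := by
  constructor
  · rintro ⟨m, n, h⟩
    obtain ⟨j, hj⟩ := coe_eq_coe_iff_circle.1 h
    rw [sub_eq_iff_eq_add] at hj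
    rw [hj]
    exact add_mem (intCast_mem_dyadicReals j) ⟨m, n, rfl⟩
  · rintro ⟨m, n, rfl⟩
    exact ⟨m, n, rfl⟩

theorem eventually_nhds_coe_iff {x : ℝ} {p : UnitAddCircle → Prop} :
    (∀ᶠ y in 𝓝 (x : UnitAddCircle), p y) ↔ ∀ᶠ t : ℝ in 𝓝 x, p t := by
  have h : 𝓝 (x : UnitAddCircle) = map ((↑) : ℝ → UnitAddCircle) (𝓝 x) :=
    QuotientAddGroup.nhds_eq _ x
  rw [h, eventually_map]

theorem eventually_nhds_zero_circle_iff {p : UnitAddCircle → Prop} :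
    (∀ᶠ y in 𝓝 (0 : UnitAddCircle), p y) ↔ ∀ᶠ t : ℝ in 𝓝 0, p t :=
  eventually_nhds_coe_iff (x := 0)

theorem coe_sub_one_circle (t : ℝ) : ((t - 1 : ℝ) : UnitAddCircle) = t := by
  rw [AddCircle.coe_sub, AddCircle.coe_period, sub_zero]

theorem continuous_coe_circle : Continuous ((↑) : ℝ → UnitAddCircle) :=
  AddCircle.continuous_mk' 1

/-- A continuous local lift of a circle map has the slopes of that map. -/
theorem HasDyadicSlopeAt.hasSlopeAt {g : UnitAddCircle → UnitAddCircle} {φ : ℝ → ℝ} {x : ℝ} {k : ℤ}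
    (hφ : ∀ᶠ y in 𝓝 x, (φ y : UnitAddCircle) = g y) (hc : ContinuousAt φ x)
    (h : HasDyadicSlopeAt g x k) : HasSlopeAt φ x k := by
  have ht : Tendsto (fun t : ℝ => x + t) (𝓝 0) (𝓝 x) := by
    have : Continuous (fun t : ℝ => x + t) := by fun_prop
    simpa using this.tendsto 0
  have h1 : Tendsto (fun t => φ (x + t) - φ x - 2 ^ k * t) (𝓝 0) (𝓝 0) := by
    simpa using ((hc.tendsto.comp ht).sub_const (φ x)).sub (tendsto_two_zpow_mul k)
  filter_upwards [h, ht.eventually hφ, h1.eventually (Metric.ball_mem_nhds 0 one_pos)]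
    with t h2 h3 h4
  have h5 : ((φ (x + t) : ℝ) : UnitAddCircle) = ((φ x + 2 ^ k * t : ℝ) : UnitAddCircle) := by
    rw [h3, AddCircle.coe_add, h2, AddCircle.coe_add, hφ.self_of_nhds]
  obtain ⟨n, hn⟩ := coe_eq_coe_iff_circle.1 h5
  have h6 : |(n : ℝ)| < 1 := by
    rw [← hn]
    rw [sub_add_eq_sub_sub]
    simpa [Real.dist_eq] using h4
  have h7 : n = 0 := by
    rw [← Int.abs_lt_one_iff]
    exact_mod_cast h6
  rw [h7, Int.cast_zero, sub_eq_zero] at hn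
  exact hn

/-- Conversely a circle map has the slopes of its local lifts. -/
theorem HasSlopeAt.hasDyadicSlopeAt {g : UnitAddCircle → UnitAddCircle} {φ : ℝ → ℝ} {x : ℝ} {k : ℤ}
    (hφ : ∀ᶠ y in 𝓝 x, (φ y : UnitAddCircle) = g y) (h : HasSlopeAt φ x k) :
    HasDyadicSlopeAt g x k := by
  have ht : Tendsto (fun t : ℝ => x + t) (𝓝 0) (𝓝 x) := by
    have : Continuous (fun t : ℝ => x + t) := by fun_prop
    simpa using this.tendsto 0
  filter_upwards [h, ht.eventually hφ] with t h1 h2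
  rw [← AddCircle.coe_add, ← h2, h1, AddCircle.coe_add, hφ.self_of_nhds]

end CircleCoe

section CircleHom

theorem plCompact_mem_Ico (f : plCompact 0 1) {x : ℝ} (hx : x ∈ Set.Ico (0 : ℝ) 1) :
    (f : ℝ ≃ₜ ℝ) x ∈ Set.Ico (0 : ℝ) 1 := by
  obtain ⟨-, u, v, hu, hv, h⟩ := f.2
  by_contra hcon
  have h1 := h ((f : ℝ ≃ₜ ℝ) x) fun h6 => hcon ⟨hu.le.trans h6.1, h6.2.trans_lt hv⟩
  rw [(f : ℝ ≃ₜ ℝ).injective h1] at hcon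
  exact hcon hx

theorem plCompact_zero_one (f : plCompact 0 1) : (f : ℝ ≃ₜ ℝ) 0 = 0 ∧ (f : ℝ ≃ₜ ℝ) 1 = 1 := by
  obtain ⟨-, u, v, hu, hv, h⟩ := f.2
  exact ⟨h 0 fun h6 => by linarith [h6.1], h 1 fun h6 => by linarith [h6.2]⟩

/-- The map of the circle induced by a homeomorphism of the line with support in `(0, 1)`. -/
noncomputable def inducedCircleMap (f : plCompact 0 1) : UnitAddCircle → UnitAddCircle :=
  AddCircle.liftIco 1 0 fun t => (((f : ℝ ≃ₜ ℝ) t : ℝ) : UnitAddCircle)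

theorem inducedCircleMap_coe (f : plCompact 0 1) {t : ℝ} (ht : t ∈ Set.Ico (0 : ℝ) 1) :
    inducedCircleMap f t = (((f : ℝ ≃ₜ ℝ) t : ℝ) : UnitAddCircle) :=
  AddCircle.liftIco_zero_coe_apply ht

theorem continuous_inducedCircleMap (f : plCompact 0 1) : Continuous (inducedCircleMap f) := by
  refine AddCircle.liftIco_zero_continuous ?_
    (continuous_coe_circle.comp (f : ℝ ≃ₜ ℝ).continuous).continuousOn
  rw [(plCompact_zero_one f).1, (plCompact_zero_one f).2, AddCircle.coe_period, AddCircle.coe_zero]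

theorem inducedCircleMap_mul (f g : plCompact 0 1) (x : UnitAddCircle) :
    inducedCircleMap (f * g) x = inducedCircleMap f (inducedCircleMap g x) := by
  obtain ⟨t, ht, rfl⟩ := AddCircle.eq_coe_Ico x
  rw [inducedCircleMap_coe _ ht, inducedCircleMap_coe _ ht,
    inducedCircleMap_coe _ (plCompact_mem_Ico g ht)]
  rfl

theorem inducedCircleMap_one (x : UnitAddCircle) : inducedCircleMap 1 x = x := by
  obtain ⟨t, ht, rfl⟩ := AddCircle.eq_coe_Ico x
  rw [inducedCircleMap_coe _ ht]
  rfl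

/-- The action on the circle of the homeomorphisms of the line with support in `(0, 1)`. -/
noncomputable def circleHom : plCompact 0 1 →* (UnitAddCircle ≃ₜ UnitAddCircle) where
  toFun f :=
    { toFun := inducedCircleMap f
      invFun := inducedCircleMap f⁻¹
      left_inv := fun x => by rw [← inducedCircleMap_mul, inv_mul_cancel, inducedCircleMap_one]
      right_inv := fun x => by rw [← inducedCircleMap_mul, mul_inv_cancel, inducedCircleMap_one]
      continuous_toFun := continuous_inducedCircleMap f
      continuous_invFun := continuous_inducedCircleMap f⁻¹ }
  map_one' := Homeomorph.ext inducedCircleMap_one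
  map_mul' f g := Homeomorph.ext (inducedCircleMap_mul f g)

theorem circleHom_coe (f : plCompact 0 1) {t : ℝ} (ht : t ∈ Set.Ico (0 : ℝ) 1) :
    circleHom f t = (((f : ℝ ≃ₜ ℝ) t : ℝ) : UnitAddCircle) := inducedCircleMap_coe f ht

theorem circleHom_eventually_eq (f : plCompact 0 1) :
    ∀ᶠ y in 𝓝 (0 : UnitAddCircle), circleHom f y = y := by
  obtain ⟨hf, u, v, hu, hv, h⟩ := f.2
  rw [eventually_nhds_zero_circle_iff]
  filter_upwards [Ioo_mem_nhds (neg_lt_zero.2 one_pos) (one_pos : (0 : ℝ) < 1), gt_mem_nhds hu,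
    lt_mem_nhds (show v - 1 < 0 by linarith)] with t h1 h2 h3
  rcases le_or_gt 0 t with h0 | h0
  · rw [circleHom_coe f ⟨h0, h1.2⟩, h t fun h6 => absurd h6.1 (not_le.2 h2)]
  · have h4 : (t : UnitAddCircle) = ((t + 1 : ℝ) : UnitAddCircle) := by simp
    rw [h4, circleHom_coe f ⟨by linarith [h1.1], by linarith⟩,
      h (t + 1) fun h6 => by linarith [h6.2]]

theorem circleHom_mem_ThompsonT (f : plCompact 0 1) : circleHom f ∈ ThompsonT := by
  have hbrk : breakpoints (circleHom f) ⊆ (↑) '' realBreakpoints (f : ℝ ≃ₜ ℝ) := by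
    intro x hx
    obtain ⟨t, ht, rfl⟩ := AddCircle.eq_coe_Ico x
    refine ⟨t, fun ⟨k, hk⟩ => hx ?_, rfl⟩
    rcases ht.1.eq_or_lt with rfl | h0
    · refine ⟨0, HasSlopeAt.hasDyadicSlopeAt (φ := id) ?_ ?_⟩
      · have := circleHom_eventually_eq f
        rw [eventually_nhds_zero_circle_iff] at this
        exact this.mono fun y hy => hy.symm
      · exact Eventually.of_forall fun t => by simp
    · refine ⟨k, hk.hasDyadicSlopeAt ?_⟩
      filter_upwards [Ioo_mem_nhds h0 ht.2] with y hy
      rw [circleHom_coe f ⟨hy.1.le, hy.2⟩]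
  refine ⟨(f.2.1.1.image _).subset hbrk, fun x hx => ?_, fun x => ?_⟩
  · obtain ⟨t, ht, rfl⟩ := hbrk hx
    exact coe_mem_dyadicPoints_iff.2 (f.2.1.2.1 ht)
  · obtain ⟨t, ht, rfl⟩ := AddCircle.eq_coe_Ico x
    rw [circleHom_coe f ht, coe_mem_dyadicPoints_iff, coe_mem_dyadicPoints_iff]
    exact f.2.1.2.2 t

/-- The embedding in `T` of the group of homeomorphisms of the line with support in `(0, 1)`. -/
noncomputable def thompsonHom : plCompact 0 1 →* ThompsonT :=
  circleHom.codRestrict ThompsonT circleHom_mem_ThompsonT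

theorem thompsonHom_smul_coe (f : plCompact 0 1) {t : ℝ} (ht : t ∈ Set.Ico (0 : ℝ) 1) :
    thompsonHom f • (t : UnitAddCircle) = (((f : ℝ ≃ₜ ℝ) t : ℝ) : UnitAddCircle) :=
  circleHom_coe f ht

theorem thompsonHom_mem_germStabilizer (f : plCompact 0 1) :
    thompsonHom f ∈ germStabilizer ThompsonT (0 : UnitAddCircle) := circleHom_eventually_eq f

/-- The lift to `[0, 1)` of a circle map fixing `0`, extended by the identity. -/
noncomputable def intervalLift (g : UnitAddCircle → UnitAddCircle) (t : ℝ) : ℝ :=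
  open Classical in
  if t ∈ Set.Ico (0 : ℝ) 1 then (AddCircle.equivIco 1 0 (g t) : ℝ) else t

theorem coe_equivIco_circle (a : ℝ) (y : UnitAddCircle) :
    ((AddCircle.equivIco 1 a y : ℝ) : UnitAddCircle) = y := AddCircle.coe_equivIco

theorem intervalLift_mem {g : UnitAddCircle → UnitAddCircle} {t : ℝ} (ht : t ∈ Set.Ico (0 : ℝ) 1) :
    intervalLift g t ∈ Set.Ico (0 : ℝ) 1 := by
  have := (AddCircle.equivIco 1 0 (g t)).2
  rw [intervalLift, if_pos ht]
  exact ⟨this.1, this.2.trans_eq (zero_add 1)⟩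

theorem coe_intervalLift {g : UnitAddCircle → UnitAddCircle} {t : ℝ} (ht : t ∈ Set.Ico (0 : ℝ) 1) :
    (intervalLift g t : UnitAddCircle) = g t := by
  rw [intervalLift, if_pos ht, coe_equivIco_circle]

theorem eq_of_coe_eq_of_mem_Ico {x y : ℝ} (hx : x ∈ Set.Ico (0 : ℝ) 1)
    (hy : y ∈ Set.Ico (0 : ℝ) 1) (h : (x : UnitAddCircle) = y) : x = y :=
  (AddCircle.coe_eq_coe_iff_of_mem_Ico (p := (1 : ℝ)) (a := 0) (by rwa [zero_add])
    (by rwa [zero_add])).1 h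

theorem intervalLift_comp {g h : UnitAddCircle → UnitAddCircle} (hgh : ∀ x, g (h x) = x) (t : ℝ) :
    intervalLift g (intervalLift h t) = t := by
  by_cases ht : t ∈ Set.Ico (0 : ℝ) 1
  · refine eq_of_coe_eq_of_mem_Ico (intervalLift_mem (intervalLift_mem ht)) ht ?_
    rw [coe_intervalLift (intervalLift_mem ht), coe_intervalLift ht, hgh]
  · have h1 : intervalLift h t = t := if_neg ht
    rw [h1]
    exact if_neg ht

theorem intervalLift_eq_self {g : UnitAddCircle → UnitAddCircle} {ε : ℝ}
    (hg : ∀ t : ℝ, |t| < ε → g t = t) {t : ℝ} (ht : t ∉ Set.Icc ε (1 - ε)) :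
    intervalLift g t = t := by
  by_cases hI : t ∈ Set.Ico (0 : ℝ) 1
  · refine eq_of_coe_eq_of_mem_Ico (intervalLift_mem hI) hI ?_
    rw [coe_intervalLift hI]
    rw [Set.mem_Icc, not_and_or, not_le, not_le] at ht
    rcases ht with h | h
    · exact hg t (by rw [abs_of_nonneg hI.1]; exact h)
    · rw [← coe_sub_one_circle t]
      refine hg _ ?_
      rw [abs_of_neg (by linarith [hI.2])]
      linarith
  · exact if_neg hI

theorem continuous_intervalLift {g : UnitAddCircle ≃ₜ UnitAddCircle} {ε : ℝ} (hε : 0 < ε)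
    (hg : ∀ t : ℝ, |t| < ε → g t = t) : Continuous (intervalLift g) := by
  rw [continuous_iff_continuousAt]
  intro t
  by_cases ht : t ∈ Set.Icc ε (1 - ε)
  · have h0 : 0 < t := hε.trans_le ht.1
    have h1 : t < 1 := by linarith [ht.2]
    have hg0 : g 0 = 0 := by simpa using hg 0 (by simpa using hε)
    have hne : g t ≠ ((0 : ℝ) : UnitAddCircle) := by
      intro h
      rw [AddCircle.coe_zero, ← hg0, g.injective.eq_iff] at h
      have := eq_of_coe_eq_of_mem_Ico (x := t) (y := 0) ⟨h0.le, h1⟩ (by simp) (by simpa using h)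
      exact h0.ne' this
    have hc : ContinuousAt (fun s : ℝ => (AddCircle.equivIco 1 0 (g s) : ℝ)) t :=
      continuous_subtype_val.continuousAt.comp
        ((AddCircle.continuousAt_equivIco 1 0 hne).comp (f := fun s : ℝ => g s)
          (g.continuous.comp continuous_coe_circle).continuousAt)
    refine hc.congr ?_
    filter_upwards [Ioo_mem_nhds h0 h1] with s hs
    exact (if_pos ⟨hs.1.le, hs.2⟩).symm
  · refine continuousAt_id.congr ?_
    filter_upwards [isClosed_Icc.isOpen_compl.mem_nhds ht] with s hs
    exact (intervalLift_eq_self hg hs).symm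

/-- The elements of `T` that are trivial near `0` come from the line. -/
theorem exists_thompsonHom_eq {g : ThompsonT}
    (hg : g ∈ germStabilizer ThompsonT (0 : UnitAddCircle)) : ∃ f, thompsonHom f = g := by
  obtain ⟨ε, hε, hgε⟩ : ∃ ε > 0, ∀ t : ℝ, |t| < ε → (g : UnitAddCircle ≃ₜ UnitAddCircle) t = t := by
    rw [mem_germStabilizer, eventually_nhds_zero_circle_iff, Metric.eventually_nhds_iff] at hg
    obtain ⟨ε, hε, h⟩ := hg
    exact ⟨ε, hε, fun t ht => h (by simpa using ht)⟩
  have hgε' : ∀ t : ℝ, |t| < ε → (g : UnitAddCircle ≃ₜ UnitAddCircle).symm t = t := fun t ht => by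
    rw [Homeomorph.symm_apply_eq, hgε t ht]
  let f : ℝ ≃ₜ ℝ :=
    { toFun := intervalLift (g : UnitAddCircle ≃ₜ UnitAddCircle)
      invFun := intervalLift (g : UnitAddCircle ≃ₜ UnitAddCircle).symm
      left_inv := intervalLift_comp (g : UnitAddCircle ≃ₜ UnitAddCircle).symm_apply_apply
      right_inv := intervalLift_comp (g : UnitAddCircle ≃ₜ UnitAddCircle).apply_symm_apply
      continuous_toFun := continuous_intervalLift hε hgε
      continuous_invFun := continuous_intervalLift hε hgε' }
  have hf : ∀ t, f t = intervalLift (g : UnitAddCircle ≃ₜ UnitAddCircle) t := fun _ => rfl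
  have hfid : ∀ t ∉ Set.Icc ε (1 - ε), f t = t := fun t ht => intervalLift_eq_self hgε ht
  have hbrk : ∀ x ∈ realBreakpoints f, x ∈ Set.Icc ε (1 - ε) ∧
      (x : UnitAddCircle) ∈ breakpoints (g : UnitAddCircle ≃ₜ UnitAddCircle) := by
    intro x hx
    have hxI : x ∈ Set.Icc ε (1 - ε) := by
      by_contra hxI
      refine hx ⟨0, ?_⟩
      have ht : Tendsto (fun t : ℝ => x + t) (𝓝 0) (𝓝 x) := by
        have : Continuous (fun t : ℝ => x + t) := by fun_prop
        simpa using this.tendsto 0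
      filter_upwards [ht.eventually (isClosed_Icc.isOpen_compl.mem_nhds hxI)] with t h
      rw [hfid _ h, hfid _ hxI]
      simp
    refine ⟨hxI, fun ⟨k, hk⟩ => hx ⟨k, hk.hasSlopeAt ?_ f.continuous.continuousAt⟩⟩
    filter_upwards [Ioo_mem_nhds (hε.trans_le hxI.1) (show x < 1 by linarith [hxI.2])] with s hs
    rw [hf, coe_intervalLift ⟨hs.1.le, hs.2⟩]
  have hfPL : f ∈ PLDyadic := by
    refine ⟨?_, fun x hx => ?_, fun x => ?_⟩
    · refine Set.Finite.of_finite_image (f := ((↑) : ℝ → UnitAddCircle))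
        (g.2.1.subset ?_) fun x hx y hy hxy => ?_
      · rintro _ ⟨x, hx, rfl⟩
        exact (hbrk x hx).2
      · have h1 := (hbrk x hx).1
        have h2 := (hbrk y hy).1
        exact eq_of_coe_eq_of_mem_Ico ⟨hε.le.trans h1.1, by linarith [h1.2]⟩
          ⟨hε.le.trans h2.1, by linarith [h2.2]⟩ hxy
    · exact coe_mem_dyadicPoints_iff.1 (g.2.2.1 (hbrk x hx).2)
    · by_cases hx : x ∈ Set.Ico (0 : ℝ) 1
      · rw [← coe_mem_dyadicPoints_iff, ← coe_mem_dyadicPoints_iff, hf, coe_intervalLift hx]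
        exact g.2.2.2 x
      · rw [hf, intervalLift, if_neg hx]
  refine ⟨⟨f, hfPL, ε, 1 - ε, hε, by linarith, hfid⟩, ?_⟩
  refine FaithfulSMul.eq_of_smul_eq_smul (α := UnitAddCircle) fun x => ?_
  obtain ⟨t, ht, rfl⟩ := AddCircle.eq_coe_Ico x
  rw [thompsonHom_smul_coe _ ht]
  exact coe_intervalLift ht

end CircleHom

/-! ### Germs at a fixed point -/

section Germs

/-- The map with slope `2^k` on the right of `0` and `2^l` on the left of `0`. -/
noncomputable def twoSlopes (k l : ℤ) (t : ℝ) : ℝ := if 0 ≤ t then 2 ^ k * t else 2 ^ l * t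

theorem twoSlopes_comp (k l k' l' : ℤ) (t : ℝ) :
    twoSlopes k l (twoSlopes k' l' t) = twoSlopes (k + k') (l + l') t := by
  unfold twoSlopes
  rcases le_or_gt 0 t with h | h
  · have : (0 : ℝ) ≤ 2 ^ k' * t := by positivity
    rw [if_pos h, if_pos h, if_pos this, zpow_add₀ two_ne_zero, mul_assoc]
  · have : ¬ (0 : ℝ) ≤ 2 ^ l' * t := not_le.2 (mul_neg_of_pos_of_neg (by positivity) h)
    rw [if_neg h.not_ge, if_neg h.not_ge, if_neg this, zpow_add₀ two_ne_zero, mul_assoc]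

theorem twoSlopes_zero_zero (t : ℝ) : twoSlopes 0 0 t = t := by simp [twoSlopes]

theorem tendsto_twoSlopes (k l : ℤ) : Tendsto (twoSlopes k l) (𝓝 0) (𝓝 0) := by
  have hc : Continuous (twoSlopes k l) :=
    Continuous.if_le (by fun_prop) (by fun_prop) continuous_const continuous_id
      fun t ht => by simp [← ht]
  simpa [twoSlopes] using hc.tendsto 0

/-- The homeomorphism `f` of the line fixes `x` and has slopes `2^k` on the right and `2^l` on the
left of it. -/
def HasGermAt (f : ℝ ≃ₜ ℝ) (x : ℝ) (k l : ℤ) : Prop :=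
  ∀ᶠ t : ℝ in 𝓝 0, f (x + t) = x + twoSlopes k l t

theorem HasGermAt.mul {f g : ℝ ≃ₜ ℝ} {x : ℝ} {k l k' l' : ℤ} (hf : HasGermAt f x k l)
    (hg : HasGermAt g x k' l') : HasGermAt (f * g) x (k + k') (l + l') := by
  filter_upwards [hg, (tendsto_twoSlopes k' l').eventually hf] with t h1 h2
  change f (g (x + t)) = _
  rw [h1, h2, twoSlopes_comp]

theorem hasGermAt_one (x : ℝ) : HasGermAt 1 x 0 0 :=
  Eventually.of_forall fun t => by rw [twoSlopes_zero_zero]; rfl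

theorem HasGermAt.inv {f : ℝ ≃ₜ ℝ} {x : ℝ} {k l : ℤ} (hf : HasGermAt f x k l) :
    HasGermAt f⁻¹ x (-k) (-l) := by
  filter_upwards [(tendsto_twoSlopes (-k) (-l)).eventually hf] with t h
  change f.symm (x + t) = _
  rw [Homeomorph.symm_apply_eq, h, twoSlopes_comp, add_neg_cancel, add_neg_cancel,
    twoSlopes_zero_zero]

theorem HasGermAt.zpow {f : ℝ ≃ₜ ℝ} {x : ℝ} {k l : ℤ} (hf : HasGermAt f x k l) (n : ℤ) :
    HasGermAt (f ^ n) x (n * k) (n * l) := by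
  induction n with
  | zero => simpa using hasGermAt_one x
  | succ n ih =>
    rw [zpow_add_one, add_mul, add_mul, one_mul, one_mul]
    exact ih.mul hf
  | pred n ih =>
    rw [zpow_sub_one, sub_mul, sub_mul, one_mul, one_mul]
    exact ih.mul hf.inv

theorem hasGermAt_bump_start {a L : ℝ} (hL : 0 < L) : HasGermAt (bump a L) a 1 0 := by
  filter_upwards [gt_mem_nhds hL] with t ht
  unfold twoSlopes
  split_ifs with h
  · rw [bump_of_mem_left hL.le (by linarith) (by linarith)]
    ring
  · rw [bump_of_le_start hL.le (by linarith)]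
    simp

theorem hasGermAt_bump_end {a L : ℝ} (hL : 0 < L) : HasGermAt (bump a L) (a + 3 * L) 0 (-1) := by
  filter_upwards [lt_mem_nhds (neg_lt_zero.2 hL)] with t ht
  unfold twoSlopes
  split_ifs with h
  · rw [bump_of_ge_end hL.le (by linarith)]
    simp
  · rw [bump_of_mem_right hL.le (by linarith) (by linarith), zpow_neg_one]
    ring

theorem exists_plCompact_hasGermAt (k l : ℤ) :
    ∃ f : plCompact 0 1, HasGermAt f (1 / 2) k l := by
  have h8 : (1 / 8 : ℝ) ∈ dyadicReals := ⟨1, 3, by norm_num⟩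
  have h2 : (1 / 2 : ℝ) ∈ dyadicReals := ⟨1, 1, by norm_num⟩
  have hR : bump (1 / 2) (1 / 8) ∈ plCompact 0 1 :=
    plSupported_le_plCompact (by norm_num) (by norm_num) (bump_mem_plSupported h2 h8 (by norm_num))
  have hL : bump (1 / 8) (1 / 8) ∈ plCompact 0 1 :=
    plSupported_le_plCompact (by norm_num) (by norm_num) (bump_mem_plSupported h8 h8 (by norm_num))
  refine ⟨⟨bump (1 / 2) (1 / 8) ^ k * bump (1 / 8) (1 / 8) ^ (-l),
    mul_mem (zpow_mem hR k) (zpow_mem hL (-l))⟩, ?_⟩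
  have h3 : HasGermAt (bump (1 / 8) (1 / 8)) (1 / 2) 0 (-1) := by
    have := hasGermAt_bump_end (a := 1 / 8) (L := 1 / 8) (by norm_num)
    rwa [show (1 / 8 + 3 * (1 / 8) : ℝ) = 1 / 2 by norm_num] at this
  have := ((hasGermAt_bump_start (a := 1 / 2) (L := 1 / 8) (by norm_num)).zpow k).mul
    (h3.zpow (-l))
  simpa using this

/-- The map `g` of the circle fixes `0` and has slopes `2^k` on the right and `2^l` on the left of
it. -/
def HasCircleGerm (g : UnitAddCircle → UnitAddCircle) (k l : ℤ) : Prop :=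
  ∀ᶠ t : ℝ in 𝓝 0, g t = (twoSlopes k l t : ℝ)

theorem HasCircleGerm.comp {f g : UnitAddCircle → UnitAddCircle} {k l k' l' : ℤ}
    (hf : HasCircleGerm f k l) (hg : HasCircleGerm g k' l') :
    HasCircleGerm (fun x => f (g x)) (k + k') (l + l') := by
  filter_upwards [hg, (tendsto_twoSlopes k' l').eventually hf] with t h1 h2
  rw [h1, h2, twoSlopes_comp]

theorem exists_hasCircleGerm {g : ThompsonT} (hg : g • (0 : UnitAddCircle) = 0) :
    ∃ k l, HasCircleGerm (fun x => g • x) k l := by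
  let φ : ℝ → ℝ := fun t => AddCircle.equivIco 1 (-1 / 2) (g • (t : UnitAddCircle))
  have hφ : ∀ t, (φ t : UnitAddCircle) = g • (t : UnitAddCircle) := fun t =>
    coe_equivIco_circle _ _
  have hφ0 : φ 0 = 0 := by
    have h : (0 : ℝ) ∈ Set.Ico (-1 / 2 : ℝ) (-1 / 2 + 1) := ⟨by norm_num, by norm_num⟩
    have h1 := congrArg Subtype.val (AddCircle.equivIco_coe_eq (p := (1 : ℝ)) h)
    rw [AddCircle.coe_zero, ← hg] at h1
    exact h1
  have hcoe : ∀ t : ℝ, t ≠ 0 → |t| < 1 → (t : UnitAddCircle) ≠ 0 := by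
    intro t ht0 ht1 h
    obtain ⟨n, hn⟩ := coe_eq_coe_iff_circle (x := t) (y := 0) |>.1 (by rw [h, AddCircle.coe_zero])
    rw [sub_zero] at hn
    rw [hn] at ht0 ht1
    have : n = 0 := Int.abs_lt_one_iff.1 (by exact_mod_cast ht1)
    exact ht0 (by simp [this])
  -- near `0`, a continuous local lift without breakpoints other than `0`
  obtain ⟨ε, hε, hε1, hne, hbrk⟩ : ∃ ε > 0, ε ≤ (1 : ℝ) ∧
      (∀ t : ℝ, |t| < ε → g • (t : UnitAddCircle) ≠ ((-1 / 2 : ℝ) : UnitAddCircle)) ∧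
      ∀ t : ℝ, |t| < ε → t ≠ 0 → (t : UnitAddCircle) ∉
        breakpoints (g : UnitAddCircle ≃ₜ UnitAddCircle) := by
    have h1 : ∀ᶠ y in 𝓝 (0 : UnitAddCircle), g • y ≠ ((-1 / 2 : ℝ) : UnitAddCircle) := by
      refine (isOpen_ne_fun (continuous_const_smul g) continuous_const).mem_nhds ?_
      change g • (0 : UnitAddCircle) ≠ _
      rw [hg]
      exact (hcoe (-1 / 2) (by norm_num) (by rw [abs_lt]; constructor <;> norm_num)).symm
    have h2 : ∀ᶠ y in 𝓝 (0 : UnitAddCircle),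
        y ∉ breakpoints (g : UnitAddCircle ≃ₜ UnitAddCircle) \ {0} :=
      (g.2.1.subset Set.sdiff_subset).isClosed.isOpen_compl.mem_nhds (by simp)
    have h3 := h1.and h2
    rw [eventually_nhds_zero_circle_iff, Metric.eventually_nhds_iff] at h3
    obtain ⟨ε, hε, h⟩ := h3
    refine ⟨min ε 1, by positivity, min_le_right _ _, fun t ht => ?_, fun t ht ht0 htb => ?_⟩
    · exact (h (by simpa using ht.trans_le (min_le_left _ _))).1
    · exact (h (by simpa using ht.trans_le (min_le_left _ _))).2
        ⟨htb, hcoe t ht0 (ht.trans_le (min_le_right _ _))⟩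
  have hcont : ∀ t : ℝ, |t| < ε → ContinuousAt φ t := fun t ht =>
    continuous_subtype_val.continuousAt.comp
      ((AddCircle.continuousAt_equivIco 1 (-1 / 2) (hne t ht)).comp
        (f := fun s : ℝ => g • (s : UnitAddCircle))
        ((continuous_const_smul g).comp continuous_coe_circle).continuousAt)
  have hslope : ∀ t : ℝ, |t| < ε → t ≠ 0 → ∃ k, HasSlopeAt φ t k := fun t ht ht0 => by
    obtain ⟨k, hk⟩ := not_not.1 (hbrk t ht ht0)
    exact ⟨k, hk.hasSlopeAt (Eventually.of_forall hφ) (hcont t ht)⟩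
  have hlim : ∀ s : Set ℝ, Tendsto φ (𝓝[s] 0) (𝓝 0) := fun s => by
    have := (hcont 0 (by simpa using hε)).tendsto
    rw [hφ0] at this
    exact this.mono_left nhdsWithin_le_nhds
  have haff : ∀ (s : Set ℝ) (k : ℤ) (c : ℝ), Tendsto (fun x : ℝ => (2 : ℝ) ^ k * x + c)
      (𝓝[s] 0) (𝓝 c) := fun s k c => by
    have h : Continuous fun x : ℝ => (2 : ℝ) ^ k * x + c := by fun_prop
    have := h.tendsto 0
    rw [mul_zero, zero_add] at this
    exact this.mono_left nhdsWithin_le_nhds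
  obtain ⟨k, c, hk⟩ := exists_affine_of_hasSlopeAt (s := Set.Ioo 0 ε) isOpen_Ioo
    isPreconnected_Ioo (Set.nonempty_Ioo.2 hε) fun x hx =>
      hslope x (by rw [abs_lt]; constructor <;> linarith [hx.1, hx.2]) hx.1.ne'
  obtain ⟨l, d, hl⟩ := exists_affine_of_hasSlopeAt (s := Set.Ioo (-ε) 0) isOpen_Ioo
    isPreconnected_Ioo (Set.nonempty_Ioo.2 (by linarith)) fun x hx =>
      hslope x (by rw [abs_lt]; constructor <;> linarith [hx.1, hx.2]) hx.2.ne
  have hc : c = 0 := by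
    refine tendsto_nhds_unique ((haff (Set.Ioi 0) k c).congr' ?_) (hlim (Set.Ioi 0))
    filter_upwards [Ioo_mem_nhdsGT hε] with x hx using (hk x hx).symm
  have hd : d = 0 := by
    refine tendsto_nhds_unique ((haff (Set.Iio 0) l d).congr' ?_) (hlim (Set.Iio 0))
    filter_upwards [Ioo_mem_nhdsLT (neg_lt_zero.2 hε)] with x hx using (hl x hx).symm
  refine ⟨k, l, ?_⟩
  filter_upwards [Ioo_mem_nhds (neg_lt_zero.2 hε) hε] with t ht
  rw [← hφ]
  congr 1
  unfold twoSlopes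
  rcases lt_trichotomy t 0 with h | h | h
  · rw [if_neg h.not_ge, hl t ⟨ht.1, h⟩, hd, add_zero]
  · simp [h, hφ0]
  · rw [if_pos h.le, hk t ⟨h, ht.2⟩, hc, add_zero]

end Germs

/-! ### Groups containing the compactly supported homeomorphisms of the line -/

section PLAction

/-- Let a group `G` of homeomorphisms of the circle contain `plCompact 0 1`, by means of `ι`. Then
every uniformly recurrent subgroup other than the trivial one has a member which contains
`plCompact 0 1`: some member contains `plCompact p q`, and the interval `(p, q)` can be expanded. -/
theorem IsURS.exists_range_le {G : Type*} [Group G] [MulAction G UnitAddCircle]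
    [FaithfulSMul G UnitAddCircle] [ContinuousConstSMul G UnitAddCircle] (ι : plCompact 0 1 →* G)
    (hι : ∀ (f : plCompact 0 1) (t : ℝ), t ∈ Set.Ico (0 : ℝ) 1 →
      ι f • (t : UnitAddCircle) = (((f : ℝ ≃ₜ ℝ) t : ℝ) : UnitAddCircle))
    {A : Set (Subgroup G)} (hA : IsURS A) (h : A ≠ {⊥}) : ∃ K ∈ A, ι.range ≤ K := by
  have hinj : Function.Injective ι := by
    rw [injective_iff_map_eq_one]
    intro f hf
    refine Subtype.ext (Homeomorph.ext fun t => ?_)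
    by_cases ht : t ∈ Set.Ico (0 : ℝ) 1
    · refine eq_of_coe_eq_of_mem_Ico (plCompact_mem_Ico f ht) ht ?_
      rw [← hι f t ht, hf, one_smul]
      rfl
    · obtain ⟨-, u, v, hu, hv, h⟩ := f.2
      exact h t fun h6 => ht ⟨hu.le.trans h6.1, h6.2.trans_lt hv⟩
  have hrigid : ∀ O : Set UnitAddCircle, IsOpen O → O.Nonempty →
      ∃ Γ ∈ {Γ | ∃ p q : ℝ, p < q ∧ 0 ≤ p ∧ q ≤ 1 ∧
        Γ = ((plCompact p q).subgroupOf (plCompact 0 1)).map ι},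
      IsSimpleGroup Γ ∧ Infinite Γ ∧ ∀ l ∈ Γ, ∀ x ∉ O, l • x = x := by
    intro O hO hne
    obtain ⟨x, hx⟩ := hne
    obtain ⟨t, ht, rfl⟩ := AddCircle.eq_coe_Ico x
    have hev : ∀ᶠ s : ℝ in 𝓝 t, (s : UnitAddCircle) ∈ O :=
      eventually_nhds_coe_iff.1 (hO.mem_nhds hx)
    obtain ⟨ε, hε, hball⟩ := Metric.eventually_nhds_iff.1 hev
    set q := min (t + ε) 1 with hq
    have htq : t < q := lt_min (by linarith) ht.2
    have hsub : plCompact t q ≤ plCompact 0 1 := by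
      rintro f ⟨hf, u, v, hu, hv, huv⟩
      exact ⟨hf, u, v, ht.1.trans_lt hu, hv.trans_le (min_le_right _ _), huv⟩
    have e : plCompact t q ≃* ((plCompact t q).subgroupOf (plCompact 0 1)).map ι :=
      (Subgroup.subgroupOfEquivOfLe hsub).symm.trans (Subgroup.equivMapOfInjective _ ι hinj)
    have := isSimpleGroup_plCompact htq
    have := infinite_plCompact htq
    refine ⟨_, ⟨t, q, htq, ht.1, min_le_right _ _, rfl⟩, e.symm.isSimpleGroup,
      Infinite.of_injective _ e.injective, ?_⟩
    rintro _ ⟨f, ⟨hf, u, v, hu, hv, huv⟩, rfl⟩ y hy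
    obtain ⟨s, hs, rfl⟩ := AddCircle.eq_coe_Ico y
    rw [hι f s hs]
    have : (f : ℝ ≃ₜ ℝ) s = s := huv s fun h6 => by
      refine hy (hball ?_)
      rw [Real.dist_eq, abs_of_pos (by linarith [h6.1])]
      linarith [h6.2, min_le_left (t + ε) 1]
    rw [this]
  obtain ⟨H, hH, _, ⟨p, q, hpq, hp, hq, rfl⟩, hle⟩ := hA.exists_rigid_le hrigid h
  obtain ⟨o₁, ho₁, ho₁'⟩ := exists_between hpq
  obtain ⟨o₂, ho₂, ho₂'⟩ := exists_between ho₁'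
  have hcomp : ∀ n : ℕ, ∃ c : plCompact 0 1, ∀ x ∈ Set.Icc (1 / (n + 2) : ℝ) (1 - 1 / (n + 2)),
      (c : ℝ ≃ₜ ℝ) x ∈ Set.Ioo o₁ o₂ := fun n => by
    have hn : (0 : ℝ) < 1 / (n + 2) := by positivity
    obtain ⟨g, hg, hgx⟩ := exists_compress (p := 0) (q := 1) hn
      (show 1 - 1 / ((n : ℝ) + 2) < 1 by linarith) (hp.trans ho₁.le) ho₂ (ho₂'.le.trans hq)
    exact ⟨⟨g, hg⟩, hgx⟩
  choose c hc using hcomp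
  let U : Ultrafilter ℕ := Ultrafilter.of atTop
  refine ⟨ultrafilterLimit U fun n => conjSubgroup (ι (c n))⁻¹ H,
    ultrafilterLimit_mem hA.isClosed fun n => hA.invariant _ H hH, ?_⟩
  rintro _ ⟨f, rfl⟩
  obtain ⟨hf, u, v, hu, hv, huv⟩ := f.2
  have hlim : Tendsto (fun n : ℕ => (1 : ℝ) / (n + 2)) atTop (𝓝 0) := by
    have := (tendsto_add_atTop_iff_nat 2).2 (tendsto_one_div_atTop_nhds_zero_nat (𝕜 := ℝ))
    simpa using this
  have hev : ∀ᶠ n : ℕ in (U : Filter ℕ), (1 : ℝ) / (n + 2) < u ∧ (1 : ℝ) / (n + 2) < 1 - v :=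
    ((hlim.eventually (gt_mem_nhds hu)).and (hlim.eventually (gt_mem_nhds
      (show 0 < 1 - v by linarith)))).filter_mono (Ultrafilter.of_le _)
  filter_upwards [hev] with n hn
  rw [mem_conjSubgroup]
  refine hle ⟨c n * f * (c n)⁻¹, ?_, by simp⟩
  refine ⟨(c n * f * (c n)⁻¹).2.1, o₁, o₂, ho₁, ho₂', fun x hx => ?_⟩
  change (c n : ℝ ≃ₜ ℝ) ((f : ℝ ≃ₜ ℝ) ((c n : ℝ ≃ₜ ℝ).symm x)) = x
  rw [huv, Homeomorph.apply_symm_apply]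
  intro h6
  refine hx (Set.Ioo_subset_Icc_self ?_)
  have := hc n ((c n : ℝ ≃ₜ ℝ).symm x) ⟨hn.1.le.trans h6.1, h6.2.trans (by linarith [hn.2])⟩
  rwa [Homeomorph.apply_symm_apply] at this

end PLAction

/-! ### Thompson's group `F` -/

section F

/-- The embedding in `F` of the group of homeomorphisms of the line with support in `(0, 1)`. -/
noncomputable def thompsonFHom : plCompact 0 1 →* ThompsonF :=
  thompsonHom.codRestrict ThompsonF fun f => (thompsonHom_mem_germStabilizer f).self_of_nhds

theorem thompsonFHom_range :
    thompsonFHom.range = germStabilizer ThompsonF (0 : UnitAddCircle) := by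
  ext g
  constructor
  · rintro ⟨f, rfl⟩
    exact thompsonHom_mem_germStabilizer f
  · intro hg
    obtain ⟨f, hf⟩ := exists_thompsonHom_eq (g := (g : ThompsonT)) hg
    exact ⟨f, Subtype.ext hf⟩

theorem thompsonFHom_range_le_commutator : thompsonFHom.range ≤ commutator ThompsonF := by
  rw [MonoidHom.range_eq_map, ← commutator_plCompact, commutator_def, Subgroup.map_commutator,
    commutator_def]
  exact Subgroup.commutator_mono le_top le_top

/-- The derived subgroup of `F` consists of the elements that are trivial near `0`: the germs at
`0` form an abelian group, and the elements with trivial germ form a perfect group. -/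
theorem commutator_ThompsonF :
    commutator ThompsonF = germStabilizer ThompsonF (0 : UnitAddCircle) := by
  refine le_antisymm ?_ (thompsonFHom_range ▸ thompsonFHom_range_le_commutator)
  rw [commutator_def, Subgroup.commutator_le]
  intro f _ g _
  obtain ⟨k, l, hf⟩ := exists_hasCircleGerm (g := (f : ThompsonT)) f.2
  obtain ⟨k', l', hg⟩ := exists_hasCircleGerm (g := (g : ThompsonT)) g.2
  have h1 : ∀ᶠ y in 𝓝 (0 : UnitAddCircle), (f * g) • y = (g * f) • y := by
    rw [eventually_nhds_zero_circle_iff]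
    filter_upwards [hf.comp hg, hg.comp hf] with t h1 h2
    rw [add_comm k, add_comm l, ← h2] at h1
    exact h1
  have h0 : (g * f)⁻¹ • (0 : UnitAddCircle) = 0 := inv_mem (s := MulAction.stabilizer ThompsonT 0)
    (mul_mem g.2 f.2)
  have h2 : Tendsto (fun y : UnitAddCircle => (g * f)⁻¹ • y) (𝓝 0) (𝓝 0) := by
    have := (continuous_const_smul (g * f)⁻¹).tendsto (0 : UnitAddCircle)
    rwa [h0] at this
  rw [mem_germStabilizer]
  filter_upwards [h2.eventually h1] with y hy
  rw [show ⁅f, g⁆ = (f * g) * (g * f)⁻¹ by rw [commutatorElement_def]; group, mul_smul, hy,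
    smul_inv_smul]

theorem isURS_ThompsonF_iff (A : Set (Subgroup ThompsonF)) :
    IsURS A ↔ ∃ N : Subgroup ThompsonF, N.Normal ∧ A = {N} := by
  constructor
  · intro hA
    by_cases h : A = {⊥}
    · exact ⟨⊥, inferInstance, h⟩
    · obtain ⟨K, hK, hle⟩ := hA.exists_range_le thompsonFHom
        (fun f t ht => thompsonHom_smul_coe f ht) h
      rw [thompsonFHom_range, ← commutator_ThompsonF] at hle
      have hN : K.Normal := ⟨fun n hn g => by
        have h1 : ⁅g, n⁆ ∈ K := hle (Subgroup.commutator_mem_commutator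
          (Subgroup.mem_top g) (Subgroup.mem_top n))
        have := K.mul_mem h1 hn
        rwa [commutatorElement_def, inv_mul_cancel_right] at this⟩
      exact ⟨K, hN, hA.eq_singleton hN hK⟩
  · rintro ⟨N, hN, rfl⟩
    exact isURS_singleton hN

theorem isURS_commutator_ThompsonF_iff (A : Set (Subgroup (commutator ThompsonF))) :
    IsURS A ↔ A = {⊥} ∨ A = {⊤} := by
  constructor
  · intro hA
    refine or_iff_not_imp_left.2 fun h => ?_
    obtain ⟨K, hK, hle⟩ := hA.exists_range_le (thompsonFHom.codRestrict (commutator ThompsonF)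
      fun f => thompsonFHom_range_le_commutator ⟨f, rfl⟩)
      (fun f t ht => thompsonHom_smul_coe f ht) h
    have hKtop : K = ⊤ := by
      rw [eq_top_iff]
      rintro ⟨g, hg⟩ -
      rw [commutator_ThompsonF, ← thompsonFHom_range] at hg
      obtain ⟨f, rfl⟩ := hg
      exact hle ⟨f, rfl⟩
    exact hA.eq_singleton inferInstance (hKtop ▸ hK)
  · rintro (rfl | rfl)
    · exact isURS_singleton inferInstance
    · exact isURS_singleton inferInstance

end F

/-! ### Thompson's group `T` -/

section T

/-- The rotation by a dyadic angle, as an element of `T`. -/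
noncomputable def dyadicRotation (d : dyadicReals) : ThompsonT :=
  ⟨Homeomorph.addLeft ((d : ℝ) : UnitAddCircle), by
    have h : breakpoints (Homeomorph.addLeft ((d : ℝ) : UnitAddCircle)) = ∅ := by
      refine Set.eq_empty_of_forall_notMem fun x hx => hx ⟨0, Eventually.of_forall fun t => ?_⟩
      simp [add_assoc]
    refine ⟨h ▸ Set.finite_empty, h ▸ Set.empty_subset _, fun x => ?_⟩
    obtain ⟨t, -, rfl⟩ := AddCircle.eq_coe_Ico x
    change ((d : ℝ) : UnitAddCircle) + t ∈ dyadicPoints ↔ _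
    rw [← AddCircle.coe_add, coe_mem_dyadicPoints_iff, coe_mem_dyadicPoints_iff,
      add_mem_cancel_left d.2]⟩

theorem dyadicRotation_smul (d : dyadicReals) (x : UnitAddCircle) :
    dyadicRotation d • x = ((d : ℝ) : UnitAddCircle) + x := rfl

instance isMinimal_ThompsonT : MulAction.IsMinimal ThompsonT UnitAddCircle where
  dense_orbit x y := by
    obtain ⟨t, -, rfl⟩ := AddCircle.eq_coe_Ico x
    obtain ⟨s, -, rfl⟩ := AddCircle.eq_coe_Ico y
    refine mem_closure_iff_nhds.2 fun O hO => ?_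
    have hev : ∀ᶠ r : ℝ in 𝓝 s, (r : UnitAddCircle) ∈ O := eventually_nhds_coe_iff.1 hO
    obtain ⟨ε, hε, h⟩ := Metric.eventually_nhds_iff.1 hev
    obtain ⟨d, hd, h1, h2⟩ := exists_dyadic_between (show s - t < s - t + ε by linarith)
    refine ⟨_, h (y := d + t) ?_, dyadicRotation ⟨d, hd⟩, ?_⟩
    · rw [Real.dist_eq, abs_of_pos] <;> linarith
    · change dyadicRotation ⟨d, hd⟩ • (t : UnitAddCircle) = _
      rw [dyadicRotation_smul, AddCircle.coe_add]

theorem sqrt_two_mul_notMem_dyadicReals {k : ℤ} (hk : k ≠ 0) :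
    (1 - 2 ^ k) * √2 ∉ dyadicReals := by
  rintro ⟨m, n, h⟩
  have hq : (1 - (2 : ℚ) ^ k) ≠ 0 := by
    rw [sub_ne_zero, ne_comm]
    intro h
    exact hk ((zpow_eq_one_iff_right₀ (by norm_num) (by norm_num)).1 h)
  refine irrational_sqrt_two.ratCast_mul hq ⟨m / 2 ^ n, ?_⟩
  push_cast
  rw [← h]

/-- An element of `T` that fixes an irrational point such as `√2` is trivial near it: it is affine
there, and it preserves the dyadic points only if the slope is `1`. -/
theorem stabilizer_le_germStabilizer_sqrt_two :
    MulAction.stabilizer ThompsonT ((√2 : ℝ) : UnitAddCircle) ≤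
      germStabilizer ThompsonT ((√2 : ℝ) : UnitAddCircle) := by
  intro g hg
  have hg' : (g : UnitAddCircle ≃ₜ UnitAddCircle) ((√2 : ℝ) : UnitAddCircle) =
    ((√2 : ℝ) : UnitAddCircle) := hg
  have hbrk : ((√2 : ℝ) : UnitAddCircle) ∉ breakpoints (g : UnitAddCircle ≃ₜ UnitAddCircle) := by
    intro h
    have h1 := coe_mem_dyadicPoints_iff.1 (g.2.2.1 h)
    refine sqrt_two_mul_notMem_dyadicReals (k := 1) one_ne_zero ?_
    have := neg_mem h1
    convert this using 1
    ring
  obtain ⟨k, hk⟩ := not_not.1 hbrk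
  rw [HasDyadicSlopeAt, hg'] at hk
  have hk0 : k = 0 := by
    by_contra hk0
    obtain ⟨ε, hε, h⟩ := Metric.eventually_nhds_iff.1 hk
    obtain ⟨d, hd, h1, h2⟩ := exists_dyadic_between (show √2 < √2 + ε by linarith)
    have h3 := h (y := d - √2) (by rw [Real.dist_eq, abs_of_pos] <;> linarith)
    rw [← AddCircle.coe_add, ← AddCircle.coe_add, add_sub_cancel] at h3
    have h4 := (g.2.2.2 d).2 (coe_mem_dyadicPoints_iff.2 hd)
    rw [h3, coe_mem_dyadicPoints_iff] at h4
    refine sqrt_two_mul_notMem_dyadicReals hk0 ?_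
    convert sub_mem h4 (two_zpow_mul_mem_dyadicReals k hd) using 1
    ring
  rw [mem_germStabilizer, eventually_nhds_coe_iff]
  have ht : Tendsto (fun s : ℝ => s - √2) (𝓝 √2) (𝓝 0) := by
    have : Continuous (fun s : ℝ => s - √2) := by fun_prop
    simpa using this.tendsto √2
  filter_upwards [ht.eventually hk] with s hs
  rw [hk0, zpow_zero, one_mul, ← AddCircle.coe_add, add_sub_cancel] at hs
  exact hs

theorem exists_plCompact_apply_eq_of_lt {y z : ℝ} (hy : y ∈ dyadicReals) (hz : z ∈ dyadicReals)
    (h0 : 0 < y) (hyz : y < z) (h1 : z < 1) : ∃ f : plCompact 0 1, (f : ℝ ≃ₜ ℝ) y = z := by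
  -- several bumps move `y` to `z` by small steps of equal length
  obtain ⟨n, hn⟩ := exists_pow_lt_of_lt_one (lt_min h0 (sub_pos.2 h1))
    (by norm_num : (1 / 2 : ℝ) < 1)
  set δ := (2 : ℝ) ^ (-n : ℤ) * (z - y) with hδ
  have hδ' : δ = (1 / 2) ^ n * (z - y) := by
    rw [hδ, zpow_neg, zpow_natCast, one_div, inv_pow]
  have hδd : δ ∈ dyadicReals := two_zpow_mul_mem_dyadicReals _ (sub_mem hz hy)
  have hδ0 : 0 < δ := mul_pos (by positivity) (sub_pos.2 hyz)
  have hδ1 : δ < min y (1 - z) := by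
    refine lt_of_le_of_lt ?_ hn
    rw [hδ']
    exact mul_le_of_le_one_right (by positivity) (by linarith)
  have hδ2 := lt_min_iff.1 hδ1
  have h2n : (2 : ℝ) ^ n * δ = z - y := by
    rw [hδ', ← mul_assoc, ← mul_pow]
    norm_num
  have step : ∀ j : ℕ, j ≤ 2 ^ n → ∃ f : plCompact 0 1, (f : ℝ ≃ₜ ℝ) y = y + j * δ := by
    intro j
    induction j with
    | zero => exact fun _ => ⟨1, by simp⟩
    | succ j ih =>
      intro hj
      obtain ⟨f, hf⟩ := ih ((Nat.le_succ j).trans hj)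
      have hjn : ((j : ℝ) + 1) * δ ≤ z - y := by
        rw [← h2n]
        exact mul_le_mul_of_nonneg_right (by exact_mod_cast hj) hδ0.le
      have hj0 : 0 ≤ (j : ℝ) * δ := by positivity
      have hjd : (j : ℝ) * δ ∈ dyadicReals := by
        rw [← nsmul_eq_mul]
        exact nsmul_mem hδd j
      have hb : bump (y + j * δ - δ) δ ∈ plCompact 0 1 :=
        plSupported_le_plCompact (by linarith) (by linarith)
          (bump_mem_plSupported (sub_mem (add_mem hy hjd) hδd) hδd hδ0.le)
      refine ⟨⟨_, hb⟩ * f, ?_⟩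
      rw [Subgroup.coe_mul, Homeomorph.mul_apply, hf,
        bump_of_mem_left hδ0.le (by linarith) (by linarith)]
      push_cast
      ring
  obtain ⟨f, hf⟩ := step (2 ^ n) le_rfl
  refine ⟨f, hf.trans ?_⟩
  push_cast
  rw [h2n]
  ring

/-- The group of homeomorphisms of the line with support in `(0, 1)` acts transitively on the dyadic
numbers of `(0, 1)`. -/
theorem exists_plCompact_apply_eq {y z : ℝ} (hy : y ∈ dyadicReals) (hz : z ∈ dyadicReals)
    (hy' : y ∈ Set.Ioo (0 : ℝ) 1) (hz' : z ∈ Set.Ioo (0 : ℝ) 1) :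
    ∃ f : plCompact 0 1, (f : ℝ ≃ₜ ℝ) y = z := by
  rcases lt_trichotomy y z with h | rfl | h
  · exact exists_plCompact_apply_eq_of_lt hy hz hy'.1 h hz'.2
  · exact ⟨1, rfl⟩
  · obtain ⟨f, hf⟩ := exists_plCompact_apply_eq_of_lt hz hy hz'.1 h hy'.2
    exact ⟨f⁻¹, by
      change (f : ℝ ≃ₜ ℝ).symm y = z
      rw [Homeomorph.symm_apply_eq, hf]⟩

theorem one_half_mem_dyadicReals : (1 / 2 : ℝ) ∈ dyadicReals := ⟨1, 1, by norm_num⟩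

theorem exists_thompsonHom_smul_eq_half {z : UnitAddCircle} (hz : z ∈ dyadicPoints) (h0 : z ≠ 0) :
    ∃ f, thompsonHom f • z = ((1 / 2 : ℝ) : UnitAddCircle) := by
  obtain ⟨t, ht, rfl⟩ := AddCircle.eq_coe_Ico z
  have ht0 : t ≠ 0 := by
    rintro rfl
    exact h0 (AddCircle.coe_zero 1)
  obtain ⟨f, hf⟩ := exists_plCompact_apply_eq (coe_mem_dyadicPoints_iff.1 hz)
    one_half_mem_dyadicReals ⟨lt_of_le_of_ne ht.1 ht0.symm, ht.2⟩ ⟨by norm_num, by norm_num⟩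
  exact ⟨f, by rw [thompsonHom_smul_coe f ht, hf]⟩

theorem exists_germStabilizer_half_hasCircleGerm (k l : ℤ) :
    ∃ q ∈ germStabilizer ThompsonT ((1 / 2 : ℝ) : UnitAddCircle),
      HasCircleGerm (fun x => q • x) k l := by
  obtain ⟨f, hf⟩ := exists_plCompact_hasGermAt k l
  set r := dyadicRotation ⟨1 / 2, one_half_mem_dyadicReals⟩ with hr
  have hr0 : r⁻¹ • (0 : UnitAddCircle) = ((1 / 2 : ℝ) : UnitAddCircle) := by
    rw [inv_smul_eq_iff, hr, dyadicRotation_smul, ← AddCircle.coe_add,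
      add_halves, AddCircle.coe_period]
  refine ⟨r⁻¹ * thompsonHom f * r, ?_, ?_⟩
  · rw [← hr0, ← conj_mem_germStabilizer]
    convert thompsonHom_mem_germStabilizer f using 1
    group
  · filter_upwards [hf, Ioo_mem_nhds (show (-1 / 2 : ℝ) < 0 by norm_num)
      (show (0 : ℝ) < 1 / 2 by norm_num)] with t h1 h2
    rw [mul_smul, mul_smul, inv_smul_eq_iff, hr, dyadicRotation_smul, dyadicRotation_smul,
      ← AddCircle.coe_add, ← AddCircle.coe_add, thompsonHom_smul_coe f
        ⟨by linarith [h2.1], by linarith [h2.2]⟩, h1]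

/-- The germ stabilizer of `0` is contained in no proper subgroup that moves `0`: such a subgroup
contains the germ stabilizer of `1/2` as well, hence elements with all germs at `0`. -/
theorem eq_top_of_germStabilizer_le {K : Subgroup ThompsonT}
    (hK : germStabilizer ThompsonT (0 : UnitAddCircle) ≤ K) {g : ThompsonT} (hg : g ∈ K)
    (hg0 : g • (0 : UnitAddCircle) ≠ 0) : K = ⊤ := by
  have hdy : ∀ h : ThompsonT, h • (0 : UnitAddCircle) ∈ dyadicPoints := fun h =>
    (h.2.2.2 0).2 ⟨0, 0, by simp⟩
  obtain ⟨f₀, hf₀⟩ := exists_thompsonHom_smul_eq_half (hdy g) hg0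
  have hkK : thompsonHom f₀ * g ∈ K := mul_mem (hK (thompsonHom_mem_germStabilizer f₀)) hg
  set k := thompsonHom f₀ * g
  have hk : k • (0 : UnitAddCircle) = ((1 / 2 : ℝ) : UnitAddCircle) := by rw [mul_smul, hf₀]
  have hhalf : germStabilizer ThompsonT ((1 / 2 : ℝ) : UnitAddCircle) ≤ K := fun h hh => by
    rw [← hk, ← conj_mem_germStabilizer] at hh
    have := mul_mem (mul_mem hkK (hK hh)) (inv_mem hkK)
    convert this using 1
    group
  have hfix : ∀ h : ThompsonT, h • (0 : UnitAddCircle) = 0 → h ∈ K := fun h hh => by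
    obtain ⟨m, l, hml⟩ := exists_hasCircleGerm hh
    obtain ⟨q, hq, hqg⟩ := exists_germStabilizer_half_hasCircleGerm (-m) (-l)
    have h1 : q * h ∈ K := by
      refine hK (mem_germStabilizer.2 (eventually_nhds_zero_circle_iff.2 ?_))
      filter_upwards [hqg.comp hml] with t ht
      rw [neg_add_cancel, neg_add_cancel, twoSlopes_zero_zero] at ht
      rw [mul_smul, ht]
    exact (mul_mem_cancel_left (hhalf hq)).1 h1
  refine eq_top_iff.2 fun h _ => ?_
  by_cases hh : h • (0 : UnitAddCircle) = 0
  · exact hfix h hh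
  · obtain ⟨f, hf⟩ := exists_thompsonHom_smul_eq_half (hdy h) hh
    have h1 : k⁻¹ * (thompsonHom f * h) ∈ K :=
      hfix _ (by rw [mul_smul, mul_smul, hf, inv_smul_eq_iff, hk])
    rwa [mul_mem_cancel_left (inv_mem hkK),
      mul_mem_cancel_left (hK (thompsonHom_mem_germStabilizer f))] at h1

theorem isURS_ThompsonT_iff (A : Set (Subgroup ThompsonT)) :
    IsURS A ↔ A = {⊥} ∨ A = {⊤} ∨ A = stabilizerURS ThompsonT UnitAddCircle := by
  refine isURS_iff_of_between ⟨_, stabilizer_le_germStabilizer_sqrt_two⟩ (fun A hA => ?_) A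
  refine or_iff_not_imp_left.2 fun h => ?_
  obtain ⟨K, hKA, hK⟩ := hA.exists_range_le thompsonHom (fun f t ht => thompsonHom_smul_coe f ht) h
  have hK' : germStabilizer ThompsonT (0 : UnitAddCircle) ≤ K := fun g hg => by
    obtain ⟨f, rfl⟩ := exists_thompsonHom_eq hg
    exact hK ⟨f, rfl⟩
  by_cases hfix : K ≤ MulAction.stabilizer ThompsonT (0 : UnitAddCircle)
  · exact Or.inr ⟨K, hKA, 0, hK', hfix⟩
  · obtain ⟨g, hg, hg0⟩ := SetLike.not_le_iff_exists.1 hfix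
    refine Or.inl (hA.eq_singleton inferInstance ?_)
    rwa [← eq_top_of_germStabilizer_le hK' hg hg0]

end T

/-! ### Words, cylinders and prefix exchanges -/

section Words

theorem prependWord_apply_of_lt {w : List Bool} {x y : BinaryCantor} {i : ℕ} (hi : i < w.length) :
    prependWord w x i = prependWord w y i := by
  induction w generalizing i with
  | nil => simp at hi
  | cons b w ih =>
    cases i with
    | zero => rfl
    | succ i => exact ih (by simpa using hi)

theorem prependWord_add (w : List Bool) (x : BinaryCantor) (n : ℕ) :
    prependWord w x (n + w.length) = x n := by
  induction w with
  | nil => rfl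
  | cons b w ih => exact ih

theorem prependWord_mem (w : List Bool) (x : BinaryCantor) : prependWord w x ∈ wordCylinder w :=
  ⟨x, rfl⟩

theorem prependWord_append_mem (u v : List Bool) (x : BinaryCantor) :
    prependWord (u ++ v) x ∈ wordCylinder u :=
  ⟨prependWord v x, (prependWord_append u v x).symm⟩

theorem wordCylinder_append_subset (u v : List Bool) : wordCylinder (u ++ v) ⊆ wordCylinder u := by
  rintro _ ⟨x, rfl⟩
  exact prependWord_append_mem u v x

theorem mem_wordCylinder_of_eq {w : List Bool} {x y : BinaryCantor} (hx : x ∈ wordCylinder w)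
    (h : ∀ i < w.length, y i = x i) : y ∈ wordCylinder w := by
  obtain ⟨x, rfl⟩ := hx
  refine ⟨fun n => y (n + w.length), funext fun n => ?_⟩
  rcases lt_or_ge n w.length with hn | hn
  · rw [h n hn, prependWord_apply_of_lt hn]
  · obtain ⟨k, rfl⟩ := Nat.exists_eq_add_of_le' hn
    exact prependWord_add _ _ _

theorem isOpen_wordCylinder (w : List Bool) : IsOpen (wordCylinder w) := by
  refine isOpen_iff_mem_nhds.2 fun x hx => ?_
  refine mem_of_superset ((PiNat.isOpen_cylinder (fun _ => Bool) x w.length).mem_nhds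
    (PiNat.self_mem_cylinder x w.length)) fun y hy => mem_wordCylinder_of_eq hx fun i hi => ?_
  exact PiNat.mem_cylinder_iff.1 hy i hi

theorem exists_word_subset {x : BinaryCantor} {O : Set BinaryCantor} (hO : O ∈ 𝓝 x) (N : ℕ) :
    ∃ w y, N ≤ w.length ∧ prependWord w y = x ∧ wordCylinder w ⊆ O := by
  obtain ⟨_, ⟨z, n, rfl⟩, hx, hsub⟩ :=
    (PiNat.isTopologicalBasis_cylinders (fun _ : ℕ => Bool)).mem_nhds_iff.1 hO
  obtain ⟨w, y, hw, rfl⟩ := exists_prependWord (N + n) x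
  refine ⟨w, y, by lia, rfl, ?_⟩
  rintro _ ⟨v, rfl⟩
  refine hsub (PiNat.mem_cylinder_iff.2 fun i hi => ?_)
  rw [← PiNat.mem_cylinder_iff.1 hx i hi]
  exact prependWord_apply_of_lt (by lia)

theorem disjoint_wordCylinder_append {u v : List Bool}
    (h : Disjoint (wordCylinder u) (wordCylinder v)) (s t : List Bool) :
    Disjoint (wordCylinder (u ++ s)) (wordCylinder (v ++ t)) :=
  h.mono (wordCylinder_append_subset u s) (wordCylinder_append_subset v t)

theorem disjoint_wordCylinder_of_length_eq {u v : List Bool} (hl : u.length = v.length)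
    (h : u ≠ v) : Disjoint (wordCylinder u) (wordCylinder v) := by
  rw [Set.disjoint_left]
  rintro _ ⟨x, rfl⟩ ⟨y, hy⟩
  exact h (eq_of_prependWord_eq hl hy.symm)

theorem disjoint_wordCylinder_append_singleton (u : List Bool) {b c : Bool} (h : b ≠ c) :
    Disjoint (wordCylinder (u ++ [b])) (wordCylinder (u ++ [c])) :=
  disjoint_wordCylinder_of_length_eq (by simp) (by simpa using h)

theorem exists_prependWord_append_singleton (u : List Bool) (x : BinaryCantor) :
    ∃ b y, prependWord u x = prependWord (u ++ [b]) y := by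
  refine ⟨x 0, fun n => x (n + 1), ?_⟩
  rw [prependWord_append]
  congr 1
  funext n
  cases n <;> rfl

theorem wordCylinder_eq_union {b c : Bool} (h : b ≠ c) (u : List Bool) :
    wordCylinder u = wordCylinder (u ++ [b]) ∪ wordCylinder (u ++ [c]) := by
  refine Set.Subset.antisymm ?_ (Set.union_subset (wordCylinder_append_subset _ _)
    (wordCylinder_append_subset _ _))
  rintro _ ⟨x, rfl⟩
  obtain ⟨d, y, hd⟩ := exists_prependWord_append_singleton u x
  rw [hd]
  have : d = b ∨ d = c := by cases b <;> cases c <;> cases d <;> simp_all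
  rcases this with rfl | rfl
  · exact Or.inl ⟨y, rfl⟩
  · exact Or.inr ⟨y, rfl⟩

/-- The map `g` acts on all sufficiently small cylinders by changing the prefix. -/
def HasDepth (g : BinaryCantor → BinaryCantor) : Prop :=
  ∃ N, ∀ w : List Bool, N ≤ w.length → ∃ z, ∀ x, g (prependWord w x) = prependWord z x

theorem continuous_prependWord (w : List Bool) : Continuous (prependWord w) := by
  induction w with
  | nil => exact continuous_id
  | cons b w ih =>
    refine continuous_pi fun n => ?_
    cases n with
    | zero => exact continuous_const
    | succ n => exact (continuous_apply n).comp ih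

theorem isClosed_wordCylinder (w : List Bool) : IsClosed (wordCylinder w) :=
  (isCompact_range (continuous_prependWord w)).isClosed

theorem HasDepth.continuous {g : BinaryCantor → BinaryCantor} (hg : HasDepth g) :
    Continuous g := by
  obtain ⟨N, hN⟩ := hg
  refine continuous_iff_continuousAt.2 fun x => ?_
  obtain ⟨w, y, hw, rfl⟩ := exists_prependWord N x
  obtain ⟨z, hz⟩ := hN w hw.ge
  have h : Continuous fun v : BinaryCantor => prependWord z fun n => v (n + w.length) :=
    (continuous_prependWord z).comp (continuous_pi fun n => continuous_apply _)
  refine h.continuousAt.congr ?_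
  filter_upwards [(isOpen_wordCylinder w).mem_nhds (prependWord_mem w y)] with v hv
  obtain ⟨v, rfl⟩ := hv
  rw [hz]
  congr 1
  funext n
  exact prependWord_add w v n

/-- A bijection that acts on all small cylinders by changing the prefix, as an element of `V`. -/
noncomputable def thompsonVOfEquiv (e : BinaryCantor ≃ BinaryCantor) (h : HasDepth e) : ThompsonV :=
  ⟨h.continuous.homeoOfEquivCompactToT2, by
    obtain ⟨N, hN⟩ := h
    exact isPrefixExchange_of_depth e.bijective (N := N) fun w hw => hN w hw.ge⟩

theorem thompsonVOfEquiv_smul (e : BinaryCantor ≃ BinaryCantor) (h : HasDepth e)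
    (x : BinaryCantor) : thompsonVOfEquiv e h • x = e x := rfl

theorem exists_smul_prependWord (g : ThompsonV) : ∃ N, ∀ w : List Bool, N ≤ w.length →
    ∃ z, ∀ x, g • prependWord w x = prependWord z x :=
  IsPrefixExchange.exists_depth g.2

theorem hasDepth_smul (g : ThompsonV) : HasDepth fun x => g • x := exists_smul_prependWord g

theorem ThompsonV.ext {g h : ThompsonV} (H : ∀ x : BinaryCantor, g • x = h • x) : g = h :=
  FaithfulSMul.eq_of_smul_eq_smul H

end Words

section Swap

/-- The exchange of the prefixes `u` and `v` (meaningful if their cylinders are disjoint). -/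
noncomputable def swapFun (u v : List Bool) (x : BinaryCantor) : BinaryCantor :=
  open Classical in
  if x ∈ wordCylinder u then prependWord v fun n => x (n + u.length)
  else if x ∈ wordCylinder v then prependWord u fun n => x (n + v.length)
  else x

theorem swapFun_left (u v : List Bool) (x : BinaryCantor) :
    swapFun u v (prependWord u x) = prependWord v x := by
  rw [swapFun, if_pos (prependWord_mem u x)]
  congr 1
  exact funext (prependWord_add u x)

theorem swapFun_right {u v : List Bool} (h : Disjoint (wordCylinder u) (wordCylinder v))
    (x : BinaryCantor) : swapFun u v (prependWord v x) = prependWord u x := by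
  rw [swapFun, if_neg (Set.disjoint_right.1 h (prependWord_mem v x)), if_pos (prependWord_mem v x)]
  congr 1
  exact funext (prependWord_add v x)

theorem swapFun_of_notMem {u v : List Bool} {x : BinaryCantor} (hu : x ∉ wordCylinder u)
    (hv : x ∉ wordCylinder v) : swapFun u v x = x := by
  rw [swapFun, if_neg hu, if_neg hv]

theorem swapFun_swapFun {u v : List Bool} (h : Disjoint (wordCylinder u) (wordCylinder v))
    (x : BinaryCantor) : swapFun u v (swapFun u v x) = x := by
  by_cases hu : x ∈ wordCylinder u
  · obtain ⟨y, rfl⟩ := hu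
    rw [swapFun_left, swapFun_right h]
  by_cases hv : x ∈ wordCylinder v
  · obtain ⟨y, rfl⟩ := hv
    rw [swapFun_right h, swapFun_left]
  rw [swapFun_of_notMem hu hv, swapFun_of_notMem hu hv]

theorem hasDepth_swapFun {u v : List Bool} (h : Disjoint (wordCylinder u) (wordCylinder v)) :
    HasDepth (swapFun u v) := by
  refine ⟨max u.length v.length, fun w hw => ?_⟩
  have key : ∀ {t : List Bool} {x y : BinaryCantor}, t.length ≤ w.length →
      prependWord t y = prependWord w x → ∃ s, w = t ++ s := fun ht hxy =>
    prefix_of_prependWord_eq ht hxy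
  by_cases hu : ∃ s, w = u ++ s
  · obtain ⟨s, rfl⟩ := hu
    exact ⟨v ++ s, fun x => by rw [prependWord_append, swapFun_left, prependWord_append]⟩
  by_cases hv : ∃ s, w = v ++ s
  · obtain ⟨s, rfl⟩ := hv
    exact ⟨u ++ s, fun x => by rw [prependWord_append, swapFun_right h, prependWord_append]⟩
  refine ⟨w, fun x => swapFun_of_notMem ?_ ?_⟩
  · rintro ⟨y, hy⟩
    exact hu (key ((le_max_left _ _).trans hw) hy)
  · rintro ⟨y, hy⟩
    exact hv (key ((le_max_right _ _).trans hw) hy)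

/-- The element of `V` that exchanges the prefixes `u` and `v`. -/
noncomputable def wordSwap {u v : List Bool} (h : Disjoint (wordCylinder u) (wordCylinder v)) :
    ThompsonV :=
  thompsonVOfEquiv (Function.Involutive.toPerm _ (swapFun_swapFun h)) (hasDepth_swapFun h)

variable {u v : List Bool} (h : Disjoint (wordCylinder u) (wordCylinder v))

theorem wordSwap_smul_left (x : BinaryCantor) :
    wordSwap h • prependWord u x = prependWord v x := swapFun_left u v x

theorem wordSwap_smul_right (x : BinaryCantor) :
    wordSwap h • prependWord v x = prependWord u x := swapFun_right h x

theorem wordSwap_smul_of_notMem {x : BinaryCantor} (hu : x ∉ wordCylinder u)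
    (hv : x ∉ wordCylinder v) : wordSwap h • x = x := swapFun_of_notMem hu hv

theorem wordSwap_smul_of_disjoint {w : List Bool} (hu : Disjoint (wordCylinder w) (wordCylinder u))
    (hv : Disjoint (wordCylinder w) (wordCylinder v)) (x : BinaryCantor) :
    wordSwap h • prependWord w x = prependWord w x :=
  wordSwap_smul_of_notMem h (Set.disjoint_left.1 hu (prependWord_mem w x))
    (Set.disjoint_left.1 hv (prependWord_mem w x))

theorem wordSwap_mem_germStabilizer {y : BinaryCantor} (hu : y ∉ wordCylinder u)
    (hv : y ∉ wordCylinder v) : wordSwap h ∈ germStabilizer ThompsonV y := by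
  rw [mem_germStabilizer]
  filter_upwards [(isClosed_wordCylinder u).isOpen_compl.mem_nhds hu,
    (isClosed_wordCylinder v).isOpen_compl.mem_nhds hv] with x hxu hxv
  exact wordSwap_smul_of_notMem h hxu hxv

theorem wordSwap_mul_self : wordSwap h * wordSwap h = 1 :=
  ThompsonV.ext fun x => by
    rw [mul_smul, one_smul]
    exact swapFun_swapFun h x

theorem wordSwap_inv : (wordSwap h)⁻¹ = wordSwap h :=
  inv_eq_of_mul_eq_one_left (wordSwap_mul_self h)

/-- Conjugation of prefix exchanges. -/
theorem conj_wordSwap {u' v' : List Bool} (h' : Disjoint (wordCylinder u') (wordCylinder v'))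
    {g : ThompsonV} (hu : ∀ x, g • prependWord u x = prependWord u' x)
    (hv : ∀ x, g • prependWord v x = prependWord v' x) :
    g * wordSwap h * g⁻¹ = wordSwap h' := by
  rw [mul_inv_eq_iff_eq_mul]
  refine ThompsonV.ext fun x => ?_
  rw [mul_smul, mul_smul]
  by_cases hxu : x ∈ wordCylinder u
  · obtain ⟨y, rfl⟩ := hxu
    rw [wordSwap_smul_left, hu, hv, wordSwap_smul_left]
  by_cases hxv : x ∈ wordCylinder v
  · obtain ⟨y, rfl⟩ := hxv
    rw [wordSwap_smul_right, hu, hv, wordSwap_smul_right]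
  rw [wordSwap_smul_of_notMem h hxu hxv, wordSwap_smul_of_notMem]
  · rintro ⟨y, hy⟩
    rw [← hu] at hy
    exact hxu ⟨y, smul_left_cancel g hy⟩
  · rintro ⟨y, hy⟩
    rw [← hv] at hy
    exact hxv ⟨y, smul_left_cancel g hy⟩

/-- A prefix exchange splits as a product of two prefix exchanges. -/
theorem wordSwap_eq_mul : wordSwap h =
    wordSwap (disjoint_wordCylinder_append h [false] [false]) *
      wordSwap (disjoint_wordCylinder_append h [true] [true]) := by
  refine ThompsonV.ext fun x => ?_
  have hft := fun w => disjoint_wordCylinder_append_singleton w (show false ≠ true by decide)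
  rw [mul_smul]
  by_cases hxu : x ∈ wordCylinder u
  · obtain ⟨y, rfl⟩ := hxu
    obtain ⟨b, z, hz⟩ := exists_prependWord_append_singleton u y
    have hz' : prependWord v y = prependWord (v ++ [b]) z := by
      rw [prependWord_append] at hz ⊢
      rw [prependWord_injective u hz]
    rw [wordSwap_smul_left, hz, hz']
    cases b
    · rw [wordSwap_smul_of_disjoint _ (hft u) (disjoint_wordCylinder_append h _ _),
        wordSwap_smul_left]
    · rw [wordSwap_smul_left, wordSwap_smul_of_disjoint _
        (disjoint_wordCylinder_append h.symm _ _) (hft v).symm]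
  by_cases hxv : x ∈ wordCylinder v
  · obtain ⟨y, rfl⟩ := hxv
    obtain ⟨b, z, hz⟩ := exists_prependWord_append_singleton v y
    have hz' : prependWord u y = prependWord (u ++ [b]) z := by
      rw [prependWord_append] at hz ⊢
      rw [prependWord_injective v hz]
    rw [wordSwap_smul_right, hz, hz']
    cases b
    · rw [wordSwap_smul_of_disjoint _ (disjoint_wordCylinder_append h.symm _ _) (hft v),
        wordSwap_smul_right]
    · rw [wordSwap_smul_right, wordSwap_smul_of_disjoint _ (hft u).symm
        (disjoint_wordCylinder_append h _ _)]
  have hn : ∀ b, x ∉ wordCylinder (u ++ [b]) ∧ x ∉ wordCylinder (v ++ [b]) := fun b =>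
    ⟨fun hx => hxu (wordCylinder_append_subset _ _ hx),
      fun hx => hxv (wordCylinder_append_subset _ _ hx)⟩
  rw [wordSwap_smul_of_notMem h hxu hxv, wordSwap_smul_of_notMem _ (hn true).1 (hn true).2,
    wordSwap_smul_of_notMem _ (hn false).1 (hn false).2]

end Swap

/-! ### Generation of Thompson's group `V` by prefix exchanges -/

section Generation

/-- The cylinders of the words `w i` form a partition of the Cantor set, for any index type. -/
def IsWordPartition {ι : Type*} (w : ι → List Bool) : Prop :=
  (∀ i j, i ≠ j → Disjoint (wordCylinder (w i)) (wordCylinder (w j))) ∧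
    ∀ x, ∃ i, x ∈ wordCylinder (w i)

variable {ι : Type*} {w : ι → List Bool}

theorem eq_nil_of_forall_mem_wordCylinder {w : List Bool} (h : ∀ x, x ∈ wordCylinder w) :
    w = [] := by
  cases w with
  | nil => rfl
  | cons b w =>
    obtain ⟨y, hy⟩ := h fun _ => !b
    have := congrFun hy 0
    cases b <;> simp [prependWord] at this

/-- A longest word of a nontrivial partition has its sibling in the partition. -/
theorem IsWordPartition.exists_siblings [Finite ι] [Nontrivial ι] (hw : IsWordPartition w) :
    ∃ i j u, i ≠ j ∧ w i = u ++ [false] ∧ w j = u ++ [true] := by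
  obtain ⟨i, hi⟩ := Finite.exists_max fun i => (w i).length
  have hne : w i ≠ [] := fun h => by
    obtain ⟨j, hj⟩ := exists_ne i
    refine Set.disjoint_left.1 (hw.1 j i hj) (prependWord_mem _ fun _ => false) ?_
    rw [h]
    exact ⟨_, rfl⟩
  obtain ⟨u, b, hu⟩ := (List.eq_nil_or_concat (w i)).resolve_left hne
  rw [List.concat_eq_append] at hu
  obtain ⟨j, y, hy⟩ := hw.2 (prependWord (u ++ [!b]) fun _ => false)
  have hlen : (w j).length ≤ (u ++ [!b]).length := by
    refine (hi j).trans ?_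
    rw [hu]
    simp
  obtain ⟨s, hs⟩ := prefix_of_prependWord_eq hlen hy
  have hj : w j = u ++ [!b] := by
    rcases List.eq_nil_or_concat s with rfl | ⟨s, c, rfl⟩
    · rw [hs, List.append_nil]
    · exfalso
      rw [List.concat_eq_append, ← List.append_assoc] at hs
      have hu' : u = w j ++ s := (List.append_inj' hs rfl).1
      have hij : i ≠ j := by
        rintro rfl
        have := congrArg List.length hu'
        rw [hu] at this
        simp at this
      refine Set.disjoint_left.1 (hw.1 i j hij) (prependWord_mem _ fun _ => false) ?_
      rw [hu, hu', List.append_assoc]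
      exact prependWord_append_mem _ _ _
  have hij : i ≠ j := by
    rintro rfl
    rw [hu] at hj
    cases b <;> simp at hj
  cases b
  · exact ⟨i, j, u, hij, hu, hj⟩
  · exact ⟨j, i, u, hij.symm, hj, hu⟩

theorem IsWordPartition.merge [DecidableEq ι] (hw : IsWordPartition w) {i j : ι} {u : List Bool}
    (hij : i ≠ j) (hi : w i = u ++ [false]) (hj : w j = u ++ [true]) :
    IsWordPartition fun a : {a // a ≠ j} => if a.1 = i then u else w a.1 := by
  have hu : wordCylinder u = wordCylinder (w i) ∪ wordCylinder (w j) := by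
    rw [hi, hj]
    exact wordCylinder_eq_union (by decide) u
  have hdisj : ∀ a, a ≠ i → a ≠ j → Disjoint (wordCylinder u) (wordCylinder (w a)) :=
    fun a hai haj => by
      rw [hu]
      exact Set.disjoint_union_left.2 ⟨hw.1 _ _ hai.symm, hw.1 _ _ haj.symm⟩
  constructor
  · rintro ⟨a, ha⟩ ⟨b, hb⟩ hab
    have hab' : a ≠ b := fun h => hab (Subtype.ext h)
    by_cases hai : a = i
    · have hbi : b ≠ i := fun h => hab' (hai.trans h.symm)
      simpa [hai, hbi] using hdisj b hbi hb
    by_cases hbi : b = i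
    · simpa [hai, hbi] using (hdisj a hai ha).symm
    simpa [hai, hbi] using hw.1 a b hab'
  · intro x
    obtain ⟨k, hk⟩ := hw.2 x
    by_cases hkj : k = j
    · exact ⟨⟨i, hij⟩, by simpa [hu] using Or.inr (hkj ▸ hk)⟩
    by_cases hki : k = i
    · exact ⟨⟨i, hij⟩, by simpa [hu] using Or.inl (hki ▸ hk)⟩
    exact ⟨⟨k, hkj⟩, by simpa [hki] using hk⟩

theorem exists_mem_smul_eq_perm [Finite ι] {S : Subgroup ThompsonV}
    (hS : ∀ (u v : List Bool) (h : Disjoint (wordCylinder u) (wordCylinder v)), wordSwap h ∈ S)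
    (hw : IsWordPartition w) (π : Equiv.Perm ι) :
    ∃ s ∈ S, ∀ a x, s • prependWord (w a) x = prependWord (w (π a)) x := by
  classical
  induction π using Equiv.Perm.swap_induction_on with
  | one => exact ⟨1, one_mem _, fun a x => one_smul _ _⟩
  | swap_mul π a b hab ih =>
    obtain ⟨s, hs, hsx⟩ := ih
    refine ⟨wordSwap (hw.1 a b hab) * s, mul_mem (hS _ _ _) hs, fun c x => ?_⟩
    rw [mul_smul, hsx, Equiv.Perm.mul_apply]
    by_cases ha : π c = a
    · rw [ha, Equiv.swap_apply_left, wordSwap_smul_left]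
    by_cases hb : π c = b
    · rw [hb, Equiv.swap_apply_right, wordSwap_smul_right]
    rw [Equiv.swap_apply_of_ne_of_ne ha hb,
      wordSwap_smul_of_disjoint _ (hw.1 _ _ ha) (hw.1 _ _ hb)]

/-- After a permutation of the target words, a sibling pair of the source goes to a sibling pair of
the target; the two pairs can be merged. -/
theorem mem_of_isWordPartition {S : Subgroup ThompsonV}
    (hS : ∀ (u v : List Bool) (h : Disjoint (wordCylinder u) (wordCylinder v)), wordSwap h ∈ S)
    (n : ℕ) : ∀ (ι : Type) [Finite ι] (_ : Nat.card ι = n) (w z : ι → List Bool)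
    (_ : IsWordPartition w) (_ : IsWordPartition z) (g : ThompsonV)
    (_ : ∀ i x, g • prependWord (w i) x = prependWord (z i) x), g ∈ S := by
  classical
  induction n with
  | zero =>
    intro ι _ hcard w z hw _ g _
    obtain ⟨i, -⟩ := hw.2 fun _ => false
    have : Nonempty ι := ⟨i⟩
    exact absurd hcard Nat.card_pos.ne'
  | succ n ih =>
    intro ι _ hcard w z hw hz g hg
    rcases subsingleton_or_nontrivial ι with hι | hι
    · obtain ⟨i, -⟩ := hw.2 fun _ => false
      have hnil : ∀ {w : ι → List Bool}, IsWordPartition w → w i = [] := fun hw =>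
        eq_nil_of_forall_mem_wordCylinder fun x => by
          obtain ⟨j, hj⟩ := hw.2 x
          rwa [Subsingleton.elim i j]
      have : g = 1 := ThompsonV.ext fun x => by
        have := hg i x
        rw [hnil hw, hnil hz] at this
        rw [one_smul]
        exact this
      rw [this]
      exact one_mem _
    · obtain ⟨i, j, u, hij, hi, hj⟩ := hw.exists_siblings
      obtain ⟨k, l, v, hkl, hk, hl⟩ := hz.exists_siblings
      obtain ⟨π, hπi, hπj⟩ : ∃ π : Equiv.Perm ι, π i = k ∧ π j = l := by
        have h : Equiv.swap i k j ≠ k := fun h => by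
          rw [Equiv.swap_apply_eq_iff, Equiv.swap_apply_right] at h
          exact hij h.symm
        exact ⟨Equiv.swap (Equiv.swap i k j) l * Equiv.swap i k, by
          rw [Equiv.Perm.mul_apply, Equiv.swap_apply_left,
            Equiv.swap_apply_of_ne_of_ne h.symm hkl], by
          rw [Equiv.Perm.mul_apply, Equiv.swap_apply_left]⟩
      obtain ⟨s, hs, hsx⟩ := exists_mem_smul_eq_perm hS hz π
      have hzπ : IsWordPartition fun a => z (π a) :=
        ⟨fun a b hab => hz.1 _ _ (π.injective.ne hab), fun x => by
          obtain ⟨a, ha⟩ := hz.2 x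
          exact ⟨π.symm a, by simpa using ha⟩⟩
      have hzi : z (π i) = v ++ [false] := by rw [hπi, hk]
      have hzj : z (π j) = v ++ [true] := by rw [hπj, hl]
      have hsg : ∀ a x, (s * g) • prependWord (w a) x = prependWord (z (π a)) x := fun a x => by
        rw [mul_smul, hg, hsx]
      refine (mul_mem_cancel_left hs).1 (ih {a // a ≠ j} ?_ _ _ (hw.merge hij hi hj)
        (hzπ.merge hij hzi hzj) (s * g) ?_)
      · have := Nat.card_congr (Equiv.optionSubtypeNe j)
        rw [Finite.card_option, hcard] at this
        lia
      · rintro ⟨a, ha⟩ x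
        by_cases hai : a = i
        · simp only [hai, if_true]
          obtain ⟨b, y, hy⟩ := exists_prependWord_append_singleton [] x
          have hy' : x = prependWord [b] y := hy
          rw [hy', ← prependWord_append, ← prependWord_append]
          cases b
          · rw [← hi, ← hzi, hsg]
          · rw [← hj, ← hzj, hsg]
        · simpa only [hai, if_false] using hsg a x

/-- Thompson's group `V` is generated by the prefix exchanges of two disjoint cylinders. -/
theorem eq_top_of_wordSwap_mem {S : Subgroup ThompsonV}
    (hS : ∀ (u v : List Bool) (h : Disjoint (wordCylinder u) (wordCylinder v)), wordSwap h ∈ S) :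
    S = ⊤ := by
  refine eq_top_iff.2 fun g _ => ?_
  obtain ⟨n, w, z, hw, hz, h⟩ := g.2
  have hp : ∀ {w : Fin n → List Bool}, IsCylinderPartition w → IsWordPartition w := fun hw =>
    ⟨hw.1, fun x => Set.mem_iUnion.1 (hw.2 ▸ Set.mem_univ x)⟩
  exact mem_of_isWordPartition hS _ (Fin n) rfl w z (hp hw) (hp hz) g h

end Generation

/-! ### Simplicity of Thompson's group `V` -/

section Simplicity

/-- Distinct points lie in disjoint small cylinders. -/
theorem exists_disjoint_wordCylinder {x y : BinaryCantor} (h : x ≠ y) {O U : Set BinaryCantor}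
    (hO : O ∈ 𝓝 x) (hU : U ∈ 𝓝 y) (N : ℕ) :
    ∃ u v s t, N ≤ u.length ∧ prependWord u s = x ∧ prependWord v t = y ∧
      wordCylinder u ⊆ O ∧ wordCylinder v ⊆ U ∧ Disjoint (wordCylinder u) (wordCylinder v) := by
  obtain ⟨A, B, hA, hB, hxA, hyB, hAB⟩ := t2_separation h
  obtain ⟨u, s, hN, hu, huO⟩ := exists_word_subset (inter_mem hO (hA.mem_nhds hxA)) N
  obtain ⟨v, t, -, hv, hvU⟩ := exists_word_subset (inter_mem hU (hB.mem_nhds hyB)) 0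
  exact ⟨u, v, s, t, hN, hu, hv, huO.trans Set.inter_subset_left, hvU.trans Set.inter_subset_left,
    hAB.mono (huO.trans Set.inter_subset_right) (hvU.trans Set.inter_subset_right)⟩

instance isMinimal_ThompsonV : MulAction.IsMinimal ThompsonV BinaryCantor where
  dense_orbit x y := by
    refine mem_closure_iff_nhds.2 fun O hO => ?_
    by_cases hxy : x = y
    · exact ⟨y, mem_of_mem_nhds hO, 1, by rw [hxy]; exact one_smul _ _⟩
    · obtain ⟨u, v, s, t, -, rfl, rfl, -, hv, huv⟩ :=
        exists_disjoint_wordCylinder hxy univ_mem hO 0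
      exact ⟨prependWord v s, hv (prependWord_mem v s), wordSwap huv, wordSwap_smul_left huv s⟩

instance infinite_ThompsonV : Infinite ThompsonV := by
  by_contra hfin
  rw [not_infinite_iff_finite] at hfin
  have hx := MulAction.dense_orbit ThompsonV (fun _ => false : BinaryCantor)
  have horb : (MulAction.orbit ThompsonV (fun _ => false : BinaryCantor)).Finite :=
    Set.finite_range _
  rw [dense_iff_closure_eq, horb.isClosed.closure_eq] at hx
  exact Set.infinite_univ (hx ▸ horb)

/-- A prefix exchange is the commutator of two elements with the same support. -/
theorem exists_wordSwap_eq_commutator {u v : List Bool}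
    (h : Disjoint (wordCylinder u) (wordCylinder v)) :
    ∃ a b : ThompsonV, wordSwap h = ⁅a, b⁆ ∧
      (∀ x ∉ wordCylinder u ∪ wordCylinder v, a • x = x) ∧
      ∀ x ∉ wordCylinder u ∪ wordCylinder v, b • x = x := by
  have hft := fun w => disjoint_wordCylinder_append_singleton w (show false ≠ true by decide)
  set a := wordSwap (disjoint_wordCylinder_append h [false] [false]) with ha
  set b := wordSwap (hft u) * wordSwap (hft v) with hb
  have hbab : b * a * b⁻¹ = wordSwap (disjoint_wordCylinder_append h [true] [true]) := by
    refine conj_wordSwap _ _ (fun x => ?_) fun x => ?_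
    · rw [hb, mul_smul, wordSwap_smul_of_disjoint _ (disjoint_wordCylinder_append h _ _)
        (disjoint_wordCylinder_append h _ _), wordSwap_smul_left]
    · rw [hb, mul_smul, wordSwap_smul_left, wordSwap_smul_of_disjoint _
        (disjoint_wordCylinder_append h.symm _ _) (disjoint_wordCylinder_append h.symm _ _)]
  have hn : ∀ {x}, x ∉ wordCylinder u ∪ wordCylinder v → ∀ c,
      x ∉ wordCylinder (u ++ [c]) ∧ x ∉ wordCylinder (v ++ [c]) := fun hx c =>
    ⟨fun h => hx (Or.inl (wordCylinder_append_subset _ _ h)),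
      fun h => hx (Or.inr (wordCylinder_append_subset _ _ h))⟩
  refine ⟨a, b, ?_, fun x hx => ?_, fun x hx => ?_⟩
  · rw [commutatorElement_def, ha, wordSwap_inv, ← ha, mul_assoc a, mul_assoc a, hbab]
    exact wordSwap_eq_mul h
  · exact wordSwap_smul_of_notMem _ (hn hx _).1 (hn hx _).2
  · rw [hb, mul_smul, wordSwap_smul_of_notMem _ (hn hx _).2 (hn hx _).2,
      wordSwap_smul_of_notMem _ (hn hx _).1 (hn hx _).1]

/-- Among the eight words of length `3`, at least four have cylinders disjoint from those of four
given words. -/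
theorem exists_disjoint_of_length_ge (ws : Finset (List Bool)) (hcard : ws.card ≤ 4)
    (hlen : ∀ w ∈ ws, 3 ≤ w.length) :
    ∃ c : List Bool, ∀ w ∈ ws, Disjoint (wordCylinder w) (wordCylinder c) := by
  classical
  obtain ⟨c, hc⟩ : ∃ c : List.Vector Bool 3, c.1 ∉ ws.image (List.take 3) := by
    by_contra! hcon
    have h1 : (Finset.univ.image fun c : List.Vector Bool 3 => c.1) ⊆ ws.image (List.take 3) := by
      intro c hc
      obtain ⟨c, -, rfl⟩ := Finset.mem_image.1 hc
      exact hcon c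
    have h2 := Finset.card_le_card h1
    rw [Finset.card_image_of_injective (f := fun c : List.Vector Bool 3 => c.1) _
      (fun _ _ h => Subtype.ext h), Finset.card_univ, card_vector] at h2
    have h3 : (ws.image (List.take 3)).card ≤ ws.card := Finset.card_image_le
    simp at h2
    lia
  refine ⟨c.1, fun w hw => ?_⟩
  have h1 : (w.take 3).length = c.1.length := by
    rw [List.length_take, min_eq_left (hlen w hw)]
    exact c.2.symm
  rw [← List.take_append_drop 3 w]
  have h2 := disjoint_wordCylinder_of_length_eq h1 fun h => hc (h ▸ Finset.mem_image_of_mem _ hw)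
  exact h2.mono_left (wordCylinder_append_subset _ _)

/-- Prefix exchanges of small cylinders are conjugate as soon as a third pair of cylinders is
disjoint from all of them. -/
theorem wordSwap_mem_of_mem {N : Subgroup ThompsonV} (hN : N.Normal) {u v a b : List Bool}
    (huv : Disjoint (wordCylinder u) (wordCylinder v))
    (hab : Disjoint (wordCylinder a) (wordCylinder b)) (hu : 3 ≤ u.length) (hv : 3 ≤ v.length)
    (ha : 3 ≤ a.length) (hb : 3 ≤ b.length) (h : wordSwap hab ∈ N) : wordSwap huv ∈ N := by
  obtain ⟨c, hc⟩ := exists_disjoint_of_length_ge {u, v, a, b} Finset.card_le_four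
    (by simp [hu, hv, ha, hb])
  have hft := disjoint_wordCylinder_append_singleton c (show false ≠ true by decide)
  have hc' : ∀ w ∈ ({u, v, a, b} : Finset _), ∀ d, Disjoint (wordCylinder w)
      (wordCylinder (c ++ [d])) := fun w hw d =>
    (hc w hw).mono_right (wordCylinder_append_subset _ _)
  have key : ∀ {s t : List Bool} (hst : Disjoint (wordCylinder s) (wordCylinder t)),
      (∀ d, Disjoint (wordCylinder s) (wordCylinder (c ++ [d]))) →
      (∀ d, Disjoint (wordCylinder t) (wordCylinder (c ++ [d]))) →
      ∃ g : ThompsonV, g * wordSwap hst * g⁻¹ = wordSwap hft := fun {s t} hst hs ht => by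
    refine ⟨wordSwap (hs false) * wordSwap (ht true), conj_wordSwap _ _ (fun x => ?_) fun x => ?_⟩
    · rw [mul_smul, wordSwap_smul_of_disjoint _ hst (hs true), wordSwap_smul_left]
    · rw [mul_smul, wordSwap_smul_left, wordSwap_smul_of_disjoint _ (hs true).symm hft.symm]
  obtain ⟨g, hg⟩ := key huv (hc' u (by simp)) (hc' v (by simp))
  obtain ⟨k, hk⟩ := key hab (hc' a (by simp)) (hc' b (by simp))
  have h1 := hN.conj_mem _ (hN.conj_mem _ h k) g⁻¹
  rw [hk, ← hg] at h1
  convert h1 using 1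
  group

instance isSimpleGroup_ThompsonV : IsSimpleGroup ThompsonV := by
  refine ⟨fun N hN => or_iff_not_imp_left.2 fun hbot => ?_⟩
  obtain ⟨δ, hδN, hδ⟩ := N.bot_or_exists_ne_one.resolve_left hbot
  obtain ⟨x, hx⟩ : ∃ x : BinaryCantor, δ • x ≠ x := by
    by_contra! hcon
    exact hδ (ThompsonV.ext fun x => by rw [hcon, one_smul])
  obtain ⟨A, B, hA, hB, hxA, hxB, hAB⟩ := t2_separation hx
  obtain ⟨p, t, hp, -, hpO⟩ := exists_word_subset
    ((hB.inter (hA.preimage (continuous_const_smul δ))).mem_nhds ⟨hxB, hxA⟩) 3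
  have hft := disjoint_wordCylinder_append_singleton p (show false ≠ true by decide)
  have hpN : wordSwap hft ∈ N := by
    obtain ⟨a, b, hab, ha, hb⟩ := exists_wordSwap_eq_commutator hft
    rw [← wordCylinder_eq_union (by decide)] at ha hb
    rw [hab]
    exact commutator_mem_of_moves_off (X := BinaryCantor) hN hδN (fun y hy hy' =>
      Set.disjoint_left.1 hAB (hpO hy).2 (hpO hy').1) ha hb
  -- split the cylinders until they are small enough
  have key : ∀ n ≤ 3, ∀ (u v : List Bool) (h : Disjoint (wordCylinder u) (wordCylinder v)),
      3 ≤ u.length + n → 3 ≤ v.length + n → wordSwap h ∈ N := by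
    intro n
    induction n with
    | zero =>
      intro _ u v h hu hv
      exact wordSwap_mem_of_mem hN h hft hu hv (by simp; lia) (by simp; lia) hpN
    | succ n ih =>
      intro hn u v h hu hv
      rw [wordSwap_eq_mul h]
      exact mul_mem (ih (by lia) _ _ _ (by simp; lia) (by simp; lia))
        (ih (by lia) _ _ _ (by simp; lia) (by simp; lia))
  exact eq_top_of_wordSwap_mem fun u v h => key 3 le_rfl u v h (by lia) (by lia)

end Simplicity

/-! ### Uniformly recurrent subgroups of Thompson's group `V` -/

section Cylinder

/-- The map `φ` transported to the cylinder of `w`, extended by the identity. -/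
noncomputable def cylinderFun (w : List Bool) (φ : BinaryCantor → BinaryCantor) (x : BinaryCantor) :
    BinaryCantor :=
  open Classical in
  if x ∈ wordCylinder w then prependWord w (φ fun n => x (n + w.length)) else x

theorem cylinderFun_prependWord (w : List Bool) (φ : BinaryCantor → BinaryCantor)
    (x : BinaryCantor) : cylinderFun w φ (prependWord w x) = prependWord w (φ x) := by
  rw [cylinderFun, if_pos (prependWord_mem w x)]
  congr 2
  exact funext (prependWord_add w x)

theorem cylinderFun_of_notMem {w : List Bool} (φ : BinaryCantor → BinaryCantor) {x : BinaryCantor}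
    (hx : x ∉ wordCylinder w) : cylinderFun w φ x = x := if_neg hx

theorem cylinderFun_comp (w : List Bool) (φ ψ : BinaryCantor → BinaryCantor) (x : BinaryCantor) :
    cylinderFun w φ (cylinderFun w ψ x) = cylinderFun w (fun y => φ (ψ y)) x := by
  by_cases hx : x ∈ wordCylinder w
  · obtain ⟨y, rfl⟩ := hx
    rw [cylinderFun_prependWord, cylinderFun_prependWord, cylinderFun_prependWord]
  · rw [cylinderFun_of_notMem _ hx, cylinderFun_of_notMem _ hx, cylinderFun_of_notMem _ hx]

theorem cylinderFun_id (w : List Bool) (x : BinaryCantor) : cylinderFun w (fun y => y) x = x := by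
  by_cases hx : x ∈ wordCylinder w
  · obtain ⟨y, rfl⟩ := hx
    rw [cylinderFun_prependWord]
  · rw [cylinderFun_of_notMem _ hx]

theorem HasDepth.cylinderFun {φ : BinaryCantor → BinaryCantor} (hφ : HasDepth φ) (w : List Bool) :
    HasDepth (cylinderFun w φ) := by
  obtain ⟨N, hN⟩ := hφ
  refine ⟨w.length + N, fun u hu => ?_⟩
  by_cases h : ∃ s, u = w ++ s
  · obtain ⟨s, rfl⟩ := h
    obtain ⟨z, hz⟩ := hN s (by simpa using hu)
    exact ⟨w ++ z, fun x => by
      rw [prependWord_append, cylinderFun_prependWord, hz, prependWord_append]⟩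
  · refine ⟨u, fun x => cylinderFun_of_notMem φ ?_⟩
    rintro ⟨y, hy⟩
    exact h (prefix_of_prependWord_eq (by lia) hy)

/-- The action of `V` on the cylinder of `w`, extended by the identity: an embedding of `V` in
itself. -/
noncomputable def cylinderHom (w : List Bool) : ThompsonV →* ThompsonV where
  toFun g := thompsonVOfEquiv
    { toFun := cylinderFun w fun x => g • x
      invFun := cylinderFun w fun x => g⁻¹ • x
      left_inv := fun x => by simp only [cylinderFun_comp, inv_smul_smul, cylinderFun_id]
      right_inv := fun x => by simp only [cylinderFun_comp, smul_inv_smul, cylinderFun_id] }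
    ((hasDepth_smul g).cylinderFun w)
  map_one' := ThompsonV.ext fun x => by
    rw [thompsonVOfEquiv_smul]
    simp only [Equiv.coe_fn_mk, one_smul, cylinderFun_id]
  map_mul' g h := ThompsonV.ext fun x => by
    rw [mul_smul, thompsonVOfEquiv_smul, thompsonVOfEquiv_smul, thompsonVOfEquiv_smul]
    simp only [Equiv.coe_fn_mk, mul_smul, cylinderFun_comp]

theorem cylinderHom_smul (w : List Bool) (g : ThompsonV) (x : BinaryCantor) :
    cylinderHom w g • x = cylinderFun w (fun x => g • x) x := rfl

theorem cylinderHom_smul_prependWord (w : List Bool) (g : ThompsonV) (x : BinaryCantor) :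
    cylinderHom w g • prependWord w x = prependWord w (g • x) := cylinderFun_prependWord _ _ _

theorem cylinderHom_injective (w : List Bool) : Function.Injective (cylinderHom w) :=
  fun g h hgh => ThompsonV.ext fun x => prependWord_injective w <| by
    rw [← cylinderHom_smul_prependWord, ← cylinderHom_smul_prependWord, hgh]

theorem smul_prependWord_mem_of_forall_notMem {w : List Bool} {g : ThompsonV}
    (hg : ∀ x ∉ wordCylinder w, g • x = x) (x : BinaryCantor) :
    g • prependWord w x ∈ wordCylinder w := by
  by_contra h
  exact h ((smul_left_cancel g (hg _ h)).symm ▸ prependWord_mem w x)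

theorem mem_range_cylinderHom {w : List Bool} {g : ThompsonV}
    (hg : ∀ x ∉ wordCylinder w, g • x = x) : g ∈ (cylinderHom w).range := by
  have hg' : ∀ x ∉ wordCylinder w, g⁻¹ • x = x := fun x hx => by rw [inv_smul_eq_iff, hg x hx]
  have hdrop : ∀ x ∈ wordCylinder w, prependWord w (fun n => x (n + w.length)) = x := by
    rintro _ ⟨x, rfl⟩
    congr 1
    exact funext (prependWord_add w x)
  have hpre : ∀ x, (fun n => prependWord w x (n + w.length)) = x := fun x =>
    funext (prependWord_add w x)
  let e : BinaryCantor ≃ BinaryCantor :=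
    { toFun := fun x n => (g • prependWord w x) (n + w.length)
      invFun := fun x n => (g⁻¹ • prependWord w x) (n + w.length)
      left_inv := fun x => by
        simp only [hdrop _ (smul_prependWord_mem_of_forall_notMem hg x), inv_smul_smul, hpre]
      right_inv := fun x => by
        simp only [hdrop _ (smul_prependWord_mem_of_forall_notMem hg' x), smul_inv_smul, hpre] }
  have he : ∀ x, prependWord w (e x) = g • prependWord w x := fun x =>
    hdrop _ (smul_prependWord_mem_of_forall_notMem hg x)
  have hdepth : HasDepth e := by
    obtain ⟨N, hN⟩ := exists_smul_prependWord g
    refine ⟨N, fun u hu => ?_⟩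
    obtain ⟨z, hz⟩ := hN (w ++ u) (by simp; lia)
    have hzw : ∀ x, prependWord w (e (prependWord u x)) = prependWord z x := fun x => by
      rw [he, ← prependWord_append, hz]
    obtain ⟨s, rfl⟩ : ∃ s, z = w ++ s := by
      rcases le_total w.length z.length with h | h
      · exact prefix_of_prependWord_eq h (hzw fun _ => false)
      · obtain ⟨s, rfl⟩ := prefix_of_prependWord_eq h (hzw fun _ => false).symm
        have hs : s = [] := eq_nil_of_forall_mem_wordCylinder fun x =>
          ⟨_, prependWord_injective z ((prependWord_append z s _).symm.trans (hzw x))⟩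
        exact ⟨[], by simp [hs]⟩
    exact ⟨s, fun x => prependWord_injective w (by rw [hzw, prependWord_append])⟩
  refine ⟨thompsonVOfEquiv e hdepth, ThompsonV.ext fun x => ?_⟩
  by_cases hx : x ∈ wordCylinder w
  · obtain ⟨y, rfl⟩ := hx
    rw [cylinderHom_smul_prependWord, thompsonVOfEquiv_smul, he]
  · rw [hg x hx, cylinderHom_smul, cylinderFun_of_notMem _ hx]

/-- The complement of a cylinder can be compressed into any smaller cylinder. -/
theorem exists_compress_compl_wordCylinder (w t : List Bool) :
    ∃ h : ThompsonV, (∀ x ∉ wordCylinder w, h • x ∈ wordCylinder (w ++ t)) ∧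
      ∀ x ∈ wordCylinder w, x ∉ wordCylinder (w ++ t) → h • x = x := by
  induction w using List.reverseRecOn generalizing t with
  | nil => exact ⟨1, fun x hx => absurd ⟨x, rfl⟩ hx, fun x _ _ => one_smul _ _⟩
  | append_singleton w b ih =>
    obtain ⟨h, h1, h2⟩ := ih ([b] ++ t ++ [false])
    rw [show w ++ ([b] ++ t ++ [false]) = w ++ [b] ++ t ++ [false] by simp] at h1 h2
    have hb : (!b) ≠ b := by cases b <;> decide
    have hbt : Disjoint (wordCylinder (w ++ [!b])) (wordCylinder (w ++ [b] ++ t)) :=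
      (disjoint_wordCylinder_append_singleton w hb).mono_right (wordCylinder_append_subset _ _)
    have hbt' : ∀ c, Disjoint (wordCylinder (w ++ [!b])) (wordCylinder (w ++ [b] ++ t ++ [c])) :=
      fun c => hbt.mono_right (wordCylinder_append_subset _ _)
    have hft := disjoint_wordCylinder_append_singleton (w ++ [b] ++ t)
      (show false ≠ true by decide)
    refine ⟨wordSwap (hbt' true) * h, fun x hx => ?_, fun x hx hxt => ?_⟩
    · rw [mul_smul]
      by_cases hxw : x ∈ wordCylinder w
      · rw [wordCylinder_eq_union hb] at hxw
        obtain ⟨y, rfl⟩ := hxw.resolve_right hx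
        rw [h2 _ (prependWord_append_mem _ _ _)
          (Set.disjoint_left.1 (hbt' false) (prependWord_mem _ _)), wordSwap_smul_left]
        exact prependWord_append_mem _ _ _
      · obtain ⟨y, hy⟩ := h1 x hxw
        rw [← hy, wordSwap_smul_of_disjoint _ (hbt' false).symm hft]
        exact prependWord_append_mem _ _ _
    · rw [mul_smul, h2 x (wordCylinder_append_subset _ _ hx)
        fun h => hxt (wordCylinder_append_subset _ _ h)]
      refine wordSwap_smul_of_notMem _ (fun h => ?_)
        fun h => hxt (wordCylinder_append_subset _ _ h)
      exact Set.disjoint_left.1 (disjoint_wordCylinder_append_singleton w hb) h hx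

end Cylinder

section V

theorem exists_eventually_notMem_wordCylinder {w : List Bool} {f : ThompsonV}
    (hf : f ∈ germStabilizer ThompsonV (prependWord w fun _ => false)) :
    ∀ᶠ n in atTop, ∀ x ∈ wordCylinder (w ++ List.replicate n false), f • x = x := by
  obtain ⟨u, y, -, hu, hsub⟩ := exists_word_subset (mem_germStabilizer.1 hf) 0
  filter_upwards [eventually_ge_atTop u.length] with n hn x hx
  have hrep : ∀ n, prependWord (List.replicate n false) (fun _ => false) = fun _ => false := by
    intro n
    induction n with
    | zero => rfl
    | succ n ih =>
      rw [List.replicate_succ, prependWord, ih]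
      funext m
      cases m <;> rfl
  have h1 : prependWord u y = prependWord (w ++ List.replicate n false) fun _ => false := by
    rw [prependWord_append, hrep, hu]
  obtain ⟨s, hs⟩ := prefix_of_prependWord_eq (by simp; lia) h1
  exact hsub (wordCylinder_append_subset u s (hs ▸ hx))

/-- Every uniformly recurrent subgroup other than the trivial one has a member that contains a germ
stabilizer. -/
theorem IsURS.exists_germStabilizer_le_ThompsonV {A : Set (Subgroup ThompsonV)} (hA : IsURS A)
    (h : A ≠ {⊥}) : ∃ K ∈ A, ∃ x : BinaryCantor, germStabilizer ThompsonV x ≤ K := by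
  have hrigid : ∀ O : Set BinaryCantor, IsOpen O → O.Nonempty →
      ∃ Γ ∈ {Γ | ∃ w, Γ = (cylinderHom w).range},
      IsSimpleGroup Γ ∧ Infinite Γ ∧ ∀ l ∈ Γ, ∀ x ∉ O, l • x = x := by
    rintro O hO ⟨x, hx⟩
    obtain ⟨w, y, -, -, hw⟩ := exists_word_subset (hO.mem_nhds hx) 0
    have e : ThompsonV ≃* (cylinderHom w).range := MonoidHom.ofInjective (cylinderHom_injective w)
    refine ⟨_, ⟨w, rfl⟩, e.symm.isSimpleGroup, Infinite.of_injective _ e.injective, ?_⟩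
    rintro _ ⟨g, rfl⟩ x hx
    exact cylinderFun_of_notMem _ fun h => hx (hw h)
  obtain ⟨H, hH, _, ⟨w, rfl⟩, hle⟩ := hA.exists_rigid_le hrigid h
  choose g hg using fun n : ℕ => exists_compress_compl_wordCylinder w (List.replicate n false)
  let U : Ultrafilter ℕ := Ultrafilter.of atTop
  refine ⟨ultrafilterLimit U fun n => conjSubgroup (g n) H,
    ultrafilterLimit_mem hA.isClosed fun n => hA.invariant _ H hH,
    prependWord w fun _ => false, fun f hf => ?_⟩
  rw [mem_ultrafilterLimit]
  filter_upwards [(exists_eventually_notMem_wordCylinder hf).filter_mono (Ultrafilter.of_le _)]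
    with n hn
  rw [mem_conjSubgroup]
  refine hle (mem_range_cylinderHom fun x hx => ?_)
  rw [mul_smul, mul_smul, hn _ ((hg n).1 x hx), inv_smul_smul]

theorem exists_germStabilizer_smul_ne {x y : BinaryCantor} (hxy : x ≠ y) :
    ∃ k ∈ germStabilizer ThompsonV y, k • x ≠ x ∧ k • x ≠ y := by
  obtain ⟨z, hz⟩ := (Set.toFinite ({x, y} : Set BinaryCantor)).exists_notMem
  rw [Set.mem_insert_iff, Set.mem_singleton_iff, not_or] at hz
  obtain ⟨u, v, s, t, -, rfl, rfl, hu, hv, huv⟩ := exists_disjoint_wordCylinder (Ne.symm hz.1)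
    (isOpen_ne.mem_nhds hxy) (isOpen_ne.mem_nhds hz.2) 0
  refine ⟨wordSwap huv, wordSwap_mem_germStabilizer huv (fun h => hu h rfl) (fun h => hv h rfl),
    ?_, ?_⟩
  · rw [wordSwap_smul_left]
    intro h
    exact Set.disjoint_left.1 huv (prependWord_mem u s) (h ▸ prependWord_mem v s)
  · rw [wordSwap_smul_left]
    exact hv (prependWord_mem v s)

/-- The germ stabilizers of two distinct points generate `V`. -/
theorem eq_top_of_two_germStabilizer_le {K : Subgroup ThompsonV} {x y : BinaryCantor}
    (hxy : x ≠ y) (hx : germStabilizer ThompsonV x ≤ K) (hy : germStabilizer ThompsonV y ≤ K) :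
    K = ⊤ := by
  have key : ∀ g : ThompsonV, g • x ≠ x → g • x ≠ y → g ∈ K := by
    intro g hgx hgy
    obtain ⟨N, hN⟩ := exists_smul_prependWord g
    have hO : {y}ᶜ ∩ (g • ·) ⁻¹' {y}ᶜ ∈ 𝓝 x :=
      inter_mem (isOpen_ne.mem_nhds hxy)
        ((continuous_const_smul g).continuousAt.preimage_mem_nhds (isOpen_ne.mem_nhds hgy))
    obtain ⟨A, B, hA, hB, hxA, hxB, hAB⟩ := t2_separation hgx
    obtain ⟨p, t, hp, rfl, hpO⟩ := exists_word_subset (inter_mem hO ((hB.inter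
      (hA.preimage (continuous_const_smul g))).mem_nhds ⟨hxB, hxA⟩)) N
    obtain ⟨q, hq⟩ := hN p hp
    have hpq : Disjoint (wordCylinder p) (wordCylinder q) := by
      rw [Set.disjoint_right]
      rintro _ ⟨s, rfl⟩ hs
      rw [← hq] at hs
      exact Set.disjoint_left.1 hAB (hpO (prependWord_mem p s)).2.2 (hpO hs).2.1
    have hyp : y ∉ wordCylinder p := fun h => (hpO h).1.1 rfl
    have hyq : y ∉ wordCylinder q := by
      rintro ⟨s, hs⟩
      rw [← hq] at hs
      exact (hpO (prependWord_mem p s)).1.2 hs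
    have h1 : wordSwap hpq ∈ K := hy (wordSwap_mem_germStabilizer hpq hyp hyq)
    have h2 : wordSwap hpq * g ∈ K := hx <| by
      rw [mem_germStabilizer]
      filter_upwards [(isOpen_wordCylinder p).mem_nhds (prependWord_mem p t)] with z hz
      obtain ⟨s, rfl⟩ := hz
      rw [mul_smul, hq, wordSwap_smul_right]
    exact (mul_mem_cancel_left h1).1 h2
  refine eq_top_iff.2 fun g _ => ?_
  by_cases hgx : g • x = x
  · obtain ⟨k, hk, hkx, hky⟩ := exists_germStabilizer_smul_ne hxy
    exact (mul_mem_cancel_left (hy hk)).1 (key (k * g) (by rwa [mul_smul, hgx])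
      (by rwa [mul_smul, hgx]))
  by_cases hgy : g • x = y
  · obtain ⟨k, hk, hkx, hky⟩ := exists_germStabilizer_smul_ne hxy.symm
    exact (mul_mem_cancel_left (hx hk)).1 (key (k * g) (by rwa [mul_smul, hgy])
      (by rwa [mul_smul, hgy]))
  exact key g hgx hgy

/-- The indicator sequence of the squares, which is not eventually periodic. -/
noncomputable def squareSequence : BinaryCantor :=
  open Classical in fun n => decide (IsSquare n)

theorem eq_zero_of_squareSequence_periodic {d N : ℕ}
    (h : ∀ n ≥ N, squareSequence (n + d) = squareSequence n) : d = 0 := by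
  by_contra hd
  set m := N + d with hm
  have h1 := h (m * m) (by nlinarith)
  have h2 : IsSquare (m * m) := ⟨m, rfl⟩
  simp only [squareSequence, h2, decide_true, decide_eq_true_eq] at h1
  obtain ⟨k, hk⟩ := h1
  have h3 : m < k := by nlinarith [Nat.pos_of_ne_zero hd]
  nlinarith

/-- An element of `V` that fixes a sequence that is not eventually periodic is trivial near it. -/
theorem stabilizer_le_germStabilizer_squareSequence :
    MulAction.stabilizer ThompsonV squareSequence ≤ germStabilizer ThompsonV squareSequence := by
  intro g hg
  have hg' : g • squareSequence = squareSequence := hg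
  obtain ⟨N, hN⟩ := exists_smul_prependWord g
  obtain ⟨w, y, hw, hy⟩ := exists_prependWord N squareSequence
  obtain ⟨z, hz⟩ := hN w hw.ge
  have hzy : prependWord z y = prependWord w y := by rw [← hz, hy, hg']
  -- comparing the prefixes `w` and `z`, the sequence `y` is periodic unless `w = z`
  have hnil : ∀ {u s : List Bool}, prependWord (u ++ s) y = prependWord u y → s = [] := by
    intro u s h
    rw [prependWord_append] at h
    have hs := prependWord_injective u h
    refine List.eq_nil_of_length_eq_zero (eq_zero_of_squareSequence_periodic (N := w.length)
      fun n hn => ?_)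
    obtain ⟨k, rfl⟩ := Nat.exists_eq_add_of_le' hn
    rw [← hy, prependWord_add, show k + w.length + s.length = k + s.length + w.length by ring,
      prependWord_add]
    conv_lhs => rw [← hs]
    exact prependWord_add s y k
  have hwz : z = w := by
    rcases le_total w.length z.length with h | h
    · obtain ⟨s, rfl⟩ := prefix_of_prependWord_eq h hzy.symm
      rw [hnil hzy, List.append_nil]
    · obtain ⟨s, rfl⟩ := prefix_of_prependWord_eq h hzy
      rw [hnil hzy.symm, List.append_nil]
  rw [mem_germStabilizer, ← hy]
  filter_upwards [(isOpen_wordCylinder w).mem_nhds (prependWord_mem w y)] with x hx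
  obtain ⟨x, rfl⟩ := hx
  rw [hz, hwz]

theorem isURS_ThompsonV_iff (A : Set (Subgroup ThompsonV)) :
    IsURS A ↔ A = {⊥} ∨ A = {⊤} ∨ A = stabilizerURS ThompsonV BinaryCantor := by
  refine isURS_iff_of_between ⟨_, stabilizer_le_germStabilizer_squareSequence⟩ (fun A hA => ?_) A
  refine or_iff_not_imp_left.2 fun h => ?_
  obtain ⟨K, hKA, x, hK⟩ := hA.exists_germStabilizer_le_ThompsonV h
  by_cases hfix : K ≤ MulAction.stabilizer ThompsonV x
  · exact Or.inr ⟨K, hKA, x, hK, hfix⟩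
  · obtain ⟨g, hg, hgx⟩ := SetLike.not_le_iff_exists.1 hfix
    have hgx' : x ≠ g • x := fun h => hgx h.symm
    refine Or.inl (hA.eq_singleton inferInstance ?_)
    rwa [← eq_top_of_two_germStabilizer_le hgx' hK fun f hf => ?_]
    rw [← conj_mem_germStabilizer] at hf
    have := mul_mem (mul_mem hg (hK hf)) (inv_mem hg)
    convert this using 1
    group

end V

/-- Classification of the URS's of Thompson's groups. A normal subgroup `N` is identified with the
URS `{N}`. -/
theorem theorem4p11 :
    ((∀ A : Set (Subgroup ThompsonF),
        IsURS A ↔ ∃ N : Subgroup ThompsonF, N.Normal ∧ A = {N}) ∧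
      (∀ A : Set (Subgroup (commutator ThompsonF)), IsURS A ↔ A = {⊥} ∨ A = {⊤})) ∧
    (∀ A : Set (Subgroup ThompsonT),
      IsURS A ↔ A = {⊥} ∨ A = {⊤} ∨ A = stabilizerURS ThompsonT UnitAddCircle) ∧
    (∀ A : Set (Subgroup ThompsonV),
      IsURS A ↔ A = {⊥} ∨ A = {⊤} ∨ A = stabilizerURS ThompsonV BinaryCantor) := by
  exact ⟨⟨isURS_ThompsonF_iff, isURS_commutator_ThompsonF_iff⟩, isURS_ThompsonT_iff,
    isURS_ThompsonV_iff⟩
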